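/- For a field $K$ of characteristic $0$ and $n\ge 1$ let $K_n=K[x_1,\dots,x_n]$. For an algebraically closed extension field $E$ of $K$, a finite set $S\subset K_n[Y]$ and $D\in K_n[Y]$, let $\mathrm{Zero}(S/D)$ be the set of points of $E^{n+1}$ at which all elements of $S$ vanish and $D$ does not vanish. For $\Psi\in K_n[Y]$ of positive degree in $Y$, the initial $\mathrm{ini}(\Psi)\in K_n$ is its leading coefficient with respect to $Y$ and the separant is $S_\Psi=\partial\Psi/\partial Y$; $\deg$ denotes the total degree in all the variables $x_1,\dots,x_n,Y$. **Lemma (squarefree quasi-GCD).** There is an algorithm, and there are polynomials $P,Q\in\mathbb{N}[z]$ and $T\in\mathbb{N}[z_1,z_2]$, none of them depending on anything, with the following property. For all $K$ as above, all $n\ge 1$, $k\ge 0$ and $d$, and all $h_0,\dots,h_k\in K_n[Y]$ with $\deg h_i<d$, written $h_i=\sum_{j=0}^{d-1}h_{i,j}Y^j$ with $h_{i,j}\in K_n$, the algorithm computes from $n,d,h_0,\dots,h_k$ polynomials $\Psi_q\in K_n[Y]\setminus K_n$ and $g_{q,t}\in K_n$ ($1\le q\le N_1$, $0\le t\le N_2$)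 such that 1. over every algebraically closed extension field $E$ of $K$, $$\mathrm{Zero}(h_1,\dots,h_k/h_0)=\bigcup_{q=1}^{N_1}\mathrm{Zero}(\Psi_q,g_{q,1},\dots,g_{q,N_2}/g_{q,0})\ \cup\ \mathrm{Zero}(\{h_{i,j}: 1\le i\le k,\ 0\le j<d\}/h_0);$$ 2. for every $q$, $\mathrm{ini}(\Psi_q)$ divides $g_{q,0}$ in $K_n$, and $S_{\Psi_q}$ vanishes at no point of $\mathrm{Zero}(\Psi_q,g_{q,1},\dots,g_{q,N_2}/g_{q,0})$, over every such $E$; 3. $\deg\Psi_q\le P(d)$ and $\deg g_{q,t}\le P(d)$ for all $q,t$, and $N_1,N_2\le k\,Q(d^n)$; 4. the running time is at most $T(k,d^n)$. Here an algorithm is a program over finite binary trees with leaves that are empty or elements of $K$; building or opening a pair, a field operation, producing the constants $0$ and $1$, a test of a field element for zero, and a branch cost one step each. A polynomial in $K_n$ is given as the list of its nonzero terms (coefficient and exponent vector, each monomial once, in any order, exponents in unary), a polynomial in $K_n[Y]$ as the list of its coefficients with respect to $Y$ from degree $0$ up to its degree, and $n$ and $d$ are given in unary. -/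

import Mathlib

universe u v

namespace QuasiGCD

/-! ### Computation over a field

Programs manipulate finite binary trees whose leaves are `nil` or elements of a field `K`. A program
contains no constants from `K` other than `0` and `1`, and does not depend on `K`. Every elementary
operation (building or opening a pair, a field operation, a zero test, a branch) costs one step. -/

/-- The data on which programs work. -/
inductive Val (K : Type u) : Type u
  | nil : Val K
  | fld : K → Val K
  | cons : Val K → Val K → Val K

/-- The elementary operations. -/
inductive Prim : Type
  | nil | zero | one | fst | snd | add | sub | mul | inv | isZero

open Classical in
/-- The effect of an elementary operation. Ill-typed arguments give `nil`. The Boolean values are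
`nil` (false) and everything else (true). -/
noncomputable def Prim.app {K : Type u} [Field K] : Prim → Val K → Val K
  | .nil, _ => .nil
  | .zero, _ => .fld 0
  | .one, _ => .fld 1
  | .fst, .cons x _ => x
  | .snd, .cons _ y => y
  | .add, .cons (.fld a) (.fld b) => .fld (a + b)
  | .sub, .cons (.fld a) (.fld b) => .fld (a - b)
  | .mul, .cons (.fld a) (.fld b) => .fld (a * b)
  | .inv, .fld a => .fld a⁻¹
  | .isZero, .fld a => if a = 0 then .cons .nil .nil else .nil
  | _, _ => .nil

/-- Programs: elementary operations, the identity, composition (`comp p q` runs `q` first), pairing,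
branching on a test and iteration while a test is true. -/
inductive Prog : Type
  | prim : Prim → Prog
  | skip : Prog
  | comp : Prog → Prog → Prog
  | pair : Prog → Prog → Prog
  | branch : Prog → Prog → Prog → Prog
  | loop : Prog → Prog → Prog

/-- `p.Runs x y t`: on input `x`, the program `p` halts with output `y` after exactly `t` steps. -/
inductive Prog.Runs {K : Type u} [Field K] : Prog → Val K → Val K → ℕ → Prop
  | prim (o : Prim) (x : Val K) : Prog.Runs (.prim o) x (o.app x) 1
  | skip (x : Val K) : Prog.Runs .skip x x 1
  | comp {p q : Prog} {x y z : Val K} {s t : ℕ} :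
      Prog.Runs q x y s → Prog.Runs p y z t → Prog.Runs (.comp p q) x z (s + t + 1)
  | pair {p q : Prog} {x y z : Val K} {s t : ℕ} :
      Prog.Runs p x y s → Prog.Runs q x z t → Prog.Runs (.pair p q) x (.cons y z) (s + t + 1)
  | branch_true {b p q : Prog} {x w y : Val K} {s t : ℕ} :
      Prog.Runs b x w s → w ≠ .nil → Prog.Runs p x y t →
      Prog.Runs (.branch b p q) x y (s + t + 1)
  | branch_false {b p q : Prog} {x y : Val K} {s t : ℕ} :
      Prog.Runs b x .nil s → Prog.Runs q x y t → Prog.Runs (.branch b p q) x y (s + t + 1)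
  | loop_done {b p : Prog} {x : Val K} {s : ℕ} :
      Prog.Runs b x .nil s → Prog.Runs (.loop b p) x x (s + 1)
  | loop_step {b p : Prog} {x w y z : Val K} {s t r : ℕ} :
      Prog.Runs b x w s → w ≠ .nil → Prog.Runs p x y t → Prog.Runs (.loop b p) y z r →
      Prog.Runs (.loop b p) x z (s + t + r + 1)

/-! ### Encoding of numbers, lists and polynomials -/

/-- A finite list of trees as a tree. -/
def Val.list {K : Type u} : List (Val K) → Val K
  | [] => .nil
  | x :: l => .cons x (Val.list l)

/-- A natural number, in unary. -/
def Val.num {K : Type u} (m : ℕ) : Val K := Val.list (List.replicate m .nil)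

/-- `w` is a sparse representation of `p`: it lists every monomial that occurs in `p` exactly once, in
some order, as a pair of its (nonzero) coefficient and its exponent vector. -/
def IsCodeX {K : Type u} [Field K] {n : ℕ} (w : Val K) (p : MvPolynomial (Fin n) K) : Prop :=
  ∃ l : List (Fin n →₀ ℕ), l.Nodup ∧ (∀ e, e ∈ l ↔ e ∈ p.support) ∧
    w = Val.list (l.map fun e =>
      Val.cons (Val.fld (p.coeff e)) (Val.list (List.ofFn fun i => Val.num (e i))))

/-- The ring `K[x₁, …, xₙ][Y]`. -/
abbrev PolyY (K : Type u) [Field K] (n : ℕ) : Type u := Polynomial (MvPolynomial (Fin n) K)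

/-- `w` lists the coefficients of `p` with respect to `Y`, from degree `0` to the degree of `p` in
`Y`. -/
def IsCodeY {K : Type u} [Field K] {n : ℕ} (w : Val K) (p : PolyY K n) : Prop :=
  ∃ c : Fin (p.natDegree + 1) → Val K,
    (∀ j, IsCodeX (c j) (p.coeff j)) ∧ w = Val.list (List.ofFn c)

/-- `w` encodes the input `n`, `d`, `h₀, …, hₖ`. -/
def IsInput {K : Type u} [Field K] {n k : ℕ} (d : ℕ) (h : Fin (k + 1) → PolyY K n)
    (w : Val K) : Prop :=
  ∃ c : Fin (k + 1) → Val K, (∀ i, IsCodeY (c i) (h i)) ∧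
    w = .cons (.num n) (.cons (.num d) (.list (List.ofFn c)))

/-- `w` encodes the list of the components `(Ψ_q, (g_{q,0}, …, g_{q,N₂}))`. -/
def IsOutput {K : Type u} [Field K] {n N₁ N₂ : ℕ} (Ψ : Fin N₁ → PolyY K n)
    (g : Fin N₁ → Fin (N₂ + 1) → MvPolynomial (Fin n) K) (w : Val K) : Prop :=
  ∃ (a : Fin N₁ → Val K) (b : Fin N₁ → Fin (N₂ + 1) → Val K),
    (∀ q, IsCodeY (a q) (Ψ q)) ∧ (∀ q t, IsCodeX (b q t) (g q t)) ∧
    w = .list (List.ofFn fun q => .cons (a q) (.list (List.ofFn (b q))))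

/-! ### Polynomials and their zeros -/

/-- The total degree in `x₁, …, xₙ, Y`. -/
noncomputable def degXY {K : Type u} [Field K] {n : ℕ} (p : PolyY K n) : ℕ :=
  p.support.sup fun j => (p.coeff j).totalDegree + j

/-- The value of `p` at the point `z = (ξ, η)` of `Eⁿ⁺¹`. -/
noncomputable def valueAt {K : Type u} [Field K] {E : Type v} [Field E] [Algebra K E] {n : ℕ}
    (z : (Fin n → E) × E) (p : PolyY K n) : E :=
  p.eval₂ (MvPolynomial.aeval z.1 : MvPolynomial (Fin n) K →ₐ[K] E).toRingHom z.2

/-- `Zero(S / D)`: the points of `Eⁿ⁺¹` at which all elements of `S` vanish and `D` does not. -/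
def zeroSet {K : Type u} [Field K] (E : Type v) [Field E] [Algebra K E] {n : ℕ}
    (S : Set (PolyY K n)) (D : PolyY K n) : Set ((Fin n → E) × E) :=
  {z | (∀ p ∈ S, valueAt z p = 0) ∧ valueAt z D ≠ 0}

/-- `Zero(Ψ, g₁, …, g_N / g₀)`. -/
def component {K : Type u} [Field K] (E : Type v) [Field E] [Algebra K E] {n N : ℕ}
    (Ψ : PolyY K n) (g : Fin (N + 1) → MvPolynomial (Fin n) K) : Set ((Fin n → E) × E) :=
  zeroSet E (insert Ψ (Set.range fun t : Fin N => Polynomial.C (g t.succ))) (Polynomial.C (g 0))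

end QuasiGCD

open QuasiGCD

/-!
# Squarefree quasi-GCD

**The components.** Fix a point `ξ` at which some coefficient of one of the equations does not
vanish, and let `α` be the first coefficient of this equation, from the top, with `α(ξ) ≠ 0`. If `η`
is a common zero of the equations above `ξ`, then `ζ = α η` is a root of a monic polynomial whose
coefficients are polynomials in `x₁, …, xₙ` (`eval_monicPoly_homog`), and it is a simple root of
some iterated derivative of this polynomial (`exists_iterate_nextList`), which is again monic up to
an integer factor. Let `c` be the lower coefficients of the derivative in question.

Symmetric functions of the values of a polynomial at the roots of a monic polynomial are computed by
Newton's identities, where only integers have to be inverted (`rootSymm_eq_esymm`). In particular,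
this applies to the elementary symmetric functions `sel K c φ α s` of the linear polynomials
`φ(ζ) (α X - ζ)`. For all `s` greater than the number of roots `ζ` with `φ(ζ) ≠ 0` they vanish, and
for `s` equal to this number, `sel K c φ α s` is up to sign the product of the `φ(ζ) (α X - ζ)` with
`φ(ζ) ≠ 0` (`sel_card`). So this construction, which needs no divisions except by integers and no
case distinctions, takes the place of a greatest common divisor. It is used twice:

* For a suitable integer `κ`, the linear combination of the homogenized equations with the powers of
  `κ` as coefficients vanishes at a root `ζ` only if all of them do (`exists_combo_ne_zero`). With
  this combination as `φ`, one obtains a polynomial `w` whose zeros are the roots that do not come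
  from common zeros of the equations.
* With the product of `w`, the next derivative and the homogenized inequation as `φ`, the selected
  roots are precisely the simple roots that come from common zeros at which the inequation holds.
  The result is the polynomial `Ψ` of a component. It is squarefree because the selected roots are
  simple.

**The guesses.** The position of `α`, the number of derivatives, the integer `κ`, and the numbers of
selected roots depend on `ξ`; the algorithm tries all possibilities. All constructions commute with
ring homomorphisms (`map_mkDatum`), so each guess leads to at most one component over
`K[x₁, …, xₙ]`. Its equations `Datum.eqs` say that the symmetric functions of higher index vanish
and that the selected roots come from common zeros of the equations. Therefore a component contains
only solutions, whether or not the guess is the intended one (`sound_mkDatum`), and the right guess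
yields a component through `(ξ, η)` (`complete_mkDatum`). The points `ξ` at which all coefficients
of all equations vanish make up the last part of the decomposition.

**The bounds.** Both this last part and the set of common zeros depend only on the `K`-linear span
of the equations. Gaussian elimination over `K` (`wp_elimP`) thus reduces the number of equations to
a bound that is polynomial in `d ^ n`, and this bounds the number of values of `κ` and of equations
of a component independently of `k`. The degrees of all polynomials involved are at most `d ^ 20`
(`compSize_le_pow`).

**The running time.** Polynomials in `x₁, …, xₙ` are replaced by dense univariate ones by Kronecker
substitution with `M = d ^ 32`, which is injective in the degrees that occur. Programs are verified
by a calculus of weakest preconditions `wp N`, in which every single loop is limited to `N`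
iterations. For a fixed program, this bounds the running time by a fixed polynomial in `N`
(`exists_runs_of_wp`), and `N = (d ^ n) ^ 64 + k + 1` suffices for the program `mainP`.
-/

namespace QuasiGCD

/-! ### Programs with bounded loops -/

/-- Composition of programs in the order of execution. -/
notation:65 p:65 " ⨾ " q:66 => Prog.comp q p

/-- Pairing of programs. -/
infixr:67 " ⊠ " => Prog.pair

/-- A bound for the running time, as a polynomial in a common bound for the numbers of iterations
of all loops. -/
noncomputable def Prog.cost : Prog → Polynomial ℕ
  | .prim _ => 1
  | .skip => 1
  | .comp p q => q.cost + p.cost + 1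
  | .pair p q => p.cost + q.cost + 1
  | .branch b p q => b.cost + p.cost + q.cost + 1
  | .loop b p => (Polynomial.X + 1) * (b.cost + p.cost + 1)

/-! ### Typed lists -/

section lists
variable {K : Type u}

/-- `ListRep ρ l w` says that the tree `w` is a list whose entries represent, with respect to `ρ`,
the entries of `l`. -/
def ListRep {α : Type*} (ρ : α → Val K → Prop) : List α → Val K → Prop
  | [], w => w = .nil
  | a :: l, w => ∃ x y, w = .cons x y ∧ ρ a x ∧ ListRep ρ l y

theorem ListRep.mono {α : Type*} {ρ σ : α → Val K → Prop} {l : List α} :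
    ∀ {w : Val K}, ListRep ρ l w → (∀ a ∈ l, ∀ x, ρ a x → σ a x) → ListRep σ l w := by
  induction l with
  | nil => intro w h _; exact h
  | cons a l ih =>
    rintro w ⟨x, y, rfl, hx, hy⟩ h
    exact ⟨x, y, rfl, h _ (by simp) _ hx, ih hy fun b hb => h b (by simp [hb])⟩

theorem ListRep.nil_iff {α : Type*} {ρ : α → Val K → Prop} {l : List α} {w : Val K}
    (h : ListRep ρ l w) : w = .nil ↔ l = [] := by
  cases l with
  | nil => simpa [ListRep] using h
  | cons a l => obtain ⟨x, y, rfl, -⟩ := h; simp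

theorem listRep_map {α β : Type*} {ρ : β → Val K → Prop} {f : α → β} {l : List α} :
    ∀ {w : Val K}, ListRep ρ (l.map f) w ↔ ListRep (fun a => ρ (f a)) l w := by
  induction l with
  | nil => intro w; rfl
  | cons a l ih => intro w; simp only [List.map_cons, ListRep, ih]

theorem listRep_iff {α : Type*} {ρ : α → Val K → Prop} {l : List α} :
    ∀ {w : Val K}, ListRep ρ l w ↔ ∃ ws, w = Val.list ws ∧ List.Forall₂ ρ l ws := by
  induction l with
  | nil => intro w; simp [ListRep, Val.list]
  | cons a l ih =>
    intro w
    constructor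
    · rintro ⟨x, y, rfl, hx, hy⟩
      obtain ⟨ws, rfl, h⟩ := ih.1 hy
      exact ⟨x :: ws, rfl, .cons hx h⟩
    · rintro ⟨ws, rfl, h⟩
      cases h with
      | cons hx h => exact ⟨_, _, rfl, hx, ih.2 ⟨_, rfl, h⟩⟩

/-- A counter: a list of which only the length matters. -/
def Counter (m : ℕ) (w : Val K) : Prop := ∃ l : List (Val K), l.length = m ∧ ListRep Eq l w

theorem ListRep.counter {α : Type*} {ρ : α → Val K → Prop} {l : List α} {w : Val K}
    (h : ListRep ρ l w) : Counter l.length w := by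
  obtain ⟨ws, rfl, hl⟩ := listRep_iff.1 h
  refine ⟨ws, hl.length_eq.symm, listRep_iff.2 ⟨ws, rfl, ?_⟩⟩
  exact List.forall₂_same.2 fun _ _ => rfl

theorem Counter.cons {m : ℕ} {x w : Val K} (h : Counter m w) : Counter (m + 1) (.cons x w) := by
  obtain ⟨l, rfl, h⟩ := h
  exact ⟨x :: l, rfl, x, w, rfl, rfl, h⟩

theorem counter_zero : Counter 0 (Val.nil : Val K) := ⟨[], rfl, rfl⟩

theorem counter_num (m : ℕ) : Counter m (Val.num m : Val K) :=
  ⟨List.replicate m .nil, by simp, listRep_iff.2 ⟨_, rfl, List.forall₂_same.2 fun _ _ => rfl⟩⟩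

end lists

section wp
variable {K : Type u} [Field K]

/-- The weakest precondition of a loop of at most `m` iterations, from those of its test and of its
body. -/
def loopWp (b p : Val K → (Val K → Prop) → Prop) : ℕ → Val K → (Val K → Prop) → Prop
  | 0, x, P => b x fun w => w = .nil ∧ P x
  | m + 1, x, P => b x fun w => (w = .nil → P x) ∧ (w ≠ .nil → p x fun y => loopWp b p m y P)

/-- Weakest precondition: `wp N p x P` says that `p` halts on `x` with an output satisfying `P`,
and that no execution of a loop needs more than `N` iterations. -/
def wp (N : ℕ) : Prog → Val K → (Val K → Prop) → Prop
  | .prim o, x, P => P (o.app x)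
  | .skip, x, P => P x
  | .comp p q, x, P => wp N q x fun y => wp N p y P
  | .pair p q, x, P => wp N p x fun y => wp N q x fun z => P (.cons y z)
  | .branch b p q, x, P => wp N b x fun w => (w ≠ .nil → wp N p x P) ∧ (w = .nil → wp N q x P)
  | .loop b p, x, P => loopWp (wp N b) (wp N p) N x P

theorem wp_mono {N : ℕ} {p : Prog} : ∀ {x : Val K} {P P' : Val K → Prop}, wp N p x P →
    (∀ y, P y → P' y) → wp N p x P' := by
  induction p with
  | prim o => intro x P P' h hP; exact hP _ h
  | skip => intro x P P' h hP; exact hP _ h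
  | comp p q ihp ihq => intro x P P' h hP; exact ihq h fun y hy => ihp hy hP
  | pair p q ihp ihq => intro x P P' h hP; exact ihp h fun y hy => ihq hy fun z hz => hP _ hz
  | branch b p q ihb ihp ihq =>
    intro x P P' h hP
    exact ihb h fun w hw => ⟨fun h => ihp (hw.1 h) hP, fun h => ihq (hw.2 h) hP⟩
  | loop b p ihb ihp =>
    have key : ∀ m x (P P' : Val K → Prop), loopWp (wp N b) (wp N p) m x P →
        (∀ y, P y → P' y) → loopWp (wp N b) (wp N p) m x P' := by
      intro m
      induction m with
      | zero => intro x P P' h hP; exact ihb h fun w hw => ⟨hw.1, hP _ hw.2⟩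
      | succ m ih =>
        intro x P P' h hP
        exact ihb h fun w hw => ⟨fun h => hP _ (hw.1 h),
          fun h => ihp (hw.2 h) fun y hy => ih _ _ _ hy hP⟩
    intro x P P' h hP
    exact key N x P P' h hP

/-- The weakest precondition is sound for the operational semantics, with the running time bounded
by `Prog.cost`. -/
theorem exists_runs_of_wp {N : ℕ} {p : Prog} : ∀ {x : Val K} {P : Val K → Prop}, wp N p x P →
    ∃ y t, p.Runs x y t ∧ t ≤ p.cost.eval N ∧ P y := by
  induction p with
  | prim o => intro x P h; exact ⟨_, _, .prim o x, by simp [Prog.cost], h⟩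
  | skip => intro x P h; exact ⟨_, _, .skip x, by simp [Prog.cost], h⟩
  | comp p q ihp ihq =>
    intro x P h
    obtain ⟨y, s, hy, hs, h⟩ := ihq h
    obtain ⟨z, t, hz, ht, h⟩ := ihp h
    exact ⟨z, _, .comp hy hz, by simp [Prog.cost]; omega, h⟩
  | pair p q ihp ihq =>
    intro x P h
    obtain ⟨y, s, hy, hs, h⟩ := ihp h
    obtain ⟨z, t, hz, ht, h⟩ := ihq h
    exact ⟨_, _, .pair hy hz, by simp [Prog.cost]; omega, h⟩
  | branch b p q ihb ihp ihq =>
    intro x P h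
    obtain ⟨w, s, hw, hs, h⟩ := ihb h
    by_cases hn : w = .nil
    · obtain ⟨y, t, hy, ht, h⟩ := ihq (h.2 hn)
      exact ⟨y, _, .branch_false (hn ▸ hw) hy, by simp [Prog.cost]; omega, h⟩
    · obtain ⟨y, t, hy, ht, h⟩ := ihp (h.1 hn)
      exact ⟨y, _, .branch_true hw hn hy, by simp [Prog.cost]; omega, h⟩
  | loop b p ihb ihp =>
    have key : ∀ m x (P : Val K → Prop), loopWp (wp N b) (wp N p) m x P →
        ∃ y t, (Prog.loop b p).Runs x y t ∧
          t ≤ (m + 1) * (b.cost.eval N + p.cost.eval N + 1) ∧ P y := by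
      intro m
      induction m with
      | zero =>
        intro x P h
        obtain ⟨w, s, hw, hs, rfl, h⟩ := ihb h
        exact ⟨x, _, .loop_done hw, by omega, h⟩
      | succ m ih =>
        intro x P h
        obtain ⟨w, s, hw, hs, h⟩ := ihb h
        by_cases hn : w = .nil
        · exact ⟨x, _, .loop_done (hn ▸ hw), by nlinarith, h.1 hn⟩
        · obtain ⟨y, t, hy, ht, h⟩ := ihp (h.2 hn)
          obtain ⟨z, r, hz, hr, h⟩ := ih _ _ h
          exact ⟨z, _, .loop_step hw hn hy hz, by linarith, h⟩
    intro x P h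
    obtain ⟨y, t, hy, ht, h⟩ := key N x P h
    exact ⟨y, t, hy, by simpa [Prog.cost] using ht, h⟩

/-! ### Basic programs -/

/-- First component. -/
abbrev hd : Prog := .prim .fst
/-- Second component. -/
abbrev tl : Prog := .prim .snd
/-- The constant `nil`. -/
abbrev nilP : Prog := .prim .nil

/-- `forT f` maps `(l, s)` to the final state of the loop that replaces the state `s` by
`f (l', s)`, where `l'` runs through the nonempty tails of the list `l`, starting with `l`. -/
def forT (f : Prog) : Prog := .loop hd ((hd ⨾ tl) ⊠ f) ⨾ tl

/-- The loop over the entries of a list: `s` is replaced by `f (x, s)` for each entry `x`. -/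
def each (f : Prog) : Prog := forT (((hd ⨾ hd) ⊠ tl) ⨾ f)

/-- The rule for loops over lists: `Inv l' s` is an invariant for the states `s` in which the tail
`l'` of the list remains to be processed. -/
theorem wp_forT {α : Type*} {ρ : α → Val K → Prop} {N : ℕ} {f : Prog} {l : List α} {w s : Val K}
    {P : Val K → Prop} (Inv : List α → Val K → Prop) (hw : ListRep ρ l w) (hN : l.length ≤ N)
    (h0 : Inv l s)
    (hstep : ∀ a l' x y s, a :: l' <:+ l → ρ a x → ListRep ρ l' y → Inv (a :: l') s →
      wp N f (.cons (.cons x y) s) (Inv l'))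
    (hP : ∀ s, Inv [] s → P s) : wp N (forT f) (.cons w s) P := by
  have key : ∀ m (l' : List α) (w s : Val K), l' <:+ l → l'.length ≤ m → ListRep ρ l' w →
      Inv l' s → loopWp (wp N hd) (wp N ((hd ⨾ tl) ⊠ f)) m (.cons w s) fun y =>
        P (Prim.snd.app y) := by
    intro m
    induction m with
    | zero =>
      intro l' w s _ hl hw hs
      obtain rfl : l' = [] := by simpa using hl
      obtain rfl : w = .nil := hw
      exact ⟨rfl, hP _ hs⟩
    | succ m ih =>
      intro l' w s hsuf hl hw hs
      cases l' with
      | nil =>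
        obtain rfl : w = .nil := hw
        exact ⟨fun _ => hP _ hs, fun h => absurd rfl h⟩
      | cons a l' =>
        obtain ⟨x, y, rfl, hx, hy⟩ := hw
        refine ⟨fun h => by simp [Prim.app] at h, fun _ => ?_⟩
        show wp N f _ _
        refine wp_mono (hstep a l' x y s hsuf hx hy hs) fun z hz => ?_
        exact ih l' y z ((List.suffix_cons a l').trans hsuf) (by simpa using hl) hy hz
  exact key N l w s List.suffix_rfl hN hw h0

theorem wp_each {α : Type*} {ρ : α → Val K → Prop} {N : ℕ} {f : Prog} {l : List α} {w s : Val K}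
    {P : Val K → Prop} (Inv : List α → Val K → Prop) (hw : ListRep ρ l w) (hN : l.length ≤ N)
    (h0 : Inv l s)
    (hstep : ∀ a l' x s, a :: l' <:+ l → ρ a x → Inv (a :: l') s → wp N f (.cons x s) (Inv l'))
    (hP : ∀ s, Inv [] s → P s) : wp N (each f) (.cons w s) P :=
  wp_forT Inv hw hN h0 (fun a l' x _ s hsuf hx _ hs => hstep a l' x s hsuf hx hs) hP

@[simp] theorem app_nil (x : Val K) : Prim.nil.app x = .nil := rfl
@[simp] theorem app_zero (x : Val K) : Prim.zero.app x = .fld 0 := rfl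
@[simp] theorem app_one (x : Val K) : Prim.one.app x = .fld 1 := rfl
@[simp] theorem app_fst (x y : Val K) : Prim.fst.app (.cons x y) = x := rfl
@[simp] theorem app_snd (x y : Val K) : Prim.snd.app (.cons x y) = y := rfl
@[simp] theorem app_add (a b : K) : Prim.add.app (.cons (.fld a) (.fld b)) = .fld (a + b) := rfl
@[simp] theorem app_sub (a b : K) : Prim.sub.app (.cons (.fld a) (.fld b)) = .fld (a - b) := rfl
@[simp] theorem app_mul (a b : K) : Prim.mul.app (.cons (.fld a) (.fld b)) = .fld (a * b) := rfl
@[simp] theorem app_inv (a : K) : Prim.inv.app (.fld a) = .fld a⁻¹ := rfl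
open Classical in
@[simp] theorem app_isZero (a : K) :
    Prim.isZero.app (.fld a) = if a = 0 then .cons .nil .nil else .nil := rfl

/-- Reversal of a list, prepended to another one: `(l, m) ↦ l.reverse ++ m`. -/
def revAppP : Prog := each .skip

theorem wp_revAppP {α : Type*} {ρ : α → Val K → Prop} {N : ℕ} {l m : List α} {w z : Val K}
    (hw : ListRep ρ l w) (hz : ListRep ρ m z) (hN : l.length ≤ N) :
    wp N revAppP (.cons w z) (ListRep ρ (l.reverse ++ m)) := by
  refine wp_each (fun l' s => ∃ m', ListRep ρ m' s ∧ l.reverse ++ m = l'.reverse ++ m') hw hN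
    ⟨m, hz, rfl⟩ ?_ ?_
  · rintro a l' x s - hx ⟨m', hs, h⟩
    exact ⟨a :: m', ⟨x, s, rfl, hx, hs⟩, by simp [h]⟩
  · rintro s ⟨m', hs, h⟩
    rw [h]; simpa using hs

/-- Reversal of a list. -/
def revP : Prog := (.skip ⊠ nilP) ⨾ revAppP

theorem wp_revP {α : Type*} {ρ : α → Val K → Prop} {N : ℕ} {l : List α} {w : Val K}
    (hw : ListRep ρ l w) (hN : l.length ≤ N) : wp N revP w (ListRep ρ l.reverse) := by
  simp only [revP, wp, app_nil]
  simpa using wp_revAppP (m := []) hw rfl hN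

/-- `mapP f` maps `(c, l)` to the list of the `f (c, x)`, for `x` in `l`. -/
def mapP (f : Prog) : Prog :=
  (tl ⊠ (hd ⊠ nilP)) ⨾
  each ((tl ⨾ hd) ⊠ ((((tl ⨾ hd) ⊠ hd) ⨾ f) ⊠ (tl ⨾ tl))) ⨾ tl ⨾ revP

theorem wp_mapP {α β : Type*} {ρ : α → Val K → Prop} {σ : β → Val K → Prop} {g : α → β} {N : ℕ}
    {f : Prog} {l : List α} {w c : Val K} (hw : ListRep ρ l w) (hN : l.length ≤ N)
    (hf : ∀ a ∈ l, ∀ x, ρ a x → wp N f (.cons c x) (σ (g a))) :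
    wp N (mapP f) (.cons c w) (ListRep σ (l.map g)) := by
  simp only [mapP, wp, app_fst, app_snd, app_nil]
  refine wp_each (fun l' s => ∃ m' t, s = .cons c t ∧ ListRep σ m' t ∧
    l.map g = m'.reverse ++ l'.map g) hw hN ⟨[], .nil, rfl, rfl, rfl⟩ ?_ ?_
  · rintro a l' x s hsuf hx ⟨m', t, rfl, ht, h⟩
    simp only [wp, app_fst, app_snd]
    refine wp_mono (hf a (hsuf.subset (by simp)) x hx) fun y hy => ?_
    exact ⟨g a :: m', _, rfl, ⟨y, t, rfl, hy, ht⟩, by simp [h]⟩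
  · rintro s ⟨m', t, rfl, ht, h⟩
    simp only [app_snd]
    have hlen := congrArg List.length h
    simp at hlen h
    rw [h]
    exact wp_revP ht (by omega)

end wp

/-! ### Dense polynomials -/

section ofList
variable {R : Type*} [CommRing R]

/-- The polynomial with the given list of coefficients, the constant one first. -/
noncomputable def ofList : List R → Polynomial R
  | [] => 0
  | a :: l => Polynomial.C a + Polynomial.X * ofList l

theorem coeff_ofList (l : List R) (i : ℕ) : (ofList l).coeff i = l.getD i 0 := by
  induction l generalizing i with
  | nil => simp [ofList]
  | cons a l ih => cases i <;> simp [ofList, ih]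

theorem ofList_append (l m : List R) :
    ofList (l ++ m) = ofList l + Polynomial.X ^ l.length * ofList m := by
  induction l with
  | nil => simp [ofList]
  | cons a l ih => simp only [List.cons_append, ofList, ih, List.length_cons]; ring

theorem ofList_map {S : Type*} [CommRing S] (f : R →+* S) (l : List R) :
    ofList (l.map f) = (ofList l).map f := by
  induction l with
  | nil => simp [ofList]
  | cons a l ih => simp [ofList, ih]

theorem ofList_map_mul (a : R) (l : List R) :
    ofList (l.map fun x => a * x) = Polynomial.C a * ofList l := by
  induction l with
  | nil => simp [ofList]
  | cons b l ih => simp only [List.map_cons, ofList, ih, Polynomial.C_mul]; ring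

/-- Sum of coefficient lists. -/
def addList : List R → List R → List R
  | [], m => m
  | a :: l, [] => a :: l
  | a :: l, b :: m => (a + b) :: addList l m

theorem length_addList (l m : List R) : (addList l m).length = max l.length m.length := by
  induction l generalizing m with
  | nil => simp [addList]
  | cons a l ih => cases m <;> simp [addList, ih]

theorem ofList_addList (l m : List R) : ofList (addList l m) = ofList l + ofList m := by
  induction l generalizing m with
  | nil => simp [addList, ofList]
  | cons a l ih =>
    cases m with
    | nil => simp [addList, ofList]
    | cons b m => simp only [addList, ofList, ih, Polynomial.C_add]; ring

end ofList

/-- Addition of polynomials, given the addition of coefficients. -/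
def polyAdd (add : Prog) : Prog :=
  (hd ⊠ (tl ⊠ nilP)) ⨾
  each (.branch (tl ⨾ hd)
    ((tl ⨾ hd ⨾ tl) ⊠ (((hd ⊠ (tl ⨾ hd ⨾ hd)) ⨾ add) ⊠ (tl ⨾ tl)))
    ((tl ⨾ hd) ⊠ (hd ⊠ (tl ⨾ tl)))) ⨾ (tl ⊠ hd) ⨾ revAppP

/-- Multiplication of polynomials by Horner's scheme, given the ring operations on coefficients. -/
def polyMul (add mul zero : Prog) : Prog :=
  ((hd ⨾ revP) ⊠ (tl ⊠ nilP)) ⨾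
  each ((tl ⨾ hd) ⊠ ((((hd ⊠ (tl ⨾ hd)) ⨾ mapP mul) ⊠ (zero ⊠ (tl ⨾ tl))) ⨾ polyAdd add)) ⨾ tl

section RepPoly
variable {K : Type u}

/-- The representation of polynomials by lists of coefficients, the constant one first. The size
allows `β` additional coefficients per unit. Vanishing leading coefficients are permitted. -/
def RepPoly {R : Type*} [CommRing R] (β : ℕ) (Rep : ℕ → R → Val K → Prop) (D : ℕ)
    (p : Polynomial R) (w : Val K) : Prop :=
  ∃ l : List R, ofList l = p ∧ l.length ≤ D * β + 1 ∧ ListRep (Rep D) l w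

variable {R : Type*} [CommRing R] {β : ℕ} {Rep : ℕ → R → Val K → Prop}

theorem RepPoly.nil {D : ℕ} : RepPoly β Rep D 0 Val.nil := ⟨[], rfl, by simp, rfl⟩

theorem RepPoly.singleton {D : ℕ} {a : R} {w : Val K} (h : Rep D a w) :
    RepPoly β Rep D (Polynomial.C a) (.cons w .nil) :=
  ⟨[a], by simp [ofList], by simp, w, .nil, rfl, h, rfl⟩

end RepPoly

section Impl
variable {K : Type u} [Field K]

/-- The programs `add`, `mul` and `zero` implement the operations of a ring `R`, of which
`Rep D a w` says that the tree `w` represents `a` within the size `D`. Sizes behave like degrees and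
are limited by `Dm`, the numbers of iterations of loops by `N`. -/
structure Impl {R : Type*} [CommRing R] (N Dm : ℕ) (Rep : ℕ → R → Val K → Prop)
    (add mul zero : Prog) : Prop where
  mono : ∀ {D D' a w}, D ≤ D' → Rep D a w → Rep D' a w
  zero : ∀ D x, wp N zero x (Rep D 0)
  add : ∀ {D a b x y}, D ≤ Dm → Rep D a x → Rep D b y → wp N add (.cons x y) (Rep D (a + b))
  mul : ∀ {D D' a b x y}, D + D' ≤ Dm → Rep D a x → Rep D' b y →
    wp N mul (.cons x y) (Rep (D + D') (a * b))

variable {R : Type*} [CommRing R] {N Dm β : ℕ} {Rep : ℕ → R → Val K → Prop} {add mul zero : Prog}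

theorem Impl.listMono (I : Impl N Dm Rep add mul zero) {D D' : ℕ} {l : List R} {w : Val K}
    (h : D ≤ D') (hw : ListRep (Rep D) l w) : ListRep (Rep D') l w :=
  hw.mono fun _ _ _ => I.mono h

theorem Impl.wp_polyAdd (I : Impl N Dm Rep add mul zero) {D : ℕ} (hD : D ≤ Dm) {l m : List R}
    {x y : Val K} (hl : l.length ≤ N) (hx : ListRep (Rep D) l x) (hy : ListRep (Rep D) m y) :
    wp N (polyAdd add) (.cons x y) (ListRep (Rep D) (addList l m)) := by
  simp only [polyAdd, wp, app_fst, app_snd, app_nil]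
  refine wp_each (fun l' s => ∃ m' acc z t, s = .cons z t ∧ ListRep (Rep D) m' z ∧
    ListRep (Rep D) acc t ∧ acc.length + l'.length = l.length ∧
    addList l m = acc.reverse ++ addList l' m') hx hl
    ⟨m, [], y, .nil, rfl, hy, rfl, by simp, rfl⟩ ?_ ?_
  · rintro a l' x s - hx ⟨m', acc, z, t, rfl, hz, ht, hlen, h⟩
    simp only [wp, app_fst, app_snd]
    cases m' with
    | nil =>
      obtain rfl : z = .nil := hz
      refine ⟨fun h => absurd rfl h, fun _ => ⟨[], a :: acc, _, _, rfl, rfl, ⟨x, t, rfl, hx, ht⟩,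
        by simp at hlen ⊢; omega, ?_⟩⟩
      cases l' <;> simpa [addList] using h
    | cons b m' =>
      obtain ⟨y, z, rfl, hy, hz⟩ := hz
      refine ⟨fun _ => ?_, fun h => by simp at h⟩
      simp only [app_fst, app_snd]
      refine wp_mono (I.add hD hx hy) fun v hv => ?_
      exact ⟨m', (a + b) :: acc, _, _, rfl, hz, ⟨v, t, rfl, hv, ht⟩,
        by simp at hlen ⊢; omega, by simpa [addList] using h⟩
  · rintro s ⟨m', acc, z, t, rfl, hz, ht, hlen, h⟩
    simp only [app_fst, app_snd]
    rw [h]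
    exact wp_revAppP ht hz (by simp at hlen; omega)

theorem Impl.wp_polyMul (I : Impl N Dm Rep add mul zero) (hN : Dm * β + 1 ≤ N) {D D' : ℕ}
    (hD : D + D' ≤ Dm) {p q : Polynomial R} {x y : Val K} (hx : RepPoly β Rep D p x)
    (hy : RepPoly β Rep D' q y) :
    wp N (polyMul add mul zero) (.cons x y) (RepPoly β Rep (D + D') (p * q)) := by
  obtain ⟨l, rfl, hl, hx⟩ := hx
  obtain ⟨m, rfl, hm, hy⟩ := hy
  have e1 : D * β + 1 ≤ N := le_trans (by gcongr; omega) hN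
  have e2 : D' * β + 1 ≤ N := le_trans (by gcongr; omega) hN
  have e3 : D * β + D' * β + 1 ≤ N := le_trans (by rw [← add_mul]; gcongr) hN
  simp only [polyMul, wp, app_fst, app_snd, app_nil]
  refine wp_mono (wp_revP hx (by omega)) fun w hw => ?_
  refine wp_each (fun l' s => ∃ acc l'' t, s = .cons y t ∧ ListRep (Rep (D + D')) acc t ∧
    l'.reverse ++ l'' = l ∧ acc.length ≤ l''.length + D' * β ∧
    ofList acc = ofList l'' * ofList m) hw (by simp; omega)
    ⟨[], [], .nil, rfl, rfl, by simp, by simp, by simp [ofList]⟩ ?_ ?_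
  · rintro a l' x s - hx ⟨acc, l'', t, rfl, ht, hl', hacc, h⟩
    have hlen := congrArg List.length hl'
    simp at hlen
    simp only [wp, app_fst, app_snd]
    refine wp_mono (wp_mapP (g := fun b => a * b) hy (by omega) fun b _ z hz =>
      I.mul hD hx hz) fun v hv => ?_
    refine wp_mono (I.zero (D + D') _) fun z hz => ?_
    refine wp_mono (I.wp_polyAdd (m := 0 :: acc) hD (by simp; omega) hv ⟨z, t, rfl, hz, ht⟩)
      fun u hu => ?_
    refine ⟨_, a :: l'', u, rfl, hu, by simpa using hl', ?_, ?_⟩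
    · simp only [length_addList, List.length_map, List.length_cons]; omega
    · rw [ofList_addList, ofList_map_mul]
      simp only [ofList, h]; simp; ring
  · rintro s ⟨acc, l'', t, rfl, ht, hl', hacc, h⟩
    simp at hl'
    subst hl'
    exact ⟨acc, h, by rw [add_mul]; omega, ht⟩

theorem Impl.poly (I : Impl N Dm Rep add mul zero) (hN : Dm * β + 1 ≤ N) :
    Impl N Dm (RepPoly β Rep) (polyAdd add) (polyMul add mul zero) nilP where
  mono := by
    rintro D D' p w h ⟨l, hp, hl, hw⟩
    exact ⟨l, hp, hl.trans (by gcongr), I.listMono h hw⟩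
  zero D x := ⟨[], rfl, by simp, rfl⟩
  add := by
    rintro D p q x y hD ⟨l, rfl, hl, hx⟩ ⟨m, rfl, hm, hy⟩
    have : D * β + 1 ≤ N := le_trans (by gcongr) hN
    refine wp_mono (I.wp_polyAdd hD (by omega) hx hy) fun w hw => ?_
    exact ⟨_, ofList_addList l m, by rw [length_addList]; omega, hw⟩
  mul hD hx hy := I.wp_polyMul hN hD hx hy

/-- The representation of the elements of the base field. -/
def RepK (_ : ℕ) (a : K) (w : Val K) : Prop := w = .fld a

theorem implK : Impl (K := K) N Dm RepK (.prim .add) (.prim .mul) (.prim .zero) where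
  mono _ h := h
  zero _ _ := rfl
  add := by rintro D a b x y - rfl rfl; rfl
  mul := by rintro D D' a b x y - rfl rfl; rfl

end Impl

/-! ### Kronecker substitution -/

section kron
variable {K : Type u} [Field K] {n : ℕ}

/-- The Kronecker substitution `xᵢ ↦ z ^ (M ^ i)`. -/
noncomputable def kron (M : ℕ) : MvPolynomial (Fin n) K →ₐ[K] Polynomial K :=
  MvPolynomial.aeval fun i => Polynomial.X ^ M ^ (i : ℕ)

/-- The exponent of the image of a monomial under Kronecker substitution. -/
def kronExp (M : ℕ) (e : Fin n →₀ ℕ) : ℕ := ∑ i, e i * M ^ (i : ℕ)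

theorem kron_eq_sum (M : ℕ) (q : MvPolynomial (Fin n) K) :
    kron M q = ∑ e ∈ q.support, Polynomial.monomial (kronExp M e) (q.coeff e) := by
  rw [kron, MvPolynomial.aeval_def, MvPolynomial.eval₂_eq']
  refine Finset.sum_congr rfl fun e _ => ?_
  rw [← Polynomial.C_mul_X_pow_eq_monomial, kronExp, ← Finset.prod_pow_eq_pow_sum]
  congr 1
  exact Finset.prod_congr rfl fun i _ => by rw [← pow_mul, mul_comm]

theorem kronExp_inj {M : ℕ} {e e' : Fin n →₀ ℕ} (he : ∀ i, e i < M) (he' : ∀ i, e' i < M)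
    (h : kronExp M e = kronExp M e') : e = e' := by
  have := (finFunctionFinEquiv (m := M) (n := n)).injective
    (a₁ := fun i => ⟨e i, he i⟩) (a₂ := fun i => ⟨e' i, he' i⟩)
    (by ext; simpa [finFunctionFinEquiv_apply, kronExp] using h)
  ext i
  simpa using congrFun this i

theorem kronExp_lt {M : ℕ} {e : Fin n →₀ ℕ} (he : ∀ i, e i < M) : kronExp M e < M ^ n := by
  have := (finFunctionFinEquiv (m := M) (n := n) fun i => ⟨e i, he i⟩).2
  simpa [finFunctionFinEquiv_apply, kronExp] using this

theorem lt_of_mem_support {M : ℕ} {q : MvPolynomial (Fin n) K} (hq : q.totalDegree < M)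
    {e : Fin n →₀ ℕ} (he : e ∈ q.support) (i : Fin n) : e i < M :=
  lt_of_le_of_lt ((Finsupp.le_degree i e).trans (MvPolynomial.le_totalDegree he)) hq

/-- Kronecker substitution loses no information on polynomials of total degree less than `M`. -/
theorem coeff_kron {M : ℕ} {q : MvPolynomial (Fin n) K} (hq : q.totalDegree < M)
    {e : Fin n →₀ ℕ} (he : ∀ i, e i < M) : (kron M q).coeff (kronExp M e) = q.coeff e := by
  rw [kron_eq_sum, Polynomial.finsetSum_coeff]
  simp only [Polynomial.coeff_monomial]
  rw [Finset.sum_eq_single e]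
  · simp
  · intro e' he' hne
    rw [if_neg]
    exact fun h => hne (kronExp_inj (lt_of_mem_support hq he') he h)
  · intro h
    simpa using h

theorem coeff_kron_eq_zero {M : ℕ} {q : MvPolynomial (Fin n) K} (hq : q.totalDegree < M)
    {i : ℕ} (hi : M ^ n ≤ i) : (kron M q).coeff i = 0 := by
  rw [kron_eq_sum, Polynomial.finsetSum_coeff]
  refine Finset.sum_eq_zero fun e he => ?_
  rw [Polynomial.coeff_monomial, if_neg]
  have := kronExp_lt (lt_of_mem_support hq he)
  omega

/-- The representation of elements of `K[x₁, …, xₙ]` by dense lists of coefficients of their images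
under Kronecker substitution. The size bounds the total degree, too. -/
def RepR (M D : ℕ) (q : MvPolynomial (Fin n) K) (w : Val K) : Prop :=
  RepPoly (M ^ n) RepK D (kron M q) w ∧ q.totalDegree ≤ D

/-- Addition in `K[z]`, and in `K[x₁, …, xₙ]` by Kronecker substitution. -/
def addR : Prog := polyAdd (.prim .add)
/-- Multiplication in `K[z]`, and in `K[x₁, …, xₙ]` by Kronecker substitution. -/
def mulR : Prog := polyMul (.prim .add) (.prim .mul) (.prim .zero)
/-- Addition in `K[x₁, …, xₙ][X]`. -/
def addQ : Prog := polyAdd addR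
/-- Multiplication in `K[x₁, …, xₙ][X]`. -/
def mulQ : Prog := polyMul addR mulR nilP
/-- Addition in `K[x₁, …, xₙ][X][Z]`. -/
def addZ : Prog := polyAdd addQ
/-- Multiplication in `K[x₁, …, xₙ][X][Z]`. -/
def mulZ : Prog := polyMul addQ mulQ nilP

variable {N Dm M : ℕ}

theorem implS (hN : Dm * M ^ n + 1 ≤ N) :
    Impl (K := K) N Dm (RepPoly (M ^ n) RepK) addR mulR nilP :=
  implK.poly hN

theorem implR (hN : Dm * M ^ n + 1 ≤ N) :
    Impl (K := K) N Dm (RepR (n := n) M) addR mulR nilP where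
  mono h hw := ⟨(implS hN).mono h hw.1, hw.2.trans h⟩
  zero D x := ⟨by rw [map_zero]; exact (implS hN).zero D x, by simp⟩
  add {D a b x y} hD hx hy := wp_mono ((implS hN).add hD hx.1 hy.1) fun w hw =>
    ⟨by simpa using hw, (MvPolynomial.totalDegree_add a b).trans (max_le hx.2 hy.2)⟩
  mul {D D' a b x y} hD hx hy := wp_mono ((implS hN).mul hD hx.1 hy.1) fun w hw =>
    ⟨by simpa using hw, (MvPolynomial.totalDegree_mul a b).trans (add_le_add hx.2 hy.2)⟩

/-- The representation of elements of `K[x₁, …, xₙ][X]`. -/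
def RepQ (M : ℕ) : ℕ → PolyY K n → Val K → Prop := RepPoly 1 (RepR M)

/-- The representation of elements of `K[x₁, …, xₙ][X][Z]`. -/
def RepZ (M : ℕ) : ℕ → Polynomial (PolyY K n) → Val K → Prop := RepPoly 1 (RepQ M)

/-- The side condition on the bound `N` for the numbers of iterations. -/
def Big (n M Dm N : ℕ) : Prop := Dm * M ^ n + 1 ≤ N ∧ Dm + 1 ≤ N

theorem implQ (hN : Big n M Dm N) : Impl (K := K) N Dm (RepQ (n := n) M) addQ mulQ nilP :=
  (implR hN.1).poly (by simpa using hN.2)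

theorem implZ (hN : Big n M Dm N) : Impl (K := K) N Dm (RepZ (n := n) M) addZ mulZ nilP :=
  (implQ hN).poly (by simpa using hN.2)

theorem repR_const (a : K) (D : ℕ) :
    RepR (n := n) M D (MvPolynomial.C a) (.cons (.fld a) .nil) := by
  refine ⟨?_, by simp⟩
  have : kron M (MvPolynomial.C a : MvPolynomial (Fin n) K) = Polynomial.C a := by
    simp [kron]
  rw [this]
  exact RepPoly.singleton rfl

theorem repQ_const (a : K) (D : ℕ) :
    RepQ (n := n) M D (algebraMap K _ a) (.cons (.cons (.fld a) .nil) .nil) :=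
  RepPoly.singleton (repR_const a D)

end kron

/-! ### Unary arithmetic and exponent vectors -/

section counters
variable {K : Type u} [Field K] {N : ℕ}

theorem wp_each_counter {f : Prog} {m : ℕ} {w s : Val K}
    {P : Val K → Prop} (Inv : ℕ → Val K → Prop) (hw : Counter m w) (hN : m ≤ N)
    (h0 : Inv m s) (hstep : ∀ i x s, i < m → Inv (i + 1) s → wp N f (.cons x s) (Inv i))
    (hP : ∀ s, Inv 0 s → P s) : wp N (each f) (.cons w s) P := by
  obtain ⟨l, rfl, hl⟩ := hw
  exact wp_each (fun l' s => Inv l'.length s) hl hN h0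
    (fun a l' x s hs _ h => hstep _ _ _ (by simpa using hs.length_le) h) hP

/-- `(a, (b, c)) ↦ c + a * b` in unary. -/
def mulAddP : Prog :=
  each ((tl ⨾ hd) ⊠ ((tl ⨾ each (nilP ⊠ tl)))) ⨾ tl

theorem wp_mulAddP {a b c : ℕ} {x y z : Val K} (hx : Counter a x) (hy : Counter b y)
    (hz : Counter c z) (ha : a ≤ N) (hb : b ≤ N) :
    wp N mulAddP (.cons x (.cons y z)) (Counter (c + a * b)) := by
  refine wp_each_counter (fun i s => ∃ t c', s = .cons y t ∧ Counter c' t ∧ c' + i * b = c + a * b)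
    hx ha ⟨z, c, rfl, hz, rfl⟩ ?_ ?_
  · rintro i x s - ⟨t, c', rfl, ht, h⟩
    simp only [wp, app_fst, app_snd]
    refine wp_each_counter (fun j s => ∃ c'', Counter c'' s ∧ c'' + j = c' + b) hy hb
      ⟨c', ht, rfl⟩ ?_ ?_
    · rintro j x s - ⟨c'', hs, h⟩
      simp only [wp, app_nil, app_snd]
      exact ⟨c'' + 1, hs.cons, by omega⟩
    · rintro s ⟨c'', hs, h'⟩
      exact ⟨s, c'', rfl, hs, by rw [← h, add_mul]; omega⟩
  · rintro s ⟨t, c', rfl, ht, h⟩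
    obtain rfl : c' = c + a * b := by omega
    exact ht

/-- `a ↦ a ^ 2` in unary. -/
def sqP : Prog := (.skip ⊠ (.skip ⊠ nilP)) ⨾ mulAddP

theorem wp_sqP {a : ℕ} {x : Val K} (hx : Counter a x) (ha : a ≤ N) :
    wp N sqP x (Counter (a ^ 2)) := by
  simp only [sqP, wp, app_nil]
  refine wp_mono (wp_mulAddP hx hx counter_zero ha ha) fun y hy => ?_
  simpa [sq] using hy

end counters

section vectors

/-- All vectors of `n` numbers less than `M`, ordered as the numbers of which they are the digits in
base `M`, the least significant digit first. -/
def vecs (M : ℕ) : ℕ → List (List ℕ)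
  | 0 => [[]]
  | n + 1 => (vecs M n).flatMap fun v => (List.range M).map (· :: v)

theorem flatMap_range_eq (M m : ℕ) :
    ((List.range m).flatMap fun i => (List.range M).map fun a => a + M * i) =
      List.range (M * m) := by
  induction m with
  | zero => simp
  | succ m ih =>
    rw [List.range_succ, List.flatMap_append, ih, Nat.mul_succ, List.range_add]
    simp [add_comm]

theorem ofDigits_vecs (M n : ℕ) : (vecs M n).map (Nat.ofDigits M) = List.range (M ^ n) := by
  induction n with
  | zero => simp [vecs]
  | succ n ih =>
    rw [pow_succ', ← flatMap_range_eq, ← ih, List.flatMap_map, vecs, List.map_flatMap]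
    congr 1; ext1 v
    simp [Nat.ofDigits_cons, Function.comp_def]

theorem length_vecs (M n : ℕ) : (vecs M n).length = M ^ n := by
  simpa using congrArg List.length (ofDigits_vecs M n)

theorem length_of_mem_vecs {M n : ℕ} {v : List ℕ} (hv : v ∈ vecs M n) :
    v.length = n ∧ ∀ a ∈ v, a < M := by
  induction n generalizing v with
  | zero => simp_all [vecs]
  | succ n ih =>
    simp only [vecs, List.mem_flatMap, List.mem_map, List.mem_range] at hv
    obtain ⟨v, hv, a, ha, rfl⟩ := hv
    simpa [ha] using ih hv

variable {K : Type u}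

/-- The representation of vectors by lists of unary numbers. -/
def RepVec (v : List ℕ) (w : Val K) : Prop := w = Val.list (v.map Val.num)

variable [Field K] {N : ℕ}

/-- The numbers less than a given one, in descending order. -/
def rangeP : Prog := (.skip ⊠ (nilP ⊠ nilP)) ⨾ each ((nilP ⊠ (tl ⨾ hd)) ⊠ tl) ⨾ tl

theorem wp_rangeP {M : ℕ} {w : Val K} (hw : Counter M w) (hN : M ≤ N) :
    wp N rangeP w (ListRep (fun a x => x = Val.num a) (List.range M).reverse) := by
  simp only [rangeP, wp, app_nil]
  refine wp_each_counter (fun i s => ∃ t j, s = .cons (.num j) t ∧ j + i = M ∧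
    ListRep (fun a x => x = Val.num a) (List.range j).reverse t) hw hN
    ⟨.nil, 0, rfl, by omega, rfl⟩ ?_ ?_
  · rintro i x s - ⟨t, j, rfl, h, ht⟩
    simp only [wp, app_nil, app_fst, app_snd]
    refine ⟨_, j + 1, rfl, by omega, ?_⟩
    rw [List.range_succ, List.reverse_concat']
    exact ⟨_, _, rfl, rfl, ht⟩
  · rintro s ⟨t, j, rfl, h, ht⟩
    obtain rfl : j = M := by omega
    exact ht

/-- `(v, (r, l)) ↦ [a :: v | a ∈ r.reverse] ++ l`. -/
def consAllP : Prog :=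
  ((tl ⨾ hd) ⊠ (hd ⊠ (tl ⨾ tl))) ⨾
  each ((tl ⨾ hd) ⊠ ((hd ⊠ (tl ⨾ hd)) ⊠ (tl ⨾ tl))) ⨾ tl

theorem wp_consAllP {r v : List ℕ} {l : List (List ℕ)} {x y z : Val K}
    (hx : RepVec v x) (hy : ListRep (fun a x => x = Val.num a) r.reverse y)
    (hz : ListRep RepVec l z) (hr : r.length ≤ N) :
    wp N consAllP (.cons x (.cons y z)) (ListRep RepVec (r.map (· :: v) ++ l)) := by
  simp only [consAllP, wp, app_fst, app_snd]
  refine wp_each (fun r' s => ∃ t l', s = .cons x t ∧ ListRep RepVec l' t ∧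
    r.map (· :: v) ++ l = r'.reverse.map (· :: v) ++ l') hy (by simpa using hr)
    ⟨z, l, rfl, hz, by simp⟩ ?_ ?_
  · rintro a r' _ s - rfl ⟨t, l', rfl, ht, h⟩
    simp only [wp, app_fst, app_snd]
    refine ⟨_, (a :: v) :: l', rfl, ⟨_, _, rfl, ?_, ht⟩, by simp [h]⟩
    rw [hx]; rfl
  · rintro s ⟨t, l', rfl, ht, h⟩
    rw [h]; simpa using ht

/-- `(n, M) ↦ vecs M n`. -/
def vecsP : Prog :=
  (hd ⊠ ((tl ⨾ rangeP) ⊠ (nilP ⊠ nilP))) ⨾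
  each ((tl ⨾ hd) ⊠ (((tl ⨾ tl ⨾ revP) ⊠ ((tl ⨾ hd) ⊠ nilP)) ⨾
    each ((tl ⨾ hd) ⊠ consAllP) ⨾ tl)) ⨾ tl

theorem wp_vecsP {n M : ℕ} {x y : Val K} (hx : Counter n x) (hy : Counter M y)
    (hn : n ≤ N) (hM : M ≤ N) (hN : ∀ i ≤ n, M ^ i ≤ N) :
    wp N vecsP (.cons x y) (ListRep RepVec (vecs M n)) := by
  simp only [vecsP, wp, app_fst, app_snd, app_nil]
  refine wp_mono (wp_rangeP hy hM) fun r hr => ?_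
  refine wp_each_counter (fun i s => ∃ t j, s = .cons r t ∧ j + i = n ∧
    ListRep RepVec (vecs M j) t) hx hn ⟨_, 0, rfl, by omega, _, _, rfl, rfl, rfl⟩ ?_ ?_
  · rintro i x s - ⟨t, j, rfl, h, ht⟩
    simp only [wp, app_nil, app_fst, app_snd]
    have hl : (vecs M j).length ≤ N := by rw [length_vecs]; exact hN j (by omega)
    refine wp_mono (wp_revP ht hl) fun t' ht' => ?_
    refine wp_each (fun l s => ∃ t l', s = .cons r t ∧ ListRep RepVec l' t ∧
      vecs M (j + 1) = (l.reverse.flatMap fun v => (List.range M).map (· :: v)) ++ l') ht'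
      (by simpa using hl) ⟨.nil, [], rfl, rfl, by simp [vecs]⟩ ?_ ?_
    · rintro v l x s - hx ⟨t, l', rfl, ht, h⟩
      simp only [wp, app_fst, app_snd]
      refine wp_mono (wp_consAllP hx hr ht (by simpa using hM)) fun u hu => ?_
      exact ⟨u, _, rfl, hu, by simp [h]⟩
    · rintro s ⟨t, l', rfl, ht, h⟩
      exact ⟨t, j + 1, rfl, by omega, by rw [h]; simpa using ht⟩
  · rintro s ⟨t, j, rfl, h, ht⟩
    obtain rfl : j = n := by omega
    exact ht

end vectors

/-! ### Decoding -/

section decode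
variable {K : Type u} [Field K] {N n M D : ℕ}

/-- The exponent vector given by a list of numbers. -/
noncomputable def expOf (n : ℕ) (v : List ℕ) : Fin n →₀ ℕ :=
  Finsupp.equivFunOnFinite.symm fun i => v.getD i 0

theorem ofFn_expOf {v : List ℕ} (hv : v.length = n) : List.ofFn (expOf n v) = v := by
  subst hv
  refine List.ext_getElem (by simp) fun i h _ => ?_
  simp [expOf]

theorem kronExp_eq_ofDigits (M : ℕ) {n : ℕ} (e : Fin n →₀ ℕ) :
    kronExp M e = Nat.ofDigits M (List.ofFn e) := by
  have key : ∀ (n : ℕ) (f : Fin n → ℕ),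
      ∑ i, f i * M ^ (i : ℕ) = Nat.ofDigits M (List.ofFn f) := by
    intro n
    induction n with
    | zero => simp
    | succ n ih =>
      intro f
      rw [Fin.sum_univ_succ, List.ofFn_succ, Nat.ofDigits_cons, ← ih, Finset.mul_sum]
      simp [pow_succ]
      exact Finset.sum_congr rfl fun i _ => by ring
  exact key n e

/-- `(V, c)` is mapped to the list of the pairs of a nonzero entry of the list `c` and the
corresponding entry of the list `V`. -/
def decodeP : Prog :=
  (hd ⊠ (tl ⊠ nilP)) ⨾
  each (.branch (tl ⨾ hd)
    (.branch (tl ⨾ hd ⨾ hd ⨾ .prim .isZero)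
      ((tl ⨾ hd ⨾ tl) ⊠ (tl ⨾ tl))
      ((tl ⨾ hd ⨾ tl) ⊠ (((tl ⨾ hd ⨾ hd) ⊠ hd) ⊠ (tl ⨾ tl))))
    tl) ⨾ tl

/-- The elements of `vecs M n` are ordered as the positions of the coefficients after Kronecker
substitution; so the list of coefficients and `vecs M n` can be traversed in parallel. -/
theorem wp_decodeP {q : MvPolynomial (Fin n) K} {V w : Val K} (hV : ListRep RepVec (vecs M n) V)
    (hw : RepR M D q w) (hD : D < M) (hN : M ^ n ≤ N) :
    wp N decodeP (.cons V w) fun y => IsCodeX y q := by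
  obtain ⟨⟨l, hlq, -, hw⟩, hq⟩ := hw
  have hq : q.totalDegree < M := by omega
  have hco : ∀ i, l.getD i 0 = (kron M q).coeff i := fun i => by rw [← hlq, coeff_ofList]
  have hexp : ∀ v ∈ vecs M n, kronExp M (expOf n v) = Nat.ofDigits M v := fun v hv => by
    rw [kronExp_eq_ofDigits, ofFn_expOf (length_of_mem_vecs hv).1]
  have hlt : ∀ v ∈ vecs M n, ∀ i, expOf n v i < M := fun v hv i => by
    obtain ⟨h1, h2⟩ := length_of_mem_vecs hv
    have : (i : ℕ) < v.length := by omega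
    simpa [expOf, this] using h2 _ (List.getElem_mem this)
  have hcoef : ∀ v ∈ vecs M n, q.coeff (expOf n v) = l.getD (Nat.ofDigits M v) 0 := fun v hv => by
    rw [hco, ← hexp v hv, coeff_kron hq (hlt v hv)]
  have hinj : ∀ v ∈ vecs M n, ∀ v' ∈ vecs M n, expOf n v = expOf n v' → v = v' := by
    intro v hv v' hv' h
    rw [← ofFn_expOf (length_of_mem_vecs hv).1, h, ofFn_expOf (length_of_mem_vecs hv').1]
  simp only [decodeP, wp, app_fst, app_snd, app_nil]
  -- `p` is the part of `vecs M n` that has been processed, `m` are the remaining coefficients, and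
  -- `kept` are the vectors in `p` that belong to nonzero terms.
  refine wp_each (fun V' s => ∃ x m kept, s = .cons x
      (Val.list (kept.map fun v => .cons (.fld (q.coeff (expOf n v))) (Val.list (v.map Val.num)))) ∧
    ListRep (RepK 0) m x ∧ ∃ p, p ++ V' = vecs M n ∧ m = l.drop p.length ∧ kept.Nodup ∧
      ∀ v, v ∈ kept ↔ v ∈ p ∧ q.coeff (expOf n v) ≠ 0) hV (by rwa [length_vecs])
    ⟨w, l, [], rfl, hw, [], by simp, by simp, by simp, by simp⟩ ?_ ?_
  · rintro v V' y s - hy ⟨x, m, kept, rfl, hx, p, hp, rfl, hnd, hk⟩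
    have hv : v ∈ vecs M n := by rw [← hp]; simp
    have hnd' : (vecs M n).Nodup := List.Nodup.of_map (Nat.ofDigits M)
      (by rw [ofDigits_vecs]; exact List.nodup_range)
    have hvp : v ∉ p := by
      rw [← hp, List.nodup_append] at hnd'
      exact fun h => hnd'.2.2 v h v (by simp) rfl
    have hidx : Nat.ofDigits M v = p.length := by
      have h := congrArg (fun l => l.getD p.length 0) (ofDigits_vecs M n)
      have hlen : p.length < M ^ n := by
        rw [← length_vecs, ← hp]; simp
      simpa [← hp, hlen] using h
    have hcv := hcoef v hv
    rw [hidx] at hcv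
    simp only [wp, app_fst, app_snd]
    cases hm : l.drop p.length with
    | nil =>
      rw [hm] at hx
      obtain rfl : x = .nil := hx
      have hlen := List.drop_eq_nil_iff.1 hm
      refine ⟨fun h => absurd rfl h, fun _ => ⟨.nil, [], kept, rfl, rfl, p ++ [v],
        by simpa using hp, by simp; omega, hnd, fun v' => ?_⟩⟩
      rw [hk, List.mem_append, List.mem_singleton]
      constructor
      · exact fun h => ⟨.inl h.1, h.2⟩
      · rintro ⟨h | rfl, h'⟩
        · exact ⟨h, h'⟩
        · rw [hcv, List.getD_eq_default _ _ hlen] at h'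
          exact absurd rfl h'
    | cons a m =>
      rw [hm] at hx
      obtain ⟨_, z, rfl, rfl, hz⟩ := hx
      have ha : l.getD p.length 0 = a := by
        have := congrArg (fun l => l.getD 0 0) hm
        simpa [List.getD_eq_getElem?_getD] using this
      have hm' : m = l.drop (p ++ [v]).length := by
        have := congrArg List.tail hm
        simpa using this.symm
      refine ⟨fun _ => ?_, fun h => by simp at h⟩
      simp only [app_fst, app_snd, app_isZero]
      by_cases h0 : a = 0
      · refine ⟨fun _ => ?_, fun h => by simp [h0] at h⟩
        refine ⟨z, m, kept, rfl, hz, p ++ [v], by simpa using hp, hm', hnd, fun v' => ?_⟩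
        rw [hk, List.mem_append, List.mem_singleton]
        constructor
        · exact fun h => ⟨.inl h.1, h.2⟩
        · rintro ⟨h | rfl, h'⟩
          · exact ⟨h, h'⟩
          · rw [hcv, ha] at h'
            exact absurd h0 h'
      · refine ⟨fun h => by simp [h0] at h, fun _ => ?_⟩
        refine ⟨z, m, v :: kept, ?_, hz, p ++ [v], by simpa using hp, hm', ?_, fun v' => ?_⟩
        · rw [List.map_cons, hcv, ha, hy]; rfl
        · exact List.nodup_cons.2 ⟨fun h => hvp ((hk v).1 h).1, hnd⟩
        · rw [List.mem_cons, hk, List.mem_append, List.mem_singleton]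
          constructor
          · rintro (rfl | h)
            · exact ⟨.inr rfl, by rwa [hcv, ha]⟩
            · exact ⟨.inl h.1, h.2⟩
          · rintro ⟨h | rfl, h'⟩
            · exact .inr ⟨h, h'⟩
            · exact .inl rfl
  · rintro s ⟨x, m, kept, rfl, hx, p, hp, rfl, hnd, hk⟩
    rw [List.append_nil] at hp
    subst hp
    refine ⟨kept.map (expOf n), ?_, fun e => ?_, ?_⟩
    · exact hnd.map_on fun v hv v' hv' h => hinj v ((hk v).1 hv).1 v' ((hk v').1 hv').1 h
    · rw [List.mem_map]
      constructor
      · rintro ⟨v, hv, rfl⟩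
        exact MvPolynomial.mem_support_iff.2 ((hk v).1 hv).2
      · intro he
        have hlt' := lt_of_mem_support hq he
        have : kronExp M e ∈ (vecs M n).map (Nat.ofDigits M) := by
          rw [ofDigits_vecs, List.mem_range]; exact kronExp_lt hlt'
        obtain ⟨v, hv, hve⟩ := List.mem_map.1 this
        have : expOf n v = e := kronExp_inj (hlt v hv) hlt' (by rw [hexp v hv, hve])
        exact ⟨v, (hk v).2 ⟨hv, by rw [this]; exact MvPolynomial.mem_support_iff.1 he⟩, this⟩
    · simp only [app_snd, List.map_map]
      congr 1
      refine List.map_congr_left fun v hv => ?_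
      have := ofFn_expOf (length_of_mem_vecs ((hk v).1 hv).1).1
      simp only [Function.comp]
      congr 2
      conv_lhs => rw [← this]
      rw [List.map_ofFn]; rfl

end decode

/-! ### Encoding -/

section encode
variable {K : Type u} [Field K] {N n M Dm d : ℕ}

/-- The exponent of `z` in the image of `e Yʲ` under Kronecker substitution, where the exponent of
`Y` is the most significant digit; `e` is a list of digits. -/
def posFrom (M j : ℕ) (e : List ℕ) : ℕ := e.foldr (fun a p => a + M * p) j

theorem posFrom_le_append (hM : 1 ≤ M) (j : ℕ) (e e' : List ℕ) :
    posFrom M j e' ≤ posFrom M j (e ++ e') := by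
  induction e with
  | nil => exact le_rfl
  | cons a e ih =>
    simp only [posFrom, List.cons_append, List.foldr_cons] at ih ⊢
    nlinarith

theorem posFrom_eq (M j : ℕ) (e : List ℕ) :
    posFrom M j e = Nat.ofDigits M e + j * M ^ e.length := by
  induction e with
  | nil => simp [posFrom]
  | cons a e ih =>
    simp only [posFrom, List.foldr_cons, Nat.ofDigits_cons, List.length_cons] at ih ⊢
    rw [ih]; ring

/-- `(M, (j, (c, e)))` is mapped to the dense list of coefficients of the image of the monomial
`c xᵉ Yʲ` under Kronecker substitution. -/
def encTermP : Prog :=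
  ((((tl ⨾ tl ⨾ tl ⨾ revP) ⊠ (hd ⊠ (tl ⨾ hd))) ⨾
    each ((tl ⨾ hd) ⊠ (((tl ⨾ tl) ⊠ ((tl ⨾ hd) ⊠ hd)) ⨾ mulAddP)) ⨾ tl) ⊠
    ((tl ⨾ tl ⨾ hd) ⊠ nilP)) ⨾ each (.prim .zero ⊠ tl)

theorem wp_encTermP {j : ℕ} {c : K} {e : List ℕ} {x y z : Val K} (hM : 1 ≤ M) (hMN : M ≤ N)
    (hx : Counter M x) (hy : Counter j y) (hz : RepVec e z) (he : e.length ≤ N)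
    (hN : posFrom M j e ≤ N) :
    wp N encTermP (.cons x (.cons y (.cons (.fld c) z))) fun w => ∃ l : List K,
      ofList l = Polynomial.monomial (posFrom M j e) c ∧ l.length = posFrom M j e + 1 ∧
      ListRep (RepK 0) l w := by
  have hz' : ListRep (fun a w => w = Val.num a) e z := by
    rw [hz, listRep_iff]
    exact ⟨_, rfl, by rw [List.forall₂_map_right_iff]; exact List.forall₂_same.2 fun _ _ => rfl⟩
  simp only [encTermP, wp, app_fst, app_snd, app_nil]
  refine wp_mono (wp_revP hz' he) fun r hr => ?_
  refine wp_each (fun l' s => ∃ t e', s = .cons x t ∧ l'.reverse ++ e' = e ∧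
    Counter (posFrom M j e') t) hr (by simpa using he) ⟨y, [], rfl, by simp, hy⟩ ?_ ?_
  · rintro a l' _ s - rfl ⟨t, e', rfl, h, ht⟩
    simp only [wp, app_fst, app_snd]
    have hle : posFrom M j e' ≤ N :=
      (posFrom_le_append hM j _ _).trans (by rw [h]; exact hN)
    refine wp_mono (wp_mulAddP ht hx (counter_num a) hle hMN) fun u hu => ?_
    refine ⟨u, a :: e', rfl, by simpa using h, ?_⟩
    simpa [posFrom, mul_comm] using hu
  · rintro s ⟨t, e', rfl, h, ht⟩
    obtain rfl : e' = e := by simpa using h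
    simp only [app_snd]
    refine wp_each_counter (fun i s => ∃ l : List K, ∃ m, m + i = posFrom M j e' ∧
      ofList l = Polynomial.monomial m c ∧ l.length = m + 1 ∧ ListRep (RepK 0) l s) ht hN
      ⟨[c], 0, by simp, by simp [ofList], rfl, _, _, rfl, rfl, rfl⟩ ?_ ?_
    · rintro i x s - ⟨l, m, hm, hl, hlen, hs⟩
      simp only [wp, app_snd, app_zero]
      refine ⟨0 :: l, m + 1, by omega, ?_, by simp [hlen], _, _, rfl, rfl, hs⟩
      simp [ofList, hl, Polynomial.X_mul_monomial]
    · rintro s ⟨l, m, hm, hl, hlen, hs⟩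
      obtain rfl : m = posFrom M j e' := by omega
      exact ⟨l, hl, hlen, hs⟩

/-- The Kronecker substitution on `K[x₁, …, xₙ][Y]`, with `Y ↦ z ^ (M ^ n)`. -/
noncomputable def kronY (M : ℕ) : PolyY K n →+* Polynomial K :=
  Polynomial.eval₂RingHom (kron M : MvPolynomial (Fin n) K →ₐ[K] Polynomial K).toRingHom
    (Polynomial.X ^ M ^ n)

theorem kronY_C_mul (a : K) (h : PolyY K n) :
    kronY M (algebraMap K _ a * h) = Polynomial.C a * kronY M h := by
  rw [map_mul]
  congr 1
  rw [Polynomial.algebraMap_apply]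
  simp [kronY]

theorem kronY_eq_sum (h : PolyY K n) : kronY M h = ∑ j ∈ Finset.range (h.natDegree + 1),
    kron M (h.coeff j) * Polynomial.X ^ (j * M ^ n) := by
  simp only [kronY, Polynomial.coe_eval₂RingHom, Polynomial.eval₂_eq_sum_range]
  exact Finset.sum_congr rfl fun j _ => by rw [← pow_mul, mul_comm j]; rfl

theorem totalDegree_add_lt {h : PolyY K n} (hd : degXY h < d) {j : ℕ} (hj : h.coeff j ≠ 0) :
    (h.coeff j).totalDegree + j < d :=
  lt_of_le_of_lt (Finset.le_sup (f := fun j => (h.coeff j).totalDegree + j)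
    (Polynomial.mem_support_iff.2 hj)) hd

theorem natDegree_lt_of_degXY {h : PolyY K n} (hd : degXY h < d) : h.natDegree < d := by
  by_cases h0 : h = 0
  · subst h0; simpa using Nat.zero_lt_of_lt hd
  · have := totalDegree_add_lt hd (j := h.natDegree) (by simpa using h0)
    omega

/-- `(M, h)` is mapped to the dense list of coefficients of the Kronecker substitution of `h`. -/
def encPolyP : Prog :=
  (tl ⊠ (hd ⊠ (nilP ⊠ nilP))) ⨾
  each (each ((tl ⨾ hd) ⊠ ((tl ⨾ tl ⨾ hd) ⊠
      (((((tl ⨾ hd) ⊠ ((tl ⨾ tl ⨾ hd) ⊠ hd)) ⨾ encTermP) ⊠ (tl ⨾ tl ⨾ tl)) ⨾ addR))) ⨾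
    (hd ⊠ ((nilP ⊠ (tl ⨾ hd)) ⊠ (tl ⨾ tl)))) ⨾ tl ⨾ tl

theorem kronExp_le {e : Fin n →₀ ℕ} (hM : 1 ≤ M) : kronExp M e ≤ e.degree * M ^ n := by
  have : e.degree = ∑ i, e i := Finsupp.degree_eq_sum e
  rw [this, kronExp, Finset.sum_mul]
  gcongr with i
  omega

theorem wp_encPolyP {h : PolyY K n} {x w : Val K} (hM : 1 ≤ M) (hMN : M ≤ N) (hn : n ≤ N)
    (hN : Big n M Dm N) (hdD : d ≤ Dm) (hdM : d ≤ M) (hMn : M ^ n ≤ N) (hx : Counter M x)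
    (hw : IsCodeY w h) (hd : degXY h < d) :
    wp N encPolyP (.cons x w) (RepPoly (M ^ n) RepK d (kronY M h)) := by
  obtain ⟨c, hc, rfl⟩ := hw
  have hnat := natDegree_lt_of_degXY hd
  have hDN : Dm + 1 ≤ N := hN.2
  have hw : ListRep (fun j x => IsCodeX x (h.coeff j)) (List.range (h.natDegree + 1))
      (Val.list (List.ofFn c)) := by
    rw [listRep_iff]
    refine ⟨_, rfl, List.forall₂_iff_get.2 ⟨by simp, fun i h1 h2 => ?_⟩⟩
    have := hc ⟨i, by simpa using h1⟩
    simpa only [List.get_eq_getElem, List.getElem_range, List.getElem_ofFn] using this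
  simp only [encPolyP, wp, app_fst, app_snd, app_nil]
  -- `j` counts the coefficients with respect to `Y` that have been processed, and `a` represents
  -- the sum of their contributions.
  refine wp_each (fun l s => ∃ j a q, s = .cons x (.cons j a) ∧
    List.range q ++ l = List.range (h.natDegree + 1) ∧ Counter q j ∧
    RepPoly (M ^ n) RepK d (∑ j ∈ Finset.range q, kron M (h.coeff j) *
      Polynomial.X ^ (j * M ^ n)) a) hw (by simp; omega)
    ⟨.nil, .nil, 0, rfl, by simp, counter_zero, by simpa using RepPoly.nil⟩ ?_ ?_
  · rintro j l y s - ⟨L, hnd, hL, rfl⟩ ⟨jw, a, q, rfl, hq, hjw, ha⟩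
    have hjq : q = j := by
      have h1 := congrArg List.length hq
      have h2 := congrArg (fun l => l.getD q 0) hq
      simp at h1
      have hlt : q < h.natDegree + 1 := by omega
      simpa [List.getD_eq_getElem?_getD, hlt] using h2.symm
    subst hjq
    have hL' : ListRep (fun e x => x = .cons (.fld ((h.coeff q).coeff e))
        (.list (List.ofFn fun i => .num (e i)))) L (Val.list (L.map fun e =>
      Val.cons (Val.fld ((h.coeff q).coeff e)) (Val.list (List.ofFn fun i => Val.num (e i))))) := by
      rw [listRep_iff]
      exact ⟨_, rfl, by rw [List.forall₂_map_right_iff]; exact List.forall₂_same.2 fun _ _ => rfl⟩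
    have hdeg : ∀ e ∈ L, e.degree + q < d := fun e he => by
      have he := (hL e).1 he
      have := MvPolynomial.le_totalDegree he
      have h3 := totalDegree_add_lt hd (j := q) (by rintro h0; rw [h0] at he; simp at he)
      refine lt_of_le_of_lt ?_ h3
      gcongr; exact this
    have hLlen : L.length ≤ N := by
      refine le_trans ?_ hMn
      have hinj : (L.map (kronExp M)).Nodup := hnd.map_on fun e he e' he' hh =>
        kronExp_inj (fun i => lt_of_le_of_lt (Finsupp.le_degree i e) (by have := hdeg e he; omega))
          (fun i => lt_of_le_of_lt (Finsupp.le_degree i e') (by have := hdeg e' he'; omega)) hh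
      have hsub : L.map (kronExp M) ⊆ List.range (M ^ n) := by
        intro a ha
        obtain ⟨e, he, rfl⟩ := List.mem_map.1 ha
        exact List.mem_range.2 (kronExp_lt fun i =>
          lt_of_le_of_lt (Finsupp.le_degree i e) (by have := hdeg e he; omega))
      simpa using (hinj.subperm hsub).length_le
    have hsum : kron M (h.coeff q) * Polynomial.X ^ (q * M ^ n) =
        (L.map fun e : Fin n →₀ ℕ => Polynomial.monomial (posFrom M q (List.ofFn e))
          ((h.coeff q).coeff e)).sum := by
      have : L.toFinset = (h.coeff q).support := by ext e; simp [hL]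
      rw [kron_eq_sum, ← this, List.sum_toFinset _ hnd, ← List.sum_map_mul_right]
      congr 1
      refine List.map_congr_left fun e _ => ?_
      rw [posFrom_eq, ← kronExp_eq_ofDigits, List.length_ofFn, Polynomial.monomial_mul_X_pow]
    refine wp_each (fun l' s => ∃ a' p, s = .cons x (.cons jw a') ∧
      RepPoly (M ^ n) RepK d p a' ∧
      p + (l'.map fun e : Fin n →₀ ℕ => Polynomial.monomial (posFrom M q (List.ofFn e))
          ((h.coeff q).coeff e)).sum = (∑ j ∈ Finset.range q, kron M (h.coeff j) *
      Polynomial.X ^ (j * M ^ n)) + kron M (h.coeff q) * Polynomial.X ^ (q * M ^ n))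
      hL' hLlen ⟨a, _, rfl, ha, by rw [hsum]⟩ ?_ ?_
    · rintro e l' _ s hsuf rfl ⟨a', p, rfl, ha', hp⟩
      have he := hdeg e (hsuf.subset (by simp))
      have hpos : posFrom M q (List.ofFn e) + 1 ≤ d * M ^ n + 1 := by
        rw [posFrom_eq, ← kronExp_eq_ofDigits, List.length_ofFn]
        have h1 := kronExp_le (e := e) hM
        have : (e.degree + q) * M ^ n ≤ d * M ^ n := by gcongr
        rw [add_mul] at this
        omega
      have hposN : d * M ^ n + 1 ≤ N := le_trans (by gcongr) hN.1
      simp only [wp, app_fst, app_snd]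
      refine wp_mono (wp_encTermP (e := List.ofFn e) (j := q) hM hMN hx hjw
        (by rw [RepVec, List.map_ofFn]; rfl) (by simpa using hn) (by omega)) ?_
      rintro t ⟨lt, hlt, hltlen, ht⟩
      refine wp_mono ((implS (n := n) (M := M) hN.1).add hdD
        ⟨lt, hlt, by omega, ht⟩ ha') fun u hu => ?_
      refine ⟨u, _, rfl, hu, ?_⟩
      rw [← hp, List.map_cons, List.sum_cons]; ring
    · rintro s ⟨a', p, rfl, ha', hp⟩
      simp only [wp, app_nil, app_fst, app_snd]
      refine ⟨_, a', q + 1, rfl, ?_, hjw.cons, ?_⟩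
      · rw [List.range_succ, List.append_assoc]; exact hq
      · rw [Finset.sum_range_succ, ← hp]; simpa using ha'
  · rintro s ⟨j, a, q, rfl, hq, hj, ha⟩
    simp only [app_snd]
    have : q = h.natDegree + 1 := by simpa using congrArg List.length hq
    rw [kronY_eq_sum, ← this]
    exact ha

end encode

/-! ### Gaussian elimination over the base field -/

section elim
variable {K : Type u} [Field K] {N n M Dm d : ℕ}

open Classical in
/-- The number `-q_j / p_j`, where `j` is the position of the first nonzero entry of `p`. -/
noncomputable def pivotRatio : List K → List K → Option K
  | [], _ => none
  | a :: p, q => if a = 0 then pivotRatio p q.tail else some (0 - q.headD 0 * a⁻¹)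

theorem pivotRatio_eq_none {p : List K} (q : List K) :
    pivotRatio p q = none ↔ ∀ a ∈ p, a = 0 := by
  induction p generalizing q with
  | nil => simp [pivotRatio]
  | cons a p ih =>
    by_cases h : a = 0 <;> simp [pivotRatio, h, ih]

/-- For fixed `p`, the position of the pivot does not depend on `q`. -/
theorem exists_pivot {p : List K} (hp : ∃ a ∈ p, a ≠ 0) : ∃ j < p.length, p.getD j 0 ≠ 0 ∧
    ∀ q, pivotRatio p q = some (0 - q.getD j 0 * (p.getD j 0)⁻¹) := by
  induction p with
  | nil => simp at hp
  | cons a p ih =>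
    by_cases h : a = 0
    · obtain ⟨j, hj, h1, h2⟩ := ih (by simpa [h] using hp)
      refine ⟨j + 1, by simpa using hj, by simpa using h1, fun q => ?_⟩
      rw [pivotRatio, if_pos h, h2]
      cases q <;> simp
    · refine ⟨0, by simp, by simpa using h, fun q => ?_⟩
      rw [pivotRatio, if_neg h]
      cases q <;> simp

/-- The program computing `pivotRatio`; the result `none` is represented by `nil`. -/
def scanP : Prog :=
  (hd ⊠ (tl ⊠ nilP)) ⨾
  each (.branch (tl ⨾ tl) tl
    (.branch (hd ⨾ .prim .isZero) ((tl ⨾ hd ⨾ tl) ⊠ nilP)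
      ((tl ⨾ hd ⨾ tl) ⊠ (.branch (tl ⨾ hd)
        ((.prim .zero ⊠ (((tl ⨾ hd ⨾ hd) ⊠ (hd ⨾ .prim .inv)) ⨾ .prim .mul)) ⨾ .prim .sub)
        (.prim .zero))))) ⨾ tl

/-- Optional field elements, with `nil` for `none`. -/
def RepOption (o : Option K) (w : Val K) : Prop := w = o.elim .nil .fld

theorem wp_scanP {p q : List K} {x y : Val K} (hx : ListRep (RepK 0) p x)
    (hy : ListRep (RepK 0) q y) (hN : p.length ≤ N) :
    wp N scanP (.cons x y) (RepOption (pivotRatio p q)) := by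
  simp only [scanP, wp, app_fst, app_snd, app_nil]
  refine wp_each (fun p' s => ∃ z t, s = .cons z t ∧
    ((∃ a, t = .fld a ∧ pivotRatio p q = some a) ∨
      (t = .nil ∧ ∃ q', ListRep (RepK 0) q' z ∧ pivotRatio p q = pivotRatio p' q'))) hx hN
    ⟨y, .nil, rfl, .inr ⟨rfl, q, hy, rfl⟩⟩ ?_ ?_
  · rintro a p' _ s - rfl ⟨z, t, rfl, ⟨b, rfl, h⟩ | ⟨rfl, q', hz, h⟩⟩
    · simp only [wp, app_fst, app_snd]
      exact ⟨fun _ => ⟨z, _, rfl, .inl ⟨b, rfl, h⟩⟩, fun h => by simp at h⟩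
    · simp only [wp, app_fst, app_snd, app_isZero, app_inv, app_zero]
      refine ⟨fun h => absurd rfl h, fun _ => ⟨fun h0 => ?_, fun h0 => ?_⟩⟩
      · have h0 : a = 0 := by by_contra h; simp [h] at h0
        rw [app_nil]
        refine ⟨_, _, rfl, .inr ⟨rfl, q'.tail, ?_, by rw [h, pivotRatio, if_pos h0]⟩⟩
        cases q' with
        | nil => obtain rfl : z = .nil := hz; rfl
        | cons b q' => obtain ⟨_, z, rfl, -, hz⟩ := hz; exact hz
      · have h0 : a ≠ 0 := by rintro rfl; simp at h0
        rw [pivotRatio, if_neg h0] at h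
        cases q' with
        | nil =>
          obtain rfl : z = .nil := hz
          exact ⟨fun h => absurd rfl h, fun _ => ⟨_, _, rfl, .inl ⟨0, rfl, by simpa using h⟩⟩⟩
        | cons b q' =>
          obtain ⟨_, z, rfl, rfl, hz⟩ := hz
          exact ⟨fun _ => ⟨_, _, rfl, .inl ⟨_, rfl, by simpa using h⟩⟩, fun h => by simp at h⟩
  · rintro s ⟨z, t, rfl, ⟨b, rfl, h⟩ | ⟨rfl, q', hz, h⟩⟩
    · rw [h]; rfl
    · rw [h]; rfl

/-- The representation of polynomials of degree less than `d` as vectors over `K`. -/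
def RepRow (M d : ℕ) (h : PolyY K n) (w : Val K) : Prop :=
  RepPoly (M ^ n) RepK d (kronY M h) w ∧ degXY h < d

theorem degXY_lt_iff (hd : 0 < d) {h : PolyY K n} :
    degXY h < d ↔ ∀ j, h.coeff j = 0 ∨ (h.coeff j).totalDegree + j < d := by
  constructor
  · exact fun hh j => or_iff_not_imp_left.2 fun h0 => totalDegree_add_lt hh h0
  · intro hh
    rw [degXY, Finset.sup_lt_iff (by simpa using hd)]
    exact fun j hj => (hh j).resolve_left (Polynomial.mem_support_iff.1 hj)

theorem degXY_add_mul_lt {h p : PolyY K n} (hh : degXY h < d) (hp : degXY p < d) (a : K) :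
    degXY (h + algebraMap K _ a * p) < d := by
  have hd := Nat.zero_lt_of_lt hh
  rw [degXY_lt_iff hd] at hh hp ⊢
  intro j
  have : (h + algebraMap K _ a * p).coeff j = h.coeff j + MvPolynomial.C a * p.coeff j := by
    rw [Polynomial.coeff_add, Polynomial.algebraMap_apply, Polynomial.coeff_C_mul]; rfl
  rw [this]
  have h2 := MvPolynomial.totalDegree_add (h.coeff j) (MvPolynomial.C a * p.coeff j)
  have h3 := MvPolynomial.totalDegree_mul (MvPolynomial.C a) (p.coeff j)
  rw [MvPolynomial.totalDegree_C, zero_add] at h3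
  rcases hh j with h0 | h0
  · rcases hp j with h1 | h1
    · left; rw [h0, h1]; simp
    · right; rw [h0] at h2 ⊢; simp at h2 ⊢; omega
  · rcases hp j with h1 | h1
    · right; rw [h1]; simpa using h0
    · right
      have := h2.trans (max_le_max le_rfl h3)
      rcases le_max_iff.1 this with h | h <;> omega

/-- `(p, q)` is mapped to `q + c p`, with `c` chosen such that the entry at the position of the
first nonzero entry of `p` vanishes. -/
def reduceP : Prog := (((scanP ⊠ hd) ⨾ mapP (.prim .mul)) ⊠ tl) ⨾ addR

/-- Gaussian elimination on a list of vectors over `K`. -/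
def elimP : Prog :=
  (.skip ⊠ (.skip ⊠ nilP)) ⨾
  each (.branch (((tl ⨾ hd ⨾ hd) ⊠ (tl ⨾ hd ⨾ hd)) ⨾ scanP)
    ((((tl ⨾ hd ⨾ hd) ⊠ (tl ⨾ hd ⨾ tl)) ⨾ mapP reduceP) ⊠ ((tl ⨾ hd ⨾ hd) ⊠ (tl ⨾ tl)))
    ((tl ⨾ hd ⨾ tl) ⊠ (tl ⨾ tl))) ⨾ tl

/-- Elimination leaves vectors with the same span, which are linearly independent because their
pivots are at different positions. Therefore their number is bounded by the length of the vectors.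
-/
theorem wp_elimP {hs : List (PolyY K n)} {w : Val K} (hN : Big n M Dm N) (hdD : d ≤ Dm)
    (hlen : hs.length ≤ N) (hw : ListRep (RepRow M d) hs w)
    (hinj : ∀ h : PolyY K n, degXY h < d → kronY M h = 0 → h = 0) :
    wp N elimP w fun y => ∃ gs : List (PolyY K n), ListRep (RepRow M d) gs y ∧
      gs.length ≤ hs.length ∧ gs.length ≤ d * M ^ n + 1 ∧
      ∀ W : Submodule K (PolyY K n), (∀ h ∈ hs, h ∈ W) ↔ ∀ g ∈ gs, g ∈ W := by
  have hdN : d * M ^ n + 1 ≤ N := le_trans (by gcongr) hN.1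
  simp only [elimP, wp, app_nil]
  -- `J` collects the positions of the pivots; the remaining rows vanish there.
  refine wp_each (fun l s => ∃ (rest done : List (PolyY K n)) (J : List ℕ) (x y : Val K),
    s = .cons x y ∧ ListRep (RepRow M d) rest x ∧ ListRep (RepRow M d) done y ∧
    rest.length = l.length ∧ done.length + rest.length ≤ hs.length ∧
    (∀ W : Submodule K (PolyY K n),
      (∀ h ∈ hs, h ∈ W) ↔ (∀ h ∈ rest, h ∈ W) ∧ ∀ g ∈ done, g ∈ W) ∧
    J.length = done.length ∧ J.Nodup ∧ (∀ j ∈ J, j < d * M ^ n + 1) ∧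
    ∀ h ∈ rest, ∀ j ∈ J, (kronY M h).coeff j = 0) hw hlen
    ⟨hs, [], [], w, .nil, rfl, hw, rfl, rfl, by simp, by simp, rfl, by simp, by simp, by simp⟩ ?_ ?_
  · rintro _ l _ s - - ⟨rest, done, J, x, y, rfl, hx, hy, hr, hlen', hW, hJl, hJn, hJb, hJ⟩
    cases rest with
    | nil => simp at hr
    | cons p rest =>
    obtain ⟨z, x, rfl, hz, hx⟩ := hx
    obtain ⟨⟨lp, hlp, hlpl, hzl⟩, hpd⟩ := id hz
    have hcoef : ∀ j, lp.getD j 0 = (kronY M p).coeff j := fun j => by rw [← hlp, coeff_ofList]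
    simp only [wp, app_fst, app_snd]
    refine wp_mono (wp_scanP hzl hzl (by omega)) fun o ho => ⟨fun hne => ?_, fun hnil => ?_⟩
    · obtain ⟨j, hj, hj0, hjr⟩ := exists_pivot (p := lp) (by
        by_contra h
        push Not at h
        rw [(pivotRatio_eq_none lp).2 h] at ho
        exact hne ho)
      rw [hcoef] at hj0 hjr
      have hmap : ∀ h ∈ rest, ∀ u, RepRow M d h u → wp N reduceP (.cons z u)
          (RepRow M d (h + algebraMap K _ (0 - (kronY M h).coeff j *
            ((kronY M p).coeff j)⁻¹) * p)) := by
        rintro h - u ⟨⟨lh, hlh, hlhl, hu⟩, hhd⟩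
        simp only [reduceP, wp, app_fst, app_snd]
        refine wp_mono (wp_scanP hzl hu (by omega)) fun o ho => ?_
        rw [hjr] at ho
        obtain rfl : o = .fld _ := ho
        refine wp_mono (wp_mapP (σ := RepK 0) (g := fun b =>
          (0 - lh.getD j 0 * ((kronY M p).coeff j)⁻¹) * b) hzl (by omega) ?_) fun v hv => ?_
        · rintro a - _ rfl
          rfl
        refine wp_mono ((implK (N := N) (Dm := d)).wp_polyAdd (D := d) le_rfl (by simp; omega)
          hv hu) fun t ht => ⟨⟨_, ?_, ?_, ht⟩, degXY_add_mul_lt hhd hpd _⟩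
        · rw [ofList_addList, ofList_map_mul, map_add, kronY_C_mul, hlp, hlh, ← hlh, coeff_ofList]
          ring
        · simp only [length_addList, List.length_map]; omega
      refine wp_mono (wp_mapP hx (by simp at hlen'; omega) hmap) fun t ht => ?_
      refine ⟨_, p :: done, j :: J, t, _, rfl, ht, ⟨z, y, rfl, hz, hy⟩, by simpa using hr,
        by simp at hlen' ⊢; omega, fun W => ?_, by simp [hJl], ?_, ?_, ?_⟩
      · rw [hW]
        simp only [List.mem_cons, forall_eq_or_imp, List.mem_map, forall_exists_index, and_imp,
          forall_apply_eq_imp_iff₂]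
        constructor
        · rintro ⟨⟨h1, h2⟩, h3⟩
          refine ⟨fun h hh => W.add_mem (h2 h hh) ?_, h1, h3⟩
          rw [← Algebra.smul_def]; exact W.smul_mem _ h1
        · rintro ⟨h2, h1, h3⟩
          refine ⟨⟨h1, fun h hh => ?_⟩, h3⟩
          have := h2 h hh
          rw [← Algebra.smul_def] at this
          exact (W.add_mem_iff_left (W.smul_mem _ h1)).1 this
      · exact List.nodup_cons.2 ⟨fun h => hj0 (hJ p (by simp) j h), hJn⟩
      · rintro i hi
        rcases List.mem_cons.1 hi with rfl | hi
        · omega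
        · exact hJb i hi
      · rintro h hh i hi
        obtain ⟨h, hh', rfl⟩ := List.mem_map.1 hh
        rw [map_add, kronY_C_mul, Polynomial.coeff_add, Polynomial.coeff_C_mul]
        rcases List.mem_cons.1 hi with rfl | hi
        · field_simp; ring
        · rw [hJ h (by simp [hh']) i hi, hJ p (by simp) i hi]; simp
    · have hp0 : p = 0 := by
        refine hinj p hpd ?_
        have : pivotRatio lp lp = none := by
          cases h : pivotRatio lp lp with
          | none => rfl
          | some a => rw [h, hnil] at ho; simp [RepOption] at ho
        rw [pivotRatio_eq_none] at this
        ext j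
        rw [← hcoef]
        by_cases hjl : j < lp.length
        · simpa [List.getD_eq_getElem?_getD, hjl] using this _ (List.getElem_mem hjl)
        · simp [List.getD_eq_getElem?_getD, hjl]
      refine ⟨rest, done, J, x, y, rfl, hx, hy, by simpa using hr, by simp at hlen'; omega,
        fun W => ?_, hJl, hJn, hJb, fun h hh => hJ h (by simp [hh])⟩
      rw [hW]; simp [hp0]
  · rintro s ⟨rest, done, J, x, y, rfl, hx, hy, hr, hlen', hW, hJl, hJn, hJb, hJ⟩
    obtain rfl : rest = [] := by simpa using hr
    refine ⟨done, hy, by simpa using hlen', ?_, fun W => by rw [hW]; simp⟩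
    rw [← hJl]
    have hsub : J ⊆ List.range (d * M ^ n + 1) := fun j hj => List.mem_range.2 (hJb j hj)
    simpa using (hJn.subperm hsub).length_le

end elim

/-! ### Splitting into coefficients -/

section chunk
variable {K : Type u} [Field K] {N n M Dm d : ℕ}

theorem kronY_eq_add (h : PolyY K n) :
    kronY M h = kron M (h.coeff 0) + Polynomial.X ^ M ^ n * kronY M h.divX := by
  conv_lhs => rw [← Polynomial.divX_mul_X_add h]
  rw [map_add, map_mul, add_comm, mul_comm]
  congr 1
  · simp [kronY]
  · simp [kronY]

theorem degXY_divX_lt {h : PolyY K n} (hh : degXY h < d) : degXY h.divX < d := by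
  have hd := Nat.zero_lt_of_lt hh
  rw [degXY_lt_iff hd] at hh ⊢
  intro j
  rw [Polynomial.coeff_divX]
  exact (hh (j + 1)).imp id fun h => by omega

theorem totalDegree_coeff_lt {h : PolyY K n} (hh : degXY h < d) (j : ℕ) :
    (h.coeff j).totalDegree < d := by
  rcases (degXY_lt_iff (Nat.zero_lt_of_lt hh)).1 hh j with h0 | h0
  · rw [h0]; simpa using Nat.zero_lt_of_lt hh
  · omega

/-- If the coefficients of `h` have total degree less than `M`, then their images under Kronecker
substitution do not overlap, and the first one can be split off. -/
theorem ofList_take_drop {h : PolyY K n} (hh : degXY h < d) (hdM : d ≤ M) {l : List K}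
    (hl : ofList l = kronY M h) :
    ofList (l.take (M ^ n)) = kron M (h.coeff 0) ∧ ofList (l.drop (M ^ n)) = kronY M h.divX := by
  have hdeg := (totalDegree_coeff_lt hh 0).trans_le hdM
  have hco : ∀ i, l.getD i 0 = (kron M (h.coeff 0)).coeff i +
      (Polynomial.X ^ M ^ n * kronY M h.divX).coeff i := fun i => by
    rw [← coeff_ofList, hl, kronY_eq_add, Polynomial.coeff_add]
  constructor
  · ext i
    by_cases hi : i < M ^ n
    · have := hco i
      rw [Polynomial.coeff_X_pow_mul', if_neg (by omega), add_zero] at this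
      rw [coeff_ofList, ← this]
      simp [List.getD_eq_getElem?_getD, hi]
    · rw [coeff_kron_eq_zero hdeg (by omega), coeff_ofList, List.getD_eq_default]
      simp; omega
  · ext i
    have := hco (M ^ n + i)
    rw [coeff_kron_eq_zero hdeg (by omega), zero_add, add_comm (M ^ n),
      Polynomial.coeff_X_pow_mul] at this
    rw [coeff_ofList, ← this]
    simp [List.getD_eq_getElem?_getD, add_comm]

theorem eq_zero_of_kronY_eq_zero (hdM : d ≤ M) (h : PolyY K n) (hh : degXY h < d)
    (h0 : kronY M h = 0) : h = 0 := by
  have key : ∀ j (h : PolyY K n), degXY h < d → kronY M h = 0 → h.coeff j = 0 := by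
    intro j
    induction j with
    | zero =>
      intro h hh h0
      have := (ofList_take_drop hh hdM (l := []) (by simp [ofList, h0])).1
      simp only [List.take_nil, ofList] at this
      have hdeg := (totalDegree_coeff_lt hh 0).trans_le hdM
      ext e
      by_cases he : e ∈ (h.coeff 0).support
      · rw [← coeff_kron hdeg (lt_of_mem_support hdeg he), ← this]; simp
      · simpa using he
    | succ j ih =>
      intro h hh h0
      have := (ofList_take_drop hh hdM (l := []) (by simp [ofList, h0])).2
      rw [← Polynomial.coeff_divX]
      exact ih _ (degXY_divX_lt hh) (by simpa [ofList] using this.symm)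
  ext1 j
  simpa using key j h hh h0

/-- `(c, (V, r))` is mapped to the list of the first `c` coefficients of the polynomial in `Y` that
`r` represents as a vector; the length of the list `V` is the number of entries for each
coefficient. -/
def chunkP : Prog :=
  (hd ⊠ ((tl ⨾ hd) ⊠ ((tl ⨾ tl) ⊠ nilP))) ⨾
  each ((tl ⨾ hd) ⊠
    (((((tl ⨾ hd) ⊠ ((tl ⨾ tl ⨾ hd) ⊠ nilP)) ⨾
      each (.branch (tl ⨾ hd) ((tl ⨾ hd ⨾ tl) ⊠ ((tl ⨾ hd ⨾ hd) ⊠ (tl ⨾ tl))) tl)) ⊠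
      (tl ⨾ tl ⨾ tl)) ⨾ ((hd ⨾ hd) ⊠ ((hd ⨾ tl ⨾ revP) ⊠ tl)))) ⨾ tl ⨾ tl ⨾ revP

theorem wp_chunkP {h : PolyY K n} {x V r : Val K} {m : ℕ} (hdM : d ≤ M) (hd1 : 1 ≤ d)
    (hMn : M ^ n ≤ N) (hm : m ≤ N) (hx : Counter m x) (hV : Counter (M ^ n) V)
    (hr : RepRow M d h r) :
    wp N chunkP (.cons x (.cons V r)) (ListRep (RepR M d)
      ((List.range m).map h.coeff)) := by
  obtain ⟨⟨l, hl, -, hr⟩, hdeg⟩ := hr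
  simp only [chunkP, wp, app_fst, app_snd, app_nil]
  -- After `j` steps, `g` is the polynomial `h` without its first `j` coefficients, divided by
  -- `Y ^ j`.
  refine wp_each_counter (fun i s => ∃ j g rest l' y, s = .cons V (.cons rest y) ∧ j + i = m ∧
    (∀ i, g.coeff i = h.coeff (j + i)) ∧ degXY g < d ∧ ofList l' = kronY M g ∧
    ListRep (RepK d) l' rest ∧ ListRep (RepR M d)
      ((List.range j).map h.coeff).reverse y) hx hm
    ⟨0, h, r, l, .nil, rfl, by simp, by simp, hdeg, hl, hr, rfl⟩ ?_ ?_
  · rintro i _ s - ⟨j, g, rest, l', y, rfl, hj, hg, hgd, hl', hrest, hy⟩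
    simp only [wp, app_fst, app_snd, app_nil]
    have h2 := ofList_take_drop hgd hdM hl'
    refine wp_each_counter (fun i s => ∃ t a b, s = .cons t a ∧ b + i = M ^ n ∧
      ListRep (RepK d) (l'.drop b) t ∧ ListRep (RepK d) (l'.take b).reverse a) hV hMn
      ⟨rest, .nil, 0, rfl, by omega, by simpa using hrest, by simp [ListRep]⟩ ?_ ?_
    · rintro i _ s - ⟨t, a, b, rfl, hb, ht, ha⟩
      simp only [wp, app_fst, app_snd]
      cases hc : l'.drop b with
      | nil =>
        rw [hc] at ht
        obtain rfl : t = .nil := ht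
        have := List.drop_eq_nil_iff.1 hc
        refine ⟨fun h => absurd rfl h, fun _ => ⟨.nil, a, b + 1, rfl, by omega, ?_, ?_⟩⟩
        · rw [List.drop_eq_nil_iff.2 (by omega)]; rfl
        · rw [List.take_of_length_le (by omega)]
          rwa [List.take_of_length_le (by omega)] at ha
      | cons c l'' =>
        rw [hc] at ht
        obtain ⟨z, t, rfl, hz, ht⟩ := ht
        have hlt : b < l'.length := by
          by_contra hcon
          rw [List.drop_eq_nil_iff.2 (by omega)] at hc
          simp at hc
        rw [List.drop_eq_getElem_cons hlt] at hc
        injection hc with hc1 hc2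
        refine ⟨fun _ => ⟨t, _, b + 1, rfl, by omega, by rwa [hc2], ?_⟩, fun h => by simp at h⟩
        rw [← List.take_append_getElem hlt, hc1, List.reverse_concat']
        exact ⟨z, a, rfl, hz, ha⟩
    · rintro s ⟨t, a, b, rfl, hb, ht, ha⟩
      obtain rfl : b = M ^ n := by omega
      simp only [app_fst, app_snd]
      refine wp_mono (wp_revP ha (by simp; omega)) fun u hu => ?_
      rw [List.reverse_reverse] at hu
      refine ⟨j + 1, g.divX, t, _, _, rfl, by omega, fun i => ?_, degXY_divX_lt hgd, h2.2, ht, ?_⟩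
      · rw [Polynomial.coeff_divX, hg]; congr 1; omega
      · rw [List.range_succ, List.map_append, List.reverse_append]
        refine ⟨_, _, rfl, ⟨⟨_, ?_, ?_, hu⟩, ?_⟩, hy⟩
        · rw [h2.1, hg, add_zero]
        · have := Nat.le_mul_of_pos_left (M ^ n) (show 0 < d by omega)
          simp only [List.length_take]; omega
        · exact (totalDegree_coeff_lt hdeg j).le
  · rintro s ⟨j, g, rest, l', y, rfl, hj, hg, hgd, hl', hrest, hy⟩
    obtain rfl : j = m := by omega
    simp only [app_snd]
    have := wp_revP (N := N) hy (by simpa using hm)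
    simpa using this

end chunk

/-! ### Newton's recursion -/

section newton
variable {A : Type*} [CommRing A]

/-- The power sums of the roots of a polynomial, from its coefficients `c` in descending order, by
Newton's identities. -/
def powerSum (c : ℕ → A) : ℕ → A
  | 0 => 0
  | l + 1 => -((l + 1 : ℕ) * c (l + 1) + ∑ i : Fin l, c (i + 1) * powerSum c (l - i))
  decreasing_by omega

/-- The signed elementary symmetric functions, from the power sums `p`, by Newton's identities. -/
def symmOfPowerSum (K : Type*) [Field K] [Algebra K A] (p : ℕ → A) : ℕ → A
  | 0 => 1
  | l + 1 => algebraMap K A (0 - ((l + 1 : ℕ) : K)⁻¹) *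
      ∑ i : Fin (l + 1), p (i + 1) * symmOfPowerSum K p (l - i)
  decreasing_by omega

theorem powerSum_succ (c : ℕ → A) (l : ℕ) : powerSum c (l + 1) =
    -((l + 1 : ℕ) * c (l + 1) + ∑ i ∈ Finset.range l, c (i + 1) * powerSum c (l - i)) := by
  rw [powerSum, Finset.sum_range]

theorem symmOfPowerSum_succ (K : Type*) [Field K] [Algebra K A] (p : ℕ → A) (l : ℕ) :
    symmOfPowerSum K p (l + 1) = algebraMap K A (0 - ((l + 1 : ℕ) : K)⁻¹) *
      ∑ i ∈ Finset.range (l + 1), p (i + 1) * symmOfPowerSum K p (l - i) := by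
  rw [symmOfPowerSum, Finset.sum_range]

theorem symmOfPowerSum_congr (K : Type*) [Field K] [Algebra K A] {p p' : ℕ → A} (l : ℕ)
    (h : ∀ i < l, p (i + 1) = p' (i + 1)) : symmOfPowerSum K p l = symmOfPowerSum K p' l := by
  induction l using Nat.strong_induction_on with
  | _ l ih =>
    cases l with
    | zero => rw [symmOfPowerSum, symmOfPowerSum]
    | succ l =>
      rw [symmOfPowerSum_succ, symmOfPowerSum_succ]
      congr 1
      refine Finset.sum_congr rfl fun i hi => ?_
      have := Finset.mem_range.1 hi
      rw [h i (by omega), ih (l - i) (by omega) fun j hj => h j (by omega)]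

/-- The sum of the products of corresponding entries of two lists. -/
def dotList : List A → List A → A
  | x :: a, y :: b => x * y + dotList a b
  | _, _ => 0

theorem dotList_eq_sum (a b : List A) :
    dotList a b = ∑ i ∈ Finset.range b.length, a.getD i 0 * b.getD i 0 := by
  induction b generalizing a with
  | nil => cases a <;> simp [dotList]
  | cons y b ih =>
    cases a with
    | nil => simp [dotList]
    | cons x a =>
      rw [dotList, ih, List.length_cons, Finset.sum_range_succ']
      simp [add_comm]

/-- The coefficients `1, c₁, c₂, …` in descending order of the monic polynomial given by the list
`[c₁, c₂, …]`. -/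
def monicCoeff (c : List A) (i : ℕ) : A := (1 :: c).getD i 0

/-- The sum of the `l`-th powers of the roots of the monic polynomial with the coefficients
`1, c₁, c₂, …` in descending order. -/
def rootPowerSum (c : List A) : ℕ → A
  | 0 => c.length
  | l + 1 => powerSum (monicCoeff c) (l + 1)

/-- The sum of the values of `p` at the roots of the monic polynomial with the coefficients
`1, c₁, c₂, …` in descending order. -/
noncomputable def rootSum (c : List A) (p : Polynomial A) : A :=
  p.sum fun i a => rootPowerSum c i * a

/-- The signed elementary symmetric functions of the values of `θ` at the roots of the monic
polynomial with the coefficients `1, c₁, c₂, …` in descending order. -/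
noncomputable def rootSymm (K : Type*) [Field K] [Algebra K A] (c : List A) (θ : Polynomial A) :
    ℕ → A :=
  symmOfPowerSum K fun j => rootSum c (θ ^ j)

theorem rootSum_ofList (c l : List A) : rootSum c (ofList l) =
    ∑ i ∈ Finset.range l.length, rootPowerSum c i * l.getD i 0 := by
  cases l with
  | nil => simp [rootSum, ofList]
  | cons a l =>
    have h : (ofList (a :: l)).natDegree ≤ l.length :=
      Polynomial.natDegree_le_iff_coeff_eq_zero.2 fun i hi => by
        rw [coeff_ofList, List.getD_eq_default]; simpa using hi
    rw [rootSum, Polynomial.sum_over_range' _ (by simp) (a :: l).length (by simp; omega)]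
    simp only [coeff_ofList]

theorem rootPowerSum_succ (K : Type*) [Field K] [Algebra K A] (c : List A) (l : ℕ) :
    rootPowerSum c (l + 1) = algebraMap K A (0 - 1) * (algebraMap K A (l + 1 : ℕ) * c.getD l 0 +
      dotList c ((List.range l).map fun j => rootPowerSum c (j + 1)).reverse) := by
  rw [rootPowerSum, powerSum_succ, dotList_eq_sum, zero_sub, map_neg, map_one, neg_one_mul,
    map_natCast]
  simp only [List.length_reverse, List.length_map, List.length_range]
  refine congrArg _ (congrArg₂ _ rfl (Finset.sum_congr rfl fun j hj => ?_))
  have hj := Finset.mem_range.1 hj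
  have e : l - j = (l - 1 - j) + 1 := by omega
  rw [e]
  simp [monicCoeff, List.getD_eq_getElem?_getD, hj, rootPowerSum]

theorem symmOfPowerSum_succ_eq_dotList (K : Type*) [Field K] [Algebra K A] (p : List A) (l : ℕ) :
    symmOfPowerSum K (fun i => p.getD (i - 1) 0) (l + 1) =
      algebraMap K A (0 - ((l + 1 : ℕ) : K)⁻¹) * dotList p ((List.range (l + 1)).map
        (symmOfPowerSum K fun i => p.getD (i - 1) 0)).reverse := by
  rw [symmOfPowerSum_succ, dotList_eq_sum]
  simp only [List.length_reverse, List.length_map, List.length_range]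
  refine congrArg _ (Finset.sum_congr rfl fun j hj => ?_)
  have hj := Finset.mem_range.1 hj
  simp [List.getD_eq_getElem?_getD, hj]

theorem rootSum_eq_dotList (c l : List A) : rootSum c (ofList l) =
    dotList ((List.range (l.length + 1)).map (rootPowerSum c)) l := by
  rw [rootSum_ofList, dotList_eq_sum]
  refine Finset.sum_congr rfl fun i hi => ?_
  have hi := Finset.mem_range.1 hi
  simp [List.getD_eq_getElem?_getD, show i < l.length + 1 by omega]

end newton

/-! ### Programs for symmetric functions -/

/-- Second component of a tuple. -/
notation "arg₁" => tl ⨾ hd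
/-- Third component of a tuple. -/
notation "arg₂" => tl ⨾ tl ⨾ hd
/-- Fourth component of a tuple. -/
notation "arg₃" => tl ⨾ tl ⨾ tl ⨾ hd
/-- Fifth component of a tuple. -/
notation "arg₄" => tl ⨾ tl ⨾ tl ⨾ tl ⨾ hd
/-- A tuple without two components. -/
notation "rest₂" => tl ⨾ tl
/-- A tuple without three components. -/
notation "rest₃" => tl ⨾ tl ⨾ tl
/-- A tuple without four components. -/
notation "rest₄" => tl ⨾ tl ⨾ tl ⨾ tl

section newtonP
variable {K : Type u} [Field K] {N n M Dm : ℕ}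

/-- The inclusion of `K` into `K[x₁, …, xₙ][X]`. -/
def constQ : Prog := (.skip ⊠ nilP) ⊠ nilP

variable (n M) in
theorem wp_constQ (a : K) (D : ℕ) :
    wp N constQ (.fld a) (RepQ (n := n) M D (algebraMap K _ a)) := by
  simp only [constQ, wp, app_nil]
  exact repQ_const a D

/-- The length of a list as an element of `K`. -/
def lenP : Prog := (.skip ⊠ .prim .zero) ⨾ each ((tl ⊠ .prim .one) ⨾ .prim .add)

theorem wp_lenP {m : ℕ} {w : Val K} (hw : Counter m w) (hm : m ≤ N) :
    wp N lenP w fun y => y = .fld (m : K) := by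
  simp only [lenP, wp, app_zero]
  refine wp_each_counter (fun i s => ∃ j : ℕ, s = .fld (j : K) ∧ j + i = m) hw hm
    ⟨0, by simp, by omega⟩ ?_ ?_
  · rintro i x s - ⟨j, rfl, h⟩
    simp only [wp, app_snd, app_one, app_add]
    exact ⟨j + 1, by simp, by omega⟩
  · rintro s ⟨j, rfl, h⟩
    rw [← h]; simp

/-- The sum of the products of corresponding entries of two lists. -/
def dotP : Prog :=
  (tl ⊠ (hd ⊠ nilP)) ⨾
  each ((arg₁ ⨾ tl) ⊠ (((((arg₁ ⨾ hd) ⊠ hd) ⨾ mulQ) ⊠ rest₂) ⨾ addQ)) ⨾ tl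

theorem repQ_zero (D : ℕ) : RepQ (K := K) (n := n) M D 0 .nil := RepPoly.nil

theorem wp_dotP (hN : Big n M Dm N) {a b : List (PolyY K n)} {x y : Val K} {D D' : ℕ}
    (hD : D + D' ≤ Dm) (hb : b.length ≤ N) (hx : ListRep (RepQ M D) a x)
    (hy : ListRep (RepQ M D') b y) :
    wp N dotP (.cons x y) (RepQ M (D + D') (dotList a b)) := by
  simp only [dotP, wp, app_fst, app_snd, app_nil]
  refine wp_each (fun b' s => ∃ z t a' q, s = .cons z t ∧ ListRep (RepQ M D) a' z ∧
    RepQ M (D + D') q t ∧ q + dotList a' b' = dotList a b) hy hb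
    ⟨x, .nil, a, 0, rfl, hx, repQ_zero _, by simp⟩ ?_ ?_
  · rintro b₀ b' v s - hv ⟨z, t, a', q, rfl, hz, ht, h⟩
    simp only [wp, app_fst, app_snd]
    have hhd : RepQ M D (a'.headD 0) (Prim.fst.app z) ∧
        ListRep (RepQ M D) a'.tail (Prim.snd.app z) := by
      cases a' with
      | nil => obtain rfl : z = .nil := hz; exact ⟨repQ_zero _, rfl⟩
      | cons a₀ a' => obtain ⟨u, z, rfl, hu, hz⟩ := hz; exact ⟨hu, hz⟩
    refine wp_mono ((implQ hN).mul hD hhd.1 hv) fun u hu => ?_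
    refine wp_mono ((implQ hN).add hD hu ht) fun r hr => ?_
    refine ⟨_, r, a'.tail, _, rfl, hhd.2, hr, ?_⟩
    rw [← h]
    cases a' with
    | nil => simp [dotList]
    | cons a₀ a' => simp [dotList]; ring
  · rintro s ⟨z, t, a', q, rfl, hz, ht, h⟩
    have : dotList a' ([] : List (PolyY K n)) = 0 := by cases a' <;> rfl
    rw [this, add_zero] at h
    rw [← h]; exact ht

/-- `(c, ψ)` is mapped to the list of the `rootPowerSum c l`, for `l ≤ ψ.length`. -/
def rootPowerSumP : Prog :=
  (hd ⨾ lenP ⨾ constQ) ⊠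
  ((tl ⊠ (hd ⊠ (.prim .one ⊠ (hd ⊠ nilP)))) ⨾
  each (arg₁ ⊠ (((arg₂ ⊠ .prim .one) ⨾ .prim .add) ⊠ ((arg₃ ⨾ tl) ⊠
    ((((((.prim .zero ⊠ .prim .one) ⨾ .prim .sub ⨾ constQ) ⊠
      (((((arg₂ ⨾ constQ) ⊠ (arg₃ ⨾ hd)) ⨾ mulQ) ⊠ ((arg₁ ⊠ rest₄) ⨾ dotP)) ⨾ addQ)) ⨾ mulQ)) ⊠
      rest₄)))) ⨾ rest₃ ⨾ revP)

theorem wp_rootPowerSumP (hN : Big n M Dm N) {c : List (PolyY K n)} {x y : Val K} {D m : ℕ}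
    (hD : m * D ≤ Dm) (hc : c.length ≤ N) (hm : m ≤ N) (hx : ListRep (RepQ M D) c x)
    (hy : Counter m y) :
    wp N rootPowerSumP (.cons x y) (ListRep (RepQ M (m * D))
      ((List.range (m + 1)).map (rootPowerSum c))) := by
  simp only [rootPowerSumP, wp, app_fst, app_snd, app_nil, app_one]
  refine wp_mono (wp_lenP hx.counter hc) ?_
  rintro _ rfl
  refine wp_mono (wp_constQ n M _ (m * D)) fun t₀ ht₀ => ?_
  refine wp_each_counter (fun i s => ∃ l z t, l + i = m ∧
    s = .cons x (.cons (.fld ((l + 1 : ℕ) : K)) (.cons z t)) ∧ ListRep (RepQ M D) (c.drop l) z ∧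
    ListRep (RepQ M (l * D)) ((List.range l).map fun j => rootPowerSum c (j + 1)).reverse t) hy hm
    ⟨0, x, .nil, by omega, by simp, by simpa using hx, rfl⟩ ?_ ?_
  · rintro i _ s hi ⟨l, z, t, hl, rfl, hz, ht⟩
    simp only [wp, app_fst, app_snd, app_one, app_add, app_zero, app_sub]
    have hle : D + l * D ≤ Dm :=
      le_trans (by rw [← one_add_mul]; gcongr; omega) hD
    have hle' : D ≤ Dm := by omega
    have hhd : RepQ M D (c.getD l 0) (Prim.fst.app z) ∧
        ListRep (RepQ M D) (c.drop (l + 1)) (Prim.snd.app z) := by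
      rw [← List.tail_drop]
      cases hc : c.drop l with
      | nil =>
        rw [hc] at hz
        obtain rfl : z = .nil := hz
        rw [List.getD_eq_default _ _ (List.drop_eq_nil_iff.1 hc)]
        exact ⟨repQ_zero _, rfl⟩
      | cons a₀ a' =>
        rw [hc] at hz
        obtain ⟨u, z, rfl, hu, hz⟩ := hz
        have : c.getD l 0 = a₀ := by
          have := congrArg (fun l => l.getD 0 0) hc
          simpa [List.getD_eq_getElem?_getD] using this
        rw [this]
        exact ⟨hu, hz⟩
    refine wp_mono (wp_constQ n M _ 0) fun u₁ hu₁ => ?_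
    refine wp_mono (wp_constQ n M _ 0) fun u₂ hu₂ => ?_
    refine wp_mono ((implQ hN).mul (by omega) hu₂ hhd.1) fun u₃ hu₃ => ?_
    refine wp_mono (wp_dotP hN hle (by simp; omega) hx ht) fun u₄ hu₄ => ?_
    refine wp_mono ((implQ hN).add hle ((implQ hN).mono (by omega) hu₃) hu₄) fun u₅ hu₅ => ?_
    refine wp_mono ((implQ hN).mul (by omega) hu₁ hu₅) fun u₆ hu₆ => ?_
    refine ⟨l + 1, _, _, by omega, by push_cast; rfl, hhd.2, ?_⟩
    rw [List.range_succ, List.map_append, List.reverse_append]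
    refine ⟨u₆, t, rfl, ?_, (implQ hN).listMono (by gcongr; omega) ht⟩
    convert hu₆ using 1
    · ring
    · exact rootPowerSum_succ K c l
  · rintro s ⟨l, z, t, hl, rfl, hz, ht⟩
    obtain rfl : l = m := by omega
    simp only [app_snd]
    refine wp_mono (wp_revP ht (by simpa using hm)) fun u hu => ?_
    rw [List.reverse_reverse] at hu
    rw [List.range_succ_eq_map, List.map_cons, List.map_map]
    refine ⟨t₀, u, rfl, ?_, hu⟩
    simpa [rootPowerSum] using ht₀

/-- The program computing `rootSum`. -/
def rootSumP : Prog := (rootPowerSumP ⊠ tl) ⨾ dotP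

theorem wp_rootSumP (hN : Big n M Dm N) {c : List (PolyY K n)} {p : Polynomial (PolyY K n)}
    {x y : Val K} {D D' : ℕ} (hD : (D' + 1) * D + D' ≤ Dm) (hc : c.length ≤ N)
    (hx : ListRep (RepQ M D) c x) (hy : RepZ M D' p y) :
    wp N rootSumP (.cons x y) (RepQ M ((D' + 1) * D + D') (rootSum c p)) := by
  obtain ⟨l, rfl, hl, hy⟩ := hy
  have hlD : l.length * D ≤ (D' + 1) * D := by gcongr; simpa using hl
  have h2 := hN.2
  simp only [rootSumP, wp, app_snd]
  refine wp_mono (wp_rootPowerSumP hN (by omega) hc (by omega) hx hy.counter) fun t ht => ?_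
  refine wp_mono (wp_dotP (D := l.length * D) hN (by omega) (by omega) ht hy) fun u hu => ?_
  refine (implQ hN).mono (D := l.length * D + D') (by omega) ?_
  rw [rootSum_eq_dotList]
  exact hu

/-- The list `[p₁, …, pᵣ]` of power sums is mapped to the list of the signed elementary symmetric
functions of index at most `r`. -/
def symmOfPowerSumP : Prog :=
  (.skip ⊠ (.skip ⊠ (.prim .one ⊠ ((.prim .one ⨾ constQ) ⊠ nilP)))) ⨾
  each (arg₁ ⊠ (((arg₂ ⊠ .prim .one) ⨾ .prim .add) ⊠
    (((((.prim .zero ⊠ (arg₂ ⨾ .prim .inv)) ⨾ .prim .sub ⨾ constQ) ⊠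
      ((arg₁ ⊠ rest₃) ⨾ dotP)) ⨾ mulQ) ⊠ rest₃))) ⨾ rest₂ ⨾ revP

theorem wp_symmOfPowerSumP (hN : Big n M Dm N) {p : List (PolyY K n)} {x : Val K} {D : ℕ}
    (hD : p.length * D ≤ Dm) (hp : p.length + 1 ≤ N) (hx : ListRep (RepQ M D) p x) :
    wp N symmOfPowerSumP x (ListRep (RepQ M (p.length * D))
      ((List.range (p.length + 1)).map (symmOfPowerSum K fun i => p.getD (i - 1) 0))) := by
  simp only [symmOfPowerSumP, wp, app_nil, app_one]
  refine wp_mono (wp_constQ n M _ 0) fun t₀ ht₀ => ?_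
  refine wp_each_counter (fun i s => ∃ l t, l + i = p.length ∧
    s = .cons x (.cons (.fld ((l + 1 : ℕ) : K)) t) ∧
    ListRep (RepQ M (l * D)) ((List.range (l + 1)).map
      (symmOfPowerSum K fun i => p.getD (i - 1) 0)).reverse t) hx.counter (by omega)
    ⟨0, _, by omega, by simp, t₀, .nil, rfl, ?_, rfl⟩ ?_ ?_
  · simpa [symmOfPowerSum] using ht₀
  · rintro i _ s hi ⟨l, t, hl, rfl, ht⟩
    simp only [wp, app_fst, app_snd, app_one, app_add, app_zero, app_sub, app_inv]
    have hle : D + l * D ≤ Dm :=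
      le_trans (by rw [← one_add_mul]; gcongr; omega) hD
    refine wp_mono (wp_constQ n M _ 0) fun u₁ hu₁ => ?_
    refine wp_mono (wp_dotP hN hle (by simp; omega) hx ht) fun u₄ hu₄ => ?_
    refine wp_mono ((implQ hN).mul (by omega) hu₁ hu₄) fun u₆ hu₆ => ?_
    refine ⟨l + 1, _, by omega, by push_cast; rfl, ?_⟩
    rw [List.range_succ, List.map_append, List.reverse_append]
    refine ⟨u₆, t, rfl, ?_, (implQ hN).listMono (by gcongr; omega) ht⟩
    convert hu₆ using 1
    · ring
    · exact symmOfPowerSum_succ_eq_dotList K p l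
  · rintro s ⟨l, t, hl, rfl, ht⟩
    obtain rfl : l = p.length := by omega
    simp only [app_snd]
    refine wp_mono (wp_revP ht (by simpa using hp)) fun u hu => ?_
    rwa [List.reverse_reverse] at hu

/-- The program computing `rootSymm`. -/
def rootSymmP : Prog :=
  (hd ⊠ (hd ⊠ (tl ⊠ (((.prim .one ⨾ constQ) ⊠ nilP) ⊠ nilP)))) ⨾
  each ((((arg₃ ⊠ arg₂) ⨾ mulZ) ⊠ tl) ⨾
    (arg₁ ⊠ (arg₂ ⊠ (hd ⊠ (((arg₁ ⊠ hd) ⨾ rootSumP) ⊠ rest₄))))) ⨾ rest₃ ⨾ revP ⨾ symmOfPowerSumP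

/-- The size of `rootSymm c θ s`, for `c` of length `r` and size `D`, and `θ` of size `D'`. -/
def symmSize (r D D' : ℕ) : ℕ := r * ((r * D' + 1) * D + r * D')

theorem wp_rootSymmP (hN : Big n M Dm N) {c : List (PolyY K n)} {θ : Polynomial (PolyY K n)}
    {x y : Val K} {D D' : ℕ} (hD : symmSize c.length D D' ≤ Dm) (hc : c.length + 1 ≤ N)
    (hx : ListRep (RepQ M D) c x) (hy : RepZ M D' θ y) :
    wp N rootSymmP (.cons x y) (ListRep (RepQ M (symmSize c.length D D'))
      ((List.range (c.length + 1)).map (rootSymm K c θ))) := by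
  simp only [rootSymmP, wp, app_fst, app_snd, app_nil, app_one]
  refine wp_mono (wp_constQ n M _ 0) fun t₀ ht₀ => ?_
  set r := c.length with hr
  refine wp_each_counter (fun i s => ∃ l z t, l + i = r ∧ s = .cons x (.cons y (.cons z t)) ∧
    RepZ M (l * D') (θ ^ l) z ∧ ListRep (RepQ M ((r * D' + 1) * D + r * D'))
      ((List.range l).map fun j => rootSum c (θ ^ (j + 1))).reverse t) hx.counter (by omega)
    ⟨0, _, .nil, by omega, rfl, ?_, rfl⟩ ?_ ?_
  · have := RepPoly.singleton (β := 1) ht₀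
    simpa [RepZ] using this
  · rintro i _ s hi ⟨l, z, t, hl, rfl, hz, ht⟩
    simp only [wp, app_fst, app_snd]
    have e1 : l * D' + D' ≤ r * D' := by rw [← Nat.succ_mul]; gcongr; omega
    have e2 : (r * D' + 1) * D + r * D' ≤ Dm :=
      le_trans (by rw [symmSize]; exact Nat.le_mul_of_pos_left _ (by omega)) hD
    have e3 : (l * D' + D' + 1) * D ≤ (r * D' + 1) * D := by gcongr
    refine wp_mono ((implZ hN).mul (by omega) hz hy) fun u hu => ?_
    refine wp_mono (wp_rootSumP hN (by omega) (by omega) hx hu) fun v hv => ?_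
    refine ⟨l + 1, _, _, by omega, rfl, ?_, ?_⟩
    · rw [Nat.succ_mul, pow_succ]; exact hu
    · rw [List.range_succ, List.map_append, List.reverse_append]
      refine ⟨v, t, rfl, ?_, ht⟩
      have := (implQ hN).mono (D' := (r * D' + 1) * D + r * D') (by omega) hv
      rwa [← pow_succ] at this
  · rintro s ⟨l, z, t, hl, rfl, hz, ht⟩
    obtain rfl : l = r := by omega
    simp only [app_snd]
    refine wp_mono (wp_revP ht (by simp; omega)) fun u hu => ?_
    rw [List.reverse_reverse] at hu
    have := wp_symmOfPowerSumP hN (by simpa [symmSize] using hD) (by simpa using hc) hu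
    simp only [List.length_map, List.length_range] at this
    refine wp_mono this fun v hv => ?_
    rw [symmSize]
    convert hv using 1
    refine List.map_congr_left fun s hs => symmOfPowerSum_congr K s fun i hi => ?_
    have : i < r := by simp at hs; omega
    simp [List.getD_eq_getElem?_getD, this]

end newtonP

/-! ### Symmetric functions of roots -/

section symm
variable {A : Type*} [CommRing A]

/-- Newton's identities for the signed elementary symmetric functions of a finite family. -/
theorem newton_fun {σ : Type*} [Fintype σ] [DecidableEq σ] (f : σ → A) (l : ℕ) :
    (l : A) * ((-1) ^ l * (Finset.univ.val.map f).esymm l) = -∑ i ∈ Finset.range l,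
      ((-1) ^ i * (Finset.univ.val.map f).esymm i) *
        ((Finset.univ.val.map f).map (· ^ (l - i))).sum := by
  have h := congrArg (MvPolynomial.aeval f) (MvPolynomial.mul_esymm_eq_sum σ ℤ l)
  have hp : ∀ j, MvPolynomial.aeval f (MvPolynomial.psum σ ℤ j) =
      ((Finset.univ.val.map f).map (· ^ j)).sum := fun j => by
    rw [Multiset.map_map, MvPolynomial.psum, map_sum, Finset.sum_eq_multiset_sum]
    simp only [map_pow, MvPolynomial.aeval_X, Function.comp_def]
  simp only [map_mul, map_sum, map_pow, map_neg, map_one, map_natCast,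
    MvPolynomial.aeval_esymm_eq_multiset_esymm, hp] at h
  rw [mul_left_comm, h, ← mul_assoc, ← pow_add]
  have : (-1 : A) ^ (l + (l + 1)) = -1 := by
    rw [← add_assoc, pow_succ, ← two_mul, pow_mul]; simp
  rw [this, neg_one_mul, Finset.sum_filter, Finset.Nat.sum_antidiagonal_eq_sum_range_succ_mk,
    Finset.sum_range_succ, if_neg (by simp), add_zero]
  refine congrArg _ (Finset.sum_congr rfl fun i hi => if_pos (Finset.mem_range.1 hi))

/-- Newton's identities for the signed elementary symmetric functions of a multiset. -/
theorem newton_multiset (Z : Multiset A) (l : ℕ) :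
    (l : A) * ((-1) ^ l * Z.esymm l) =
      -∑ i ∈ Finset.range l, ((-1) ^ i * Z.esymm i) * (Z.map (· ^ (l - i))).sum := by
  induction Z using Quotient.inductionOn with
  | _ L =>
    have h := newton_fun L.get l
    rwa [Fin.univ_val_map, List.ofFn_get] at h

theorem rootPowerSum_eq_sum {c : List A} {Z : Multiset A} (hc : c.length = Z.card)
    (h : ∀ i, monicCoeff c i = (-1) ^ i * Z.esymm i) (l : ℕ) :
    rootPowerSum c l = (Z.map (· ^ l)).sum := by
  cases l with
  | zero => simp [rootPowerSum, hc]
  | succ l =>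
    rw [rootPowerSum]
    induction l using Nat.strong_induction_on with
    | _ l ih =>
      have e := newton_multiset Z (l + 1)
      have h0 : Z.esymm 0 = 1 := by simp [Multiset.esymm]
      rw [Finset.sum_range_succ', h0] at e
      have e' : ∑ i ∈ Finset.range l, monicCoeff c (i + 1) * powerSum (monicCoeff c) (l - i) =
          ∑ k ∈ Finset.range l,
            (-1) ^ (k + 1) * Z.esymm (k + 1) * (Z.map (· ^ (l + 1 - (k + 1)))).sum := by
        refine Finset.sum_congr rfl fun i hi => ?_
        have hi := Finset.mem_range.1 hi
        rw [h, show l - i = l - i - 1 + 1 by omega, ih _ (by omega),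
          show l + 1 - (i + 1) = l - i - 1 + 1 by omega]
      rw [powerSum_succ, h, e, e', pow_zero, one_mul, one_mul, Nat.sub_zero]
      ring

theorem rootSum_eq_sum {c : List A} {Z : Multiset A} (hc : c.length = Z.card)
    (h : ∀ i, monicCoeff c i = (-1) ^ i * Z.esymm i) (p : Polynomial A) :
    rootSum c p = (Z.map p.eval).sum := by
  rw [rootSum, Polynomial.sum]
  simp only [Polynomial.eval_eq_sum, Polynomial.sum, rootPowerSum_eq_sum hc h]
  rw [Multiset.sum_map_sum]
  refine Finset.sum_congr rfl fun i _ => ?_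
  rw [Multiset.sum_map_mul_left, mul_comm]

theorem rootSymm_eq_esymm (K : Type*) [Field K] [CharZero K] [Algebra K A] {c : List A}
    {Z : Multiset A} (hc : c.length = Z.card)
    (h : ∀ i, monicCoeff c i = (-1) ^ i * Z.esymm i) (θ : Polynomial A) (s : ℕ) :
    rootSymm K c θ s = (-1) ^ s * (Z.map θ.eval).esymm s := by
  rw [rootSymm]
  induction s using Nat.strong_induction_on with
  | _ s ih =>
    cases s with
    | zero => simp [symmOfPowerSum, Multiset.esymm]
    | succ s =>
      have e := newton_multiset (Z.map θ.eval) (s + 1)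
      rw [symmOfPowerSum_succ, ← Finset.sum_range_reflect]
      have e' : ∑ i ∈ Finset.range (s + 1), rootSum c (θ ^ (s + 1 - 1 - i + 1)) *
          symmOfPowerSum K (fun j => rootSum c (θ ^ j)) (s - (s + 1 - 1 - i)) =
          ∑ i ∈ Finset.range (s + 1), (-1) ^ i * (Z.map θ.eval).esymm i *
            ((Z.map θ.eval).map (· ^ (s + 1 - i))).sum := by
        refine Finset.sum_congr rfl fun i hi => ?_
        have hi := Finset.mem_range.1 hi
        rw [show s - (s + 1 - 1 - i) = i by omega, ih i hi, rootSum_eq_sum hc h, mul_comm,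
          Multiset.map_map, show s + 1 - 1 - i + 1 = s + 1 - i by omega]
        simp
      have e'' : (algebraMap K A (0 - ((s + 1 : ℕ) : K)⁻¹)) * -((s + 1 : ℕ) : A) = 1 := by
        rw [← map_natCast (algebraMap K A), ← map_neg, ← map_mul, zero_sub, neg_mul_neg,
          inv_mul_cancel₀ (Nat.cast_ne_zero.2 s.succ_ne_zero), map_one]
      rw [e', ← neg_neg (Finset.sum _ _), ← e, ← neg_mul, ← mul_assoc, e'', one_mul]

/-! ### Naturality -/

variable {B : Type*} [CommRing B] (K : Type*) [Field K] [Algebra K A] [Algebra K B]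

theorem map_monicCoeff (f : A →+* B) (c : List A) (i : ℕ) :
    f (monicCoeff c i) = monicCoeff (c.map f) i := by
  simp only [monicCoeff, List.getD_eq_getElem?_getD]
  rw [show (1 : B) :: c.map f = (1 :: c).map f by simp, List.getElem?_map]
  cases (1 :: c)[i]? <;> simp

theorem map_powerSum (f : A →+* B) (c : ℕ → A) (l : ℕ) :
    f (powerSum c l) = powerSum (fun i => f (c i)) l := by
  induction l using Nat.strong_induction_on with
  | _ l ih =>
    cases l with
    | zero => simp [powerSum]
    | succ l =>
      rw [powerSum_succ, powerSum_succ]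
      simp only [map_neg, map_add, map_mul, map_natCast, map_sum]
      refine congrArg _ (congrArg _ (Finset.sum_congr rfl fun i _ => ?_))
      rw [ih _ (by omega)]

theorem map_rootSum (f : A →+* B) (c : List A) (p : Polynomial A) :
    f (rootSum c p) = rootSum (c.map f) (p.map f) := by
  rw [rootSum, rootSum, Polynomial.sum_over_range _ (by simp),
    Polynomial.sum_over_range' _ (by simp) _ (Nat.lt_succ_of_le Polynomial.natDegree_map_le),
    map_sum]
  refine Finset.sum_congr rfl fun i _ => ?_
  rw [map_mul, Polynomial.coeff_map]
  congr 1
  cases i with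
  | zero => simp [rootPowerSum]
  | succ i => simp [rootPowerSum, map_powerSum, map_monicCoeff]

theorem map_rootSymm (f : A →ₐ[K] B) (c : List A) (p : Polynomial A) (s : ℕ) :
    f (rootSymm K c p s) = rootSymm K (c.map f) (p.map (f : A →+* B)) s := by
  rw [rootSymm, rootSymm]
  induction s using Nat.strong_induction_on with
  | _ s ih =>
    cases s with
    | zero => simp [symmOfPowerSum]
    | succ s =>
      rw [symmOfPowerSum_succ, symmOfPowerSum_succ]
      simp only [map_mul, map_sum, AlgHom.commutes]
      refine congrArg _ (Finset.sum_congr rfl fun i _ => ?_)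
      rw [ih _ (by omega)]
      congr 1
      have := map_rootSum (f : A →+* B) c (p ^ (i + 1))
      rw [Polynomial.map_pow] at this
      exact this

end symm

section
variable {A : Type*} [CommRing A] {B : Type*} [CommRing B]

/-! ### Elementary symmetric functions of multisets with zeros -/

theorem esymm_zero_cons (Z : Multiset A) (s : ℕ) : (0 ::ₘ Z).esymm s = Z.esymm s := by
  cases s with
  | zero => simp [Multiset.esymm]
  | succ s => simp [Multiset.esymm, Multiset.powersetCard_cons, Multiset.map_map]

open Classical in
/-- Zeros do not contribute to elementary symmetric functions. -/
theorem esymm_filter_ne_zero (Z : Multiset A) (s : ℕ) :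
    (Z.filter (· ≠ 0)).esymm s = Z.esymm s := by
  induction Z using Multiset.induction_on generalizing s with
  | empty => rfl
  | cons a Z ih =>
    by_cases ha : a = 0
    · rw [Multiset.filter_cons_of_neg (p := (· ≠ 0)) _ (by simpa using ha), ih, ha, esymm_zero_cons]
    · rw [Multiset.filter_cons_of_pos (p := (· ≠ 0)) _ ha]
      cases s with
      | zero => simp [Multiset.esymm]
      | succ s =>
        have h1 := ih (s + 1)
        have h2 := ih s
        simp only [Multiset.esymm, Multiset.powersetCard_cons, Multiset.map_add, Multiset.sum_add,
          Multiset.map_map, Function.comp_def, Multiset.prod_cons,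
          Multiset.sum_map_mul_left] at *
        rw [h1, h2]

theorem esymm_eq_zero_of_card_lt {Z : Multiset A} {s : ℕ} (h : Z.card < s) : Z.esymm s = 0 := by
  rw [Multiset.esymm, Multiset.powersetCard_eq_empty _ h]; rfl

theorem esymm_card (Z : Multiset A) : Z.esymm Z.card = Z.prod := by
  induction Z using Quotient.inductionOn with
  | _ L =>
    change (((L : Multiset A).powersetCard L.length).map Multiset.prod).sum = _
    rw [Multiset.powersetCard_coe, List.sublistsLen_length]
    simp

theorem map_esymm (f : A →+* B) (Z : Multiset A) (s : ℕ) :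
    f (Z.esymm s) = (Z.map f).esymm s := by
  simp only [Multiset.esymm, Multiset.powersetCard_map, Multiset.map_map, map_multiset_sum,
    Function.comp_def, map_multiset_prod]

/-! ### Monic polynomials given by their lower coefficients -/

open Polynomial

/-- The monic polynomial with the coefficients `1, c₁, c₂, …` in descending order. -/
noncomputable def monicPoly (c : List A) : A[X] := X ^ c.length + ofList c.reverse

theorem ofList_natDegree_lt {l : List A} {m : ℕ} (h : l.length ≤ m) : (ofList l).degree < m :=
  (degree_lt_iff_coeff_zero _ _).2 fun i hi => by
    rw [coeff_ofList, List.getD_eq_default _ _ (by omega)]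

theorem map_monicPoly (f : A →+* B) (c : List A) :
    (monicPoly c).map f = monicPoly (c.map f) := by
  simp [monicPoly, ← ofList_map]

theorem monic_monicPoly (c : List A) : (monicPoly c).Monic :=
  monic_X_pow_add (ofList_natDegree_lt (by simp))

theorem natDegree_monicPoly [Nontrivial A] (c : List A) : (monicPoly c).natDegree = c.length := by
  have h := degree_add_eq_left_of_degree_lt (p := X ^ c.length) (q := ofList c.reverse)
    (by rw [degree_X_pow]; exact ofList_natDegree_lt (by simp))
  rw [degree_X_pow] at h
  exact natDegree_eq_of_degree_eq_some h

theorem coeff_monicPoly (c : List A) {i : ℕ} (hi : i ≤ c.length) :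
    (monicPoly c).coeff (c.length - i) = monicCoeff c i := by
  rw [monicPoly, coeff_add, coeff_X_pow, coeff_ofList, monicCoeff]
  cases i with
  | zero => simp
  | succ i =>
    rw [if_neg (by omega), zero_add, List.getD_cons_succ, List.getD_eq_getElem?_getD,
      List.getElem?_reverse (by omega), List.getD_eq_getElem?_getD]
    congr 2; omega

theorem card_roots_monicPoly {E : Type*} [Field E] [IsAlgClosed E] (c : List E) :
    (monicPoly c).roots.card = c.length := by
  rw [IsAlgClosed.card_roots_eq_natDegree, natDegree_monicPoly]

/-- Vieta's formulas. -/
theorem monicCoeff_eq_esymm {E : Type*} [Field E] [IsAlgClosed E] (c : List E) (i : ℕ) :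
    monicCoeff c i = (-1) ^ i * (monicPoly c).roots.esymm i := by
  have hr := card_roots_monicPoly c
  by_cases hi : i ≤ c.length
  · have := coeff_eq_esymm_roots_of_card (p := monicPoly c)
      (by rw [hr, natDegree_monicPoly]) (k := c.length - i) (by rw [natDegree_monicPoly]; omega)
    rw [← coeff_monicPoly c hi, this, (monic_monicPoly c).leadingCoeff, natDegree_monicPoly,
      Nat.sub_sub_self hi, one_mul]
  · rw [esymm_eq_zero_of_card_lt (by omega), monicCoeff, List.getD_eq_default _ _ (by simp; omega),
      mul_zero]

/-! ### Products over selected roots -/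

/-- The signed elementary symmetric function of index `s` of the linear polynomials
`φ(ζ) * (α * X - ζ)`, where `ζ` runs over the roots of the monic polynomial given by `c`. -/
noncomputable def sel (K : Type*) [Field K] [Algebra K A] (c : List A) (φ : A[X]) (α : A) (s : ℕ) :
    A[X] :=
  rootSymm K (c.map C) (φ.map C * (C (C α * X) - X)) s

theorem map_sel (K : Type*) [Field K] [Algebra K A] [Algebra K B] (f : A →ₐ[K] B) (c : List A)
    (φ : A[X]) (α : A) (s : ℕ) :
    (sel K c φ α s).map (f : A →+* B) =
      sel K (c.map f) (φ.map (f : A →+* B)) (f α) s := by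
  have h := map_rootSymm K (mapAlgHom f) (c.map C) (φ.map C * (C (C α * X) - X)) s
  rw [coe_mapAlgHom] at h
  rw [sel, sel, h]
  congr 1
  · simp [List.map_map, Function.comp_def]
  · have e : ((mapAlgHom f : A[X] →ₐ[K] B[X]) : A[X] →+* B[X]).comp C = C.comp (f : A →+* B) := by
      ext : 1
      simp
    rw [Polynomial.map_mul, Polynomial.map_map, Polynomial.map_map, e]
    simp

theorem sel_eq_esymm (K : Type*) [Field K] [CharZero K] {E : Type*} [Field E] [Algebra K E]
    [IsAlgClosed E] (c : List E) (φ : E[X]) (α : E) (s : ℕ) :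
    sel K c φ α s = (-1) ^ s * ((monicPoly c).roots.map fun ζ =>
      C (φ.eval ζ) * (C α * X - C ζ)).esymm s := by
  rw [sel, rootSymm_eq_esymm K (Z := (monicPoly c).roots.map C)
    (by simp [card_roots_monicPoly]) fun i => ?_]
  · rw [Multiset.map_map]
    congr 3
    ext1 ζ
    simp [eval_map, eval₂_at_apply]
  · rw [← map_monicCoeff, monicCoeff_eq_esymm, map_mul, map_esymm]
    simp

end

section
open Polynomial
variable {E : Type*} [Field E]

open Classical in
/-- The roots, with multiplicity, at which `φ` does not vanish. -/
noncomputable def selRoots (c : List E) (φ : E[X]) : Multiset E :=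
  (monicPoly c).roots.filter fun ζ => φ.eval ζ ≠ 0

theorem mem_selRoots {c : List E} {φ : E[X]} {ζ : E} :
    ζ ∈ selRoots c φ ↔ (monicPoly c).eval ζ = 0 ∧ φ.eval ζ ≠ 0 := by
  classical
  rw [selRoots, Multiset.mem_filter, mem_roots (monic_monicPoly c).ne_zero, IsRoot.def]

end

section
open Polynomial
variable {K : Type*} [Field K] [CharZero K] {E : Type*} [Field E] [Algebra K E] [IsAlgClosed E]

theorem card_selRoots_le (c : List E) (φ : E[X]) : (selRoots c φ).card ≤ c.length := by
  classical
  exact (Multiset.card_le_card (Multiset.filter_le _ _)).trans (card_roots_monicPoly c).le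

theorem sel_eq_selRoots (c : List E) (φ : E[X]) {α : E} (hα : α ≠ 0) (s : ℕ) :
    sel K c φ α s = (-1) ^ s * ((selRoots c φ).map fun ζ =>
      C (φ.eval ζ) * (C α * X - C ζ)).esymm s := by
  classical
  rw [sel_eq_esymm, ← esymm_filter_ne_zero, Multiset.filter_map, selRoots]
  congr 3
  convert Multiset.filter_congr (s := (monicPoly c).roots) fun ζ _ => ?_
  have : C α * X - C ζ ≠ 0 := fun h => hα (by simpa using congrArg (fun p => p.coeff 1) h)
  simp [this]

theorem sel_eq_zero_of_card_lt (c : List E) (φ : E[X]) {α : E} (hα : α ≠ 0) {s : ℕ}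
    (hs : (selRoots c φ).card < s) : sel K c φ α s = 0 := by
  rw [sel_eq_selRoots c φ hα, esymm_eq_zero_of_card_lt (by simpa using hs), mul_zero]

/-- If the index is the number of selected roots, then the only product of that many nonzero factors
is the product of all of them. -/
theorem sel_card (c : List E) (φ : E[X]) {α : E} (hα : α ≠ 0) :
    sel K c φ α (selRoots c φ).card = (-1) ^ (selRoots c φ).card *
      ((selRoots c φ).map fun ζ => C (φ.eval ζ) * (C α * X - C ζ)).prod := by
  rw [sel_eq_selRoots c φ hα]
  conv_lhs => rw [← Multiset.card_map (fun ζ => C (φ.eval ζ) * (C α * X - C ζ)), esymm_card]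
  simp

theorem natDegree_sel_card_le (c : List E) (φ : E[X]) {α : E} (hα : α ≠ 0) :
    (sel K c φ α (selRoots c φ).card).natDegree ≤ (selRoots c φ).card := by
  rw [sel_card c φ hα]
  have h1 : ((-1 : E[X]) ^ (selRoots c φ).card).natDegree = 0 := by
    rw [← C_1, ← C_neg, ← C_pow, natDegree_C]
  refine natDegree_mul_le.trans ?_
  rw [h1, zero_add]
  refine (natDegree_multiset_prod_le _).trans ?_
  rw [Multiset.map_map]
  refine (Multiset.sum_le_card_nsmul _ 1 fun x hx => ?_).trans (by simp)
  obtain ⟨ζ, -, rfl⟩ := Multiset.mem_map.1 hx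
  refine natDegree_mul_le.trans ?_
  rw [natDegree_C, zero_add]
  exact (natDegree_sub_le _ _).trans (by simpa using natDegree_C_mul_le α X)

theorem coeff_sel_card_ne_zero (c : List E) (φ : E[X]) {α : E} (hα : α ≠ 0) :
    (sel K c φ α (selRoots c φ).card).coeff (selRoots c φ).card ≠ 0 := by
  rw [sel_card c φ hα, ← C_1, ← C_neg, ← C_pow, coeff_C_mul]
  have h := coeff_multiset_prod_of_natDegree_le
    ((selRoots c φ).map fun ζ => C (φ.eval ζ) * (C α * X - C ζ)) 1 fun p hp => by
      obtain ⟨ζ, -, rfl⟩ := Multiset.mem_map.1 hp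
      refine natDegree_mul_le.trans ?_
      rw [natDegree_C, zero_add]
      exact (natDegree_sub_le _ _).trans (by simpa using natDegree_C_mul_le α X)
  rw [Multiset.card_map, mul_one] at h
  rw [h]
  refine mul_ne_zero (pow_ne_zero _ (by simp)) (Multiset.prod_ne_zero fun h0 => ?_)
  rw [Multiset.map_map] at h0
  obtain ⟨ζ, hζ, h0⟩ := Multiset.mem_map.1 h0
  have := (mem_selRoots.1 hζ).2
  simp [this, hα, coeff_C] at h0

/-- The number of selected roots is the greatest index for which `sel` does not vanish. -/
theorem card_selRoots_eq {c : List E} {φ : E[X]} {α : E} (hα : α ≠ 0) {s : ℕ}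
    (h0 : sel K c φ α s ≠ 0) (h : ∀ s', s < s' → s' ≤ c.length → sel K c φ α s' = 0) :
    (selRoots c φ).card = s := by
  refine le_antisymm (le_of_not_gt fun hs => ?_) (le_of_not_gt fun hs =>
    h0 (sel_eq_zero_of_card_lt c φ hα hs))
  apply coeff_sel_card_ne_zero (K := K) c φ hα
  rw [h _ hs (card_selRoots_le c φ), coeff_zero]

/-- If `α` vanishes, then `sel K c φ α s` is constant in `X`; so the condition that its coefficient
of degree `s` does not vanish implies `α ≠ 0`. -/
theorem coeff_sel_zero (c : List E) (φ : E[X]) {s : ℕ} (hs : s ≠ 0) :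
    (sel K c φ 0 s).coeff s = 0 := by
  have : (fun ζ => C (φ.eval ζ) * (C (0 : E) * X - C ζ)) = fun ζ => C (φ.eval ζ * -ζ) := by
    funext ζ; simp
  rw [sel_eq_esymm, this, ← C_1, ← C_neg, ← C_pow]
  have := map_esymm (C : E →+* E[X]) ((monicPoly c).roots.map fun ζ => φ.eval ζ * -ζ) s
  rw [Multiset.map_map] at this
  rw [show (fun ζ => C (φ.eval ζ * -ζ)) = C ∘ fun ζ => φ.eval ζ * -ζ from rfl, ← this,
    ← C_mul, coeff_C, if_neg hs]

end

section
open Polynomial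
variable {A : Type*} [CommRing A] {B : Type*} [CommRing B]

/-! ### Homogenization -/

/-- The list `[x₀, x₁, …]` is mapped to `[x₀ * pw, x₁ * α * pw, x₂ * α ^ 2 * pw, …]`. -/
def homog (α : A) : A → List A → List A
  | _, [] => []
  | pw, x :: l => x * pw :: homog α (pw * α) l

@[simp] theorem length_homog (α pw : A) (l : List A) : (homog α pw l).length = l.length := by
  induction l generalizing pw with
  | nil => rfl
  | cons x l ih => simp [homog, ih]

theorem map_homog (f : A →+* B) (α pw : A) (l : List A) :
    (homog α pw l).map f = homog (f α) (f pw) (l.map f) := by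
  induction l generalizing pw with
  | nil => rfl
  | cons x l ih => simp [homog, ih]

/-- The factor `α` on the left stands for a division by `α` on the right, so that `α` need not be
invertible. -/
theorem eval_homog (α pw y : A) (l : List A) :
    α * (ofList (homog α pw l).reverse).eval (α * y) =
      pw * α ^ l.length * (ofList l.reverse).eval y := by
  induction l generalizing pw with
  | nil => simp [homog, ofList]
  | cons x l ih =>
    simp only [homog, List.reverse_cons, ofList_append, eval_add, mul_add, ih, List.length_reverse,
      length_homog, List.length_cons, eval_mul, eval_pow, eval_X, ofList, eval_C,
      mul_zero, add_zero]
    ring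

/-- If `η` is a root of the polynomial with leading coefficient `α ≠ 0` and further coefficients
`l`, then `α * η` is a root of a monic polynomial. -/
theorem eval_monicPoly_homog (α y : A) (l : List A) :
    α * (monicPoly (homog α 1 l)).eval (α * y) =
      α ^ l.length * (ofList (α :: l).reverse).eval y := by
  rw [monicPoly, eval_add, mul_add, eval_homog]
  simp only [length_homog, eval_pow, eval_X, List.reverse_cons, ofList_append, eval_add, eval_mul,
    ofList, eval_C, List.length_reverse, mul_zero, add_zero]
  ring

/-! ### Derivatives of monic polynomials -/

/-- The lower coefficients of the derivative of a monic polynomial, up to the factor `ρ⁻¹`. -/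
def derivList (K : Type*) [Field K] [Algebra K A] (ρ : K) : List A → List A
  | [] => []
  | [_] => []
  | x :: y :: l => algebraMap K A (((l.length + 1 : ℕ) : K) * ρ) * x :: derivList K ρ (y :: l)

/-- The lower coefficients of the monic polynomial that is proportional to the derivative of the
monic polynomial with the lower coefficients `c`. -/
def nextList (K : Type*) [Field K] [Algebra K A] (c : List A) : List A :=
  derivList K (c.length : K)⁻¹ c

theorem length_derivList (K : Type*) [Field K] [Algebra K A] (ρ : K) (c : List A) :
    (derivList K ρ c).length = c.length - 1 := by
  fun_induction derivList K ρ c with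
  | case1 => rfl
  | case2 => rfl
  | case3 x y l ih => simp [ih]

theorem length_nextList (K : Type*) [Field K] [Algebra K A] (c : List A) :
    (nextList K c).length = c.length - 1 := length_derivList K _ c

theorem map_nextList (K : Type*) [Field K] [Algebra K A] [Algebra K B] (f : A →ₐ[K] B)
    (c : List A) : (nextList K c).map f = nextList K (c.map f) := by
  rw [nextList, nextList, List.length_map]
  generalize (c.length : K)⁻¹ = ρ
  fun_induction derivList K ρ c with
  | case1 => rfl
  | case2 => rfl
  | case3 x y l ih =>
    rw [List.map_cons, ih]
    simp [derivList]

theorem derivative_ofList_reverse (K : Type*) [Field K] [Algebra K A] {ρ r : K} (hρ : r * ρ = 1)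
    (c : List A) : derivative (ofList c.reverse) =
      C (algebraMap K A r) * ofList (derivList K ρ c).reverse := by
  fun_induction derivList K ρ c with
  | case1 => simp [ofList]
  | case2 => simp [ofList]
  | case3 x y l ih =>
    have e : r * (((l.length + 1 : ℕ) : K) * ρ) = ((l.length + 1 : ℕ) : K) := by
      rw [mul_left_comm, hρ, mul_one]
    have e' : algebraMap K A r * algebraMap K A (((l.length + 1 : ℕ) : K) * ρ) =
        ((l.length + 1 : ℕ) : A) := by rw [← map_mul, e, map_natCast]
    rw [List.reverse_cons, ofList_append, derivative_add, ih,
      List.reverse_cons (as := derivList K ρ (y :: l)), ofList_append, mul_add]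
    congr 1
    simp only [ofList, mul_zero, add_zero, derivative_mul, derivative_X_pow, derivative_C,
      List.length_reverse, length_derivList, List.length_cons, Nat.add_sub_cancel, C_mul]
    rw [mul_left_comm, ← mul_assoc (C (algebraMap K A r)), ← C_mul, e']
    ring

theorem derivative_monicPoly (K : Type*) [Field K] [CharZero K] [Algebra K A] (c : List A) :
    derivative (monicPoly c) =
      C (algebraMap K A c.length) * monicPoly (nextList K c) := by
  cases c with
  | nil => simp [monicPoly, ofList]
  | cons x c =>
    rw [monicPoly, derivative_add, nextList,
      derivative_ofList_reverse K (r := ((x :: c).length : K)) (mul_inv_cancel₀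
        (Nat.cast_ne_zero.2 (by simp))), monicPoly, length_derivList, derivative_X_pow,
      mul_add, map_natCast (algebraMap K A)]

/-! ### Linear combinations without accidental zeros -/

/-- `g₁ * κ ^ (k - 1) + … + gₖ`. -/
def combo (κ : A) (l : List A) : A := l.foldl (fun b g => κ * b + g) 0

theorem combo_eq_eval (κ : A) (l : List A) : combo κ l = (ofList l.reverse).eval κ := by
  induction l using List.reverseRecOn with
  | nil => simp [combo, ofList]
  | append_singleton l a ih =>
    rw [combo, List.foldl_append, ← combo, ih]
    simp [ofList, add_comm]

theorem combo_map (f : A →+* B) (κ : A) (l : List A) : f (combo κ l) = combo (f κ) (l.map f) := by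
  induction l using List.reverseRecOn with
  | nil => simp [combo]
  | append_singleton l a ih =>
    rw [List.map_append, combo, combo, List.foldl_append, List.foldl_append, ← combo, ← combo]
    simp [ih]

/-- For some natural number `κ < b`, the combination of the polynomials `gs` vanishes at an element
of `Z` only if all of them do: at each `ζ`, the combination is a polynomial in `κ`, and the bad
values of `κ` are the roots of the product of those polynomials that are nonzero. -/
theorem exists_combo_ne_zero {E : Type*} [Field E] [CharZero E] (Z : Multiset E) (gs : List E[X])
    {b : ℕ} (hb : Z.card * gs.length < b) : ∃ κ < b, ∀ ζ ∈ Z, ∀ g ∈ gs, g.eval ζ ≠ 0 →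
      combo (κ : E) (gs.map fun g => g.eval ζ) ≠ 0 := by
  classical
  let q : E → E[X] := fun ζ => ofList (gs.map fun g => g.eval ζ).reverse
  let Z' := Z.filter fun ζ => q ζ ≠ 0
  have hne : (Z'.map q).prod ≠ 0 := Multiset.prod_ne_zero fun h => by
    obtain ⟨ζ, hζ, h⟩ := Multiset.mem_map.1 h
    exact (Multiset.mem_filter.1 hζ).2 h
  have hdeg : (Z'.map q).prod.natDegree < b := by
    refine ((natDegree_multiset_prod_le _).trans ?_).trans_lt hb
    rw [Multiset.map_map]
    refine (Multiset.sum_le_card_nsmul _ gs.length fun x hx => ?_).trans ?_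
    · obtain ⟨ζ, -, rfl⟩ := Multiset.mem_map.1 hx
      refine natDegree_le_iff_coeff_eq_zero.2 fun i hi => ?_
      rw [coeff_ofList, List.getD_eq_default _ _ (by simp; omega)]
    · rw [Multiset.card_map, smul_eq_mul]
      exact Nat.mul_le_mul_right _ (Multiset.card_le_card (Multiset.filter_le _ _))
  obtain ⟨κ, hκ, h⟩ : ∃ κ < b, (Z'.map q).prod.eval (κ : E) ≠ 0 := by
    by_contra! h
    refine hne (eq_zero_of_natDegree_lt_card_of_eval_eq_zero _ (f := fun i : Fin b => (i : E))
      (fun i j h => by simpa [Fin.ext_iff] using h) (fun i => h i i.2) (by simpa using hdeg))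
  refine ⟨κ, hκ, fun ζ hζ g hg hgζ h0 => h ?_⟩
  have hq : q ζ ≠ 0 := fun h => hgζ <| by
    have h1 : g.eval ζ ∈ (gs.map fun g => g.eval ζ).reverse := by simpa using ⟨g, hg, rfl⟩
    obtain ⟨i, hi, h1⟩ := List.getElem_of_mem h1
    have h2 := congrArg (fun p => p.coeff i) h
    simp only [q, coeff_ofList, coeff_zero] at h2
    rwa [List.getD_eq_getElem _ _ hi, h1] at h2
  rw [eval_multiset_prod, Multiset.map_map]
  refine Multiset.prod_eq_zero (Multiset.mem_map.2 ⟨ζ, Multiset.mem_filter.2 ⟨hζ, hq⟩, ?_⟩)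
  simpa [q, ← combo_eq_eval] using h0

end

/-! ### Candidates for components -/

section
open Polynomial
variable {A : Type*} [CommRing A] {B : Type*} [CommRing B] (K : Type*) [Field K] [Algebra K A]
  [Algebra K B]

/-- The data from which a component is built: the polynomial of the component is `sel K c φ α s`,
up to terms of degree greater than `s`. -/
structure Datum (A : Type*) [CommRing A] where
  /-- The lower coefficients of a monic polynomial, whose roots are of the form `α * η`. -/
  c : List A
  /-- The leading coefficient of the polynomial from which `c` is derived. -/
  α : A
  /-- The polynomial that does not vanish at the selected roots. -/
  φ : Polynomial A
  /-- Homogenizations of the given equations. -/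
  ghat : List (Polynomial A)
  /-- The presumed number of selected roots. -/
  s : ℕ

/-- The image of a datum under a homomorphism. -/
noncomputable def Datum.map (f : A →+* B) (τ : Datum A) : Datum B where
  c := τ.c.map f
  α := f τ.α
  φ := τ.φ.map f
  ghat := τ.ghat.map (Polynomial.map f)
  s := τ.s

/-- The polynomial of a component, up to terms of degree greater than `τ.s`. -/
noncomputable def Datum.poly (τ : Datum A) : A[X] := sel K τ.c τ.φ τ.α τ.s

/-- The polynomials whose vanishing says that the number of selected roots is at most `τ.s`, and
that the given equations hold at all of them. -/
noncomputable def Datum.eqs (τ : Datum A) : List A[X] :=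
  ((List.range (τ.c.length + 1)).map (sel K τ.c τ.φ τ.α)).drop (τ.s + 1) ++
    τ.ghat.flatMap fun g => ((List.range (τ.c.length + 1)).map (sel K τ.c (τ.φ * g) τ.α)).tail

theorem Datum.map_poly (f : A →ₐ[K] B) (τ : Datum A) :
    (τ.poly K).map (f : A →+* B) = (τ.map (f : A →+* B)).poly K :=
  map_sel K f _ _ _ _

theorem Datum.map_eqs (f : A →ₐ[K] B) (τ : Datum A) :
    (τ.eqs K).map (Polynomial.map (f : A →+* B)) = (τ.map (f : A →+* B)).eqs K := by
  simp only [eqs, List.map_append, List.map_drop, List.map_flatMap, List.map_map, List.map_tail,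
    Datum.map, List.length_map, List.flatMap_map, Function.comp_def, map_sel, Polynomial.map_mul]
  rfl

/-- The polynomial `α ^ l.length * f(X / α) / α`, where `f` is the polynomial with the
coefficients `l` in ascending order. -/
noncomputable def homogPoly (α : A) (l : List A) : A[X] := ofList (homog α 1 l.reverse).reverse

theorem eval_homogPoly (α y : A) (l : List A) :
    α * (homogPoly α l).eval (α * y) = α ^ l.length * (ofList l).eval y := by
  rw [homogPoly, eval_homog, List.length_reverse, List.reverse_reverse, one_mul]

theorem map_homogPoly (f : A →+* B) (α : A) (l : List A) :
    (homogPoly α l).map f = homogPoly (f α) (l.map f) := by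
  rw [homogPoly, ← ofList_map, List.map_reverse, map_homog, map_one, List.map_reverse, homogPoly]

/-- The datum for the equations `gs` and the inequation `g₀`, given by their coefficients in
ascending order, where `l` lists the coefficients of one of the equations in descending order,
beginning with the presumed leading one. Further guesses are the number `m` of derivatives, the
number `κ` in the linear combination of the equations, the number `s₁` of roots at which this
combination does not vanish, and the number `s` of the roots that are finally selected: the simple
ones that come from common zeros of the equations at which the inequation holds. -/
noncomputable def mkDatum (gs : List (List A)) (g₀ : List A) (l : List A) (m κ s₁ s : ℕ) :
    Datum A where
  c := (nextList K)^[m] (homog (l.headD 0) 1 l.tail)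
  α := l.headD 0
  φ := sel K ((nextList K)^[m] (homog (l.headD 0) 1 l.tail))
      (combo (algebraMap K A[X] κ) (gs.map (homogPoly (l.headD 0)))) 1 s₁ *
    (monicPoly (nextList K ((nextList K)^[m] (homog (l.headD 0) 1 l.tail))) *
      homogPoly (l.headD 0) g₀)
  ghat := gs.map (homogPoly (l.headD 0))
  s := s

theorem length_iterate_nextList (m : ℕ) (c : List A) :
    ((nextList K)^[m] c).length = c.length - m := by
  induction m with
  | zero => rfl
  | succ m ih => rw [Function.iterate_succ_apply', length_nextList, ih]; omega

theorem map_iterate_nextList (f : A →ₐ[K] B) (m : ℕ) (c : List A) :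
    ((nextList K)^[m] c).map f = (nextList K)^[m] (c.map f) := by
  induction m with
  | zero => rfl
  | succ m ih => rw [Function.iterate_succ_apply', Function.iterate_succ_apply', map_nextList, ih]

theorem map_mkDatum (f : A →ₐ[K] B) (gs : List (List A)) (g₀ l : List A) (m κ s₁ s : ℕ) :
    (mkDatum K gs g₀ l m κ s₁ s).map (f : A →+* B) =
      mkDatum K (gs.map (List.map f)) (g₀.map f) (l.map f) m κ s₁ s := by
  have hα : (l.map f).headD 0 = f (l.headD 0) := by cases l <;> simp
  have hc : ((nextList K)^[m] (homog (l.headD 0) 1 l.tail)).map f =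
      (nextList K)^[m] (homog ((l.map f).headD 0) 1 (l.map f).tail) := by
    rw [map_iterate_nextList, hα, ← List.map_tail]
    congr 1
    exact (map_homog (f : A →+* B) _ _ _).trans (by simp)
  have hg : (gs.map (homogPoly (l.headD 0))).map (Polynomial.map (f : A →+* B)) =
      (gs.map (List.map f)).map (homogPoly ((l.map f).headD 0)) := by
    rw [List.map_map, List.map_map]
    refine List.map_congr_left fun g _ => ?_
    rw [Function.comp, Function.comp, map_homogPoly, hα]
    rfl
  simp only [Datum.map, mkDatum, Datum.mk.injEq, Polynomial.map_mul, map_sel, map_monicPoly,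
    map_homogPoly, and_true]
  have hk : (combo (algebraMap K A[X] κ) (gs.map (homogPoly (l.headD 0)))).map (f : A →+* B) =
      combo (algebraMap K B[X] κ) ((gs.map (List.map f)).map (homogPoly ((l.map f).headD 0))) := by
    have := combo_map (mapRingHom (f : A →+* B)) (algebraMap K A[X] κ)
      (gs.map (homogPoly (l.headD 0)))
    rw [coe_mapRingHom, hg] at this
    rw [this]
    simp
  refine ⟨hc, hα.symm, ?_, hg⟩
  rw [hk, map_one]
  simp only [RingHom.coe_coe]
  rw [map_nextList, hc, hα]

end

section
open Polynomial
variable {E : Type*} [Field E]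

theorem exists_drop_eq_cons (r : List E) (h : ∃ x ∈ r, x ≠ 0) : ∃ i < r.length, ∃ α rest,
    r.drop i = α :: rest ∧ α ≠ 0 ∧ ofList r.reverse = ofList (α :: rest).reverse := by
  induction r with
  | nil => simp at h
  | cons x r ih =>
    by_cases hx : x = 0
    · obtain ⟨i, hi, α, rest, h1, h2, h3⟩ := ih (by simpa [hx] using h)
      exact ⟨i + 1, by simpa using hi, α, rest, by simpa using h1, h2, by
        rw [List.reverse_cons, ofList_append, h3]; simp [ofList, hx]⟩
    · exact ⟨0, by simp, x, r, rfl, hx, rfl⟩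

theorem combo_eq_zero (κ : E) {l : List E} (h : ∀ x ∈ l, x = 0) : combo κ l = 0 := by
  induction l using List.reverseRecOn with
  | nil => rfl
  | append_singleton l a ih =>
    rw [combo, List.foldl_append, ← combo, ih fun x hx => h x (by simp [hx])]
    simp [h a (by simp)]

variable {K : Type*} [Field K] [Algebra K E]

/-- A root is a simple root of some iterated derivative. -/
theorem exists_iterate_nextList {c : List E} {ζ : E} (h : (monicPoly c).eval ζ = 0) :
    ∃ m < c.length, (monicPoly ((nextList K)^[m] c)).eval ζ = 0 ∧
      (monicPoly ((nextList K)^[m + 1] c)).eval ζ ≠ 0 := by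
  classical
  have hex : ∃ m, (monicPoly ((nextList K)^[m] c)).eval ζ ≠ 0 := ⟨c.length, by
    rw [List.length_eq_zero_iff.1 ((length_iterate_nextList K c.length c).trans (Nat.sub_self _))]
    simp [monicPoly, ofList]⟩
  have hpos : Nat.find hex ≠ 0 := fun h0 => by
    have := Nat.find_spec hex
    rw [h0] at this
    exact this h
  have hle : Nat.find hex ≤ c.length := Nat.find_min' hex <| by
    rw [List.length_eq_zero_iff.1 ((length_iterate_nextList K c.length c).trans (Nat.sub_self _))]
    simp [monicPoly, ofList]
  refine ⟨Nat.find hex - 1, by omega, not_not.1 (Nat.find_min hex (by omega)), ?_⟩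
  rw [Nat.sub_add_cancel (by omega)]
  exact Nat.find_spec hex

theorem eval_nextList_eq_zero_iff [CharZero K] {c : List E} (hc : c ≠ []) (ζ : E) :
    (monicPoly (nextList K c)).eval ζ = 0 ↔ (derivative (monicPoly c)).eval ζ = 0 := by
  rw [derivative_monicPoly K, eval_mul, eval_C, mul_eq_zero, or_iff_right]
  exact (_root_.map_ne_zero _).2 (Nat.cast_ne_zero.2 (by simpa using hc))

/-- The selected roots are simple if `φ` vanishes at all zeros of the derivative. -/
theorem selRoots_nodup [CharZero K] {c : List E} {φ : E[X]}
    (h : ∀ ζ, φ.eval ζ ≠ 0 → (monicPoly (nextList K c)).eval ζ ≠ 0) : (selRoots c φ).Nodup := by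
  classical
  refine Multiset.nodup_iff_count_le_one.2 fun ζ => le_of_not_gt fun hζ => ?_
  have hmem := mem_selRoots.1 (Multiset.count_pos.1 (zero_lt_one.trans hζ))
  refine h ζ hmem.2 ((eval_nextList_eq_zero_iff (fun hc => ?_) ζ).2 ?_)
  · rw [hc] at hmem
    simp [monicPoly, ofList] at hmem
  · refine ((one_lt_rootMultiplicity_iff_isRoot (monic_monicPoly c).ne_zero).1 ?_).2
    rw [← count_roots]
    refine hζ.trans_le (Multiset.count_le_of_le _ ?_)
    unfold selRoots
    exact Multiset.filter_le _ _

end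

section
open Polynomial
variable {K : Type*} [Field K] [CharZero K] {E : Type*} [Field E] [Algebra K E] [IsAlgClosed E]

/-- The equations of a datum determine the number of selected roots, and make the homogenized
equations vanish there. -/
theorem card_selRoots_of_eqs {τ : Datum E} (hs : τ.s ≠ 0) (hlead : (τ.poly K).coeff τ.s ≠ 0)
    (h : ∀ q ∈ τ.eqs K, q = 0) : τ.α ≠ 0 ∧ (selRoots τ.c τ.φ).card = τ.s ∧
      ∀ g ∈ τ.ghat, ∀ ζ ∈ selRoots τ.c τ.φ, g.eval ζ = 0 := by
  have hα : τ.α ≠ 0 := fun h => hlead <| by rw [Datum.poly, h, coeff_sel_zero _ _ hs]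
  refine ⟨hα, card_selRoots_eq hα (K := K) (fun h0 => hlead ?_) fun s' h1 h2 => h _ ?_,
    fun g hg ζ hζ => ?_⟩
  · rw [Datum.poly, h0, coeff_zero]
  · refine List.mem_append_left _ (List.mem_iff_getElem.2 ⟨s' - (τ.s + 1), ?_, ?_⟩)
    · simp; omega
    · simp; congr 1; omega
  · -- Otherwise the product over the roots at which `τ.φ * g` does not vanish would be nonzero, but
    -- it is one of the polynomials in `τ.eqs`.
    by_contra hgζ
    have hmem : ζ ∈ selRoots τ.c (τ.φ * g) :=
      mem_selRoots.2 ⟨(mem_selRoots.1 hζ).1, by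
        rw [eval_mul]; exact mul_ne_zero (mem_selRoots.1 hζ).2 hgζ⟩
    have hpos := Multiset.card_pos_iff_exists_mem.2 ⟨ζ, hmem⟩
    apply coeff_sel_card_ne_zero (K := K) τ.c (τ.φ * g) hα
    have hq : sel K τ.c (τ.φ * g) τ.α (selRoots τ.c (τ.φ * g)).card ∈ τ.eqs K := by
      refine List.mem_append_right _ (List.mem_flatMap.2 ⟨g, hg, List.mem_iff_getElem.2
        ⟨(selRoots τ.c (τ.φ * g)).card - 1, ?_, ?_⟩⟩)
      · have := card_selRoots_le τ.c (τ.φ * g)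
        simp; omega
      · simp only [List.getElem_tail, List.getElem_map, List.getElem_range]
        congr 1; omega
    rw [h _ hq, coeff_zero]

theorem eval_sel_card_eq_zero_iff {c : List E} {φ : E[X]} {α : E} (hα : α ≠ 0) (η : E) :
    (sel K c φ α (selRoots c φ).card).eval η = 0 ↔ α * η ∈ selRoots c φ := by
  rw [sel_card c φ hα, ← C_1, ← C_neg, ← C_pow, eval_mul, eval_C, mul_eq_zero_iff_left
    (pow_ne_zero _ (by simp)), eval_multiset_prod, Multiset.map_map, Multiset.prod_eq_zero_iff,
    Multiset.mem_map]
  constructor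
  · rintro ⟨ζ, hζ, h⟩
    have := (mem_selRoots.1 hζ).2
    simp only [Function.comp, eval_mul, eval_C, eval_sub, eval_X, mul_eq_zero, this, false_or,
      sub_eq_zero] at h
    rwa [h]
  · exact fun h => ⟨_, h, by simp⟩

theorem eval_derivative_sel_card_ne_zero {c : List E} {φ : E[X]} {α : E} (hα : α ≠ 0)
    (hS : (selRoots c φ).Nodup) {η : E} (hη : α * η ∈ selRoots c φ) :
    (derivative (sel K c φ α (selRoots c φ).card)).eval η ≠ 0 := by
  rw [sel_card c φ hα, ← C_1, ← C_neg, ← C_pow, derivative_C_mul, eval_mul, eval_C]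
  refine mul_ne_zero (pow_ne_zero _ (by simp)) ?_
  obtain ⟨S, hS'⟩ := Multiset.exists_cons_of_mem hη
  have hφ : ∀ ζ ∈ selRoots c φ, φ.eval ζ ≠ 0 := fun ζ hζ => (mem_selRoots.1 hζ).2
  rw [hS'] at hS hφ ⊢
  rw [Multiset.map_cons, Multiset.prod_cons, derivative_mul, eval_add, eval_mul, eval_mul]
  have h1 : (C (φ.eval (α * η)) * (C α * X - C (α * η))).eval η = 0 := by simp
  have h2 : (derivative (C (φ.eval (α * η)) * (C α * X - C (α * η)))).eval η =
      φ.eval (α * η) * α := by simp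
  rw [h1, h2, zero_mul, add_zero]
  refine mul_ne_zero (mul_ne_zero (hφ _ (Multiset.mem_cons_self _ _)) hα) ?_
  rw [eval_multiset_prod, Multiset.map_map]
  refine Multiset.prod_ne_zero fun h => ?_
  obtain ⟨ζ, hζ, h⟩ := Multiset.mem_map.1 h
  have := hφ ζ (Multiset.mem_cons_of_mem hζ)
  simp only [Function.comp, eval_mul, eval_C, eval_sub, eval_X, mul_eq_zero, this, false_or,
      sub_eq_zero] at h
  exact (Multiset.nodup_cons.1 hS).1 (h ▸ hζ)

/-- The conclusions that can be drawn at a point where the coefficient of degree `τ.s` does not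
vanish and all the polynomials in `τ.eqs` do. -/
theorem sound_mkDatum {gs : List (List E)} {g₀ l : List E} {m κ s₁ s : ℕ} {τ : Datum E}
    (hτ : τ = mkDatum K gs g₀ l m κ s₁ s) (hs : s ≠ 0)
    (hlead : (τ.poly K).coeff s ≠ 0) (h : ∀ q ∈ τ.eqs K, q = 0) :
    (τ.poly K).natDegree ≤ s ∧ ∀ η, (τ.poly K).eval η = 0 →
      (∀ g ∈ gs, (ofList g).eval η = 0) ∧ (ofList g₀).eval η ≠ 0 ∧
        (derivative (τ.poly K)).eval η ≠ 0 := by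
  have hss : τ.s = s := by rw [hτ]; rfl
  obtain ⟨hα, hcard, hg⟩ := card_selRoots_of_eqs (K := K) (τ := τ) (by rwa [hss]) (by rwa [hss]) h
  have e : τ.poly K = sel K τ.c τ.φ τ.α (selRoots τ.c τ.φ).card := by rw [hcard]; rfl
  rw [e]
  refine ⟨hss ▸ hcard ▸ natDegree_sel_card_le _ _ hα, fun η hη => ?_⟩
  rw [eval_sel_card_eq_zero_iff hα] at hη
  have hφ := (mem_selRoots.1 hη).2
  refine ⟨fun g hgs => ?_, fun h0 => hφ ?_,
    eval_derivative_sel_card_ne_zero hα (selRoots_nodup (K := K) fun ζ hζ h0 => hζ ?_) hη⟩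
  · have h1 := hg (homogPoly τ.α g) (by rw [hτ]; exact List.mem_map.2 ⟨g, hgs, rfl⟩) _ hη
    have h2 := eval_homogPoly τ.α η g
    rw [h1, mul_zero] at h2
    exact (mul_eq_zero.1 h2.symm).resolve_left (pow_ne_zero _ hα)
  · have h2 := eval_homogPoly τ.α η g₀
    rw [h0, mul_zero] at h2
    have h3 := (mul_eq_zero.1 h2).resolve_left hα
    rw [hτ] at h3 ⊢
    simp only [mkDatum, eval_mul] at h3 ⊢
    rw [h3, mul_zero, mul_zero]
  · rw [hτ] at h0 ⊢
    simp only [mkDatum, eval_mul] at h0 ⊢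
    rw [h0, zero_mul, mul_zero]

/-- If some coefficient of an equation does not vanish, then every solution is found. -/
theorem complete_mkDatum {gs : List (List E)} {g₀ g : List E} {η : E} {b : ℕ} (hg : g ∈ gs)
    (hne : ∃ x ∈ g, x ≠ 0) (h : ∀ g ∈ gs, (ofList g).eval η = 0) (h₀ : (ofList g₀).eval η ≠ 0)
    (hb : g.length * gs.length < b) :
    ∃ i < g.length, ∃ m < g.length - i - 1, ∃ κ < b, ∃ s₁ ≤ g.length - i - 1 - m,
      ∃ s, 1 ≤ s ∧ s ≤ g.length - i - 1 - m ∧ ∃ τ, τ = mkDatum K gs g₀ (g.reverse.drop i) m κ s₁ s ∧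
        (τ.poly K).coeff s ≠ 0 ∧ (∀ q ∈ τ.eqs K, q = 0) ∧ (τ.poly K).eval η = 0 := by
  have : CharZero E := charZero_of_injective_algebraMap (algebraMap K E).injective
  obtain ⟨i, hi, α, rest, hdrop, hα, hr⟩ := exists_drop_eq_cons g.reverse (by simpa using hne)
  rw [List.reverse_reverse] at hr
  have hlen : g.length - i - 1 = rest.length := by
    have := congrArg List.length hdrop
    simp at this; omega
  obtain ⟨m, hm, hm0, hm1⟩ := exists_iterate_nextList (K := K) (c := homog α 1 rest)
      (ζ := α * η) <| by
    have := eval_monicPoly_homog α η rest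
    rw [← hr, h g hg, mul_zero] at this
    exact (mul_eq_zero.1 this).resolve_left hα
  rw [length_homog] at hm
  rw [Function.iterate_succ_apply'] at hm1
  obtain ⟨c, hc⟩ : ∃ c, c = (nextList K)^[m] (homog α 1 rest) := ⟨_, rfl⟩
  have hclen : c.length = rest.length - m := by
    rw [hc, length_iterate_nextList, length_homog]
  rw [← hc] at hm0 hm1
  obtain ⟨κ, hκ, hκ'⟩ := exists_combo_ne_zero (monicPoly c).roots (gs.map (homogPoly α))
      (b := b) <| by
    rw [card_roots_monicPoly, List.length_map]
    refine lt_of_le_of_lt (Nat.mul_le_mul_right _ ?_) hb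
    omega
  obtain ⟨Bp, hB⟩ : ∃ Bp, Bp = combo (algebraMap K E[X] κ) (gs.map (homogPoly α)) := ⟨_, rfl⟩
  have hBe : ∀ ζ, Bp.eval ζ = combo (κ : E) ((gs.map (homogPoly α)).map fun g => g.eval ζ) :=
    fun ζ => by
      have := combo_map (evalRingHom ζ) (algebraMap K E[X] κ) (gs.map (homogPoly α))
      rw [hB]
      simpa using this
  -- All guesses are made according to the actual numbers of roots.
  obtain ⟨s₁, hs₁⟩ : ∃ s₁, s₁ = (selRoots c Bp).card := ⟨_, rfl⟩
  obtain ⟨φ, hφ⟩ : ∃ φ, φ = sel K c Bp 1 s₁ * (monicPoly (nextList K c) * homogPoly α g₀) :=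
    ⟨_, rfl⟩
  have hw : ∀ ζ, (sel K c Bp 1 s₁).eval ζ = 0 ↔ ζ ∈ selRoots c Bp := fun ζ => by
    rw [hs₁, eval_sel_card_eq_zero_iff one_ne_zero, one_mul]
  have hmem : α * η ∈ selRoots c φ := by
    refine mem_selRoots.2 ⟨hm0, ?_⟩
    rw [hφ, eval_mul, eval_mul]
    refine mul_ne_zero (fun h1 => ?_) (mul_ne_zero hm1 fun h1 => ?_)
    · refine (mem_selRoots.1 ((hw _).1 h1)).2 ?_
      rw [hBe]
      refine combo_eq_zero _ fun x hx => ?_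
      simp only [List.map_map, List.mem_map] at hx
      obtain ⟨g', hg', rfl⟩ := hx
      have := eval_homogPoly α η g'
      rw [h g' hg', mul_zero] at this
      exact (mul_eq_zero.1 this).resolve_left hα
    · have := eval_homogPoly α η g₀
      rw [h1, mul_zero] at this
      exact mul_ne_zero (pow_ne_zero _ hα) h₀ this.symm
  refine ⟨i, by simpa using hi, m, by omega, κ, hκ, s₁, ?_, (selRoots c φ).card,
    Multiset.card_pos_iff_exists_mem.2 ⟨_, hmem⟩, ?_,
    ⟨c, α, φ, gs.map (homogPoly α), (selRoots c φ).card⟩, ?_,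
    coeff_sel_card_ne_zero c φ hα, fun q hq => ?_, (eval_sel_card_eq_zero_iff hα η).2 hmem⟩
  · rw [hs₁, hlen, ← hclen]
    exact card_selRoots_le _ _
  · rw [hlen, ← hclen]
    exact card_selRoots_le _ _
  · rw [mkDatum, hdrop]
    simp only [List.headD_cons, List.tail_cons, ← hc, ← hB, ← hφ]
  · simp only [Datum.eqs, List.mem_append, List.mem_flatMap,
      List.mem_iff_getElem (l := List.drop _ _), List.mem_iff_getElem (l := List.tail _)] at hq
    rcases hq with ⟨j, hj, rfl⟩ | ⟨g', hg', j, hj, rfl⟩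
    · simp only [List.getElem_drop, List.getElem_map, List.getElem_range]
      exact sel_eq_zero_of_card_lt c φ hα (by omega)
    · simp only [List.getElem_tail, List.getElem_map, List.getElem_range]
      refine sel_eq_zero_of_card_lt c _ hα ?_
      rw [Multiset.card_eq_zero.2 (Multiset.eq_zero_of_forall_notMem fun ζ hζ => ?_)]
      · omega
      have h1 := mem_selRoots.1 hζ
      rw [eval_mul] at h1
      have h2 := hκ' ζ (by rw [mem_roots (monic_monicPoly c).ne_zero]; exact h1.1) g' hg'
        (right_ne_zero_of_mul h1.2)
      rw [← hBe] at h2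
      refine left_ne_zero_of_mul h1.2 ?_
      rw [hφ, eval_mul, (hw ζ).2 (mem_selRoots.2 ⟨h1.1, h2⟩), zero_mul]

end

/-! ### Components -/

section
open Polynomial
variable {K : Type*} [Field K] {A : Type*} [CommRing A] [Algebra K A]
  {E : Type*} [Field E] [Algebra K E]

/-- `x` is the component that is built from `τ`: its polynomial and the list of its inequation and
its equations. The polynomial is truncated at degree `τ.s`, so that its initial is the inequation;
the equations may be padded by zeros. -/
def IsCompOf (K : Type*) [Field K] {A : Type*} [CommRing A] [Algebra K A] (τ : Datum A)
    (x : A[X] × List A) : Prop :=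
  (∀ i, x.1.coeff i = if i ≤ τ.s then (τ.poly K).coeff i else 0) ∧
  ∃ es, x.2 = (τ.poly K).coeff τ.s :: es ∧ (τ.poly K).coeff τ.s ≠ 0 ∧
    (∀ e ∈ es, e = 0 ∨ ∃ q ∈ τ.eqs K, ∃ i, e = q.coeff i) ∧
    ∀ q ∈ τ.eqs K, ∀ i, q.coeff i = 0 ∨ q.coeff i ∈ es

/-- The point given by `f` and `η` lies on the component `x`. -/
def OnComp (x : A[X] × List A) (f : A →ₐ[K] E) (η : E) : Prop :=
  (x.1.map (f : A →+* E)).eval η = 0 ∧ f (x.2.headD 0) ≠ 0 ∧ ∀ e ∈ x.2.tail, f e = 0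

theorem IsCompOf.natDegree {τ : Datum A} {x : A[X] × List A} (h : IsCompOf K τ x) :
    x.1.natDegree = τ.s := by
  obtain ⟨h1, es, -, h2, -⟩ := h
  refine natDegree_eq_of_le_of_coeff_ne_zero (natDegree_le_iff_coeff_eq_zero.2 fun i hi => ?_) ?_
  · rw [h1, if_neg (by omega)]
  · rwa [h1, if_pos le_rfl]

theorem IsCompOf.leadingCoeff {τ : Datum A} {x : A[X] × List A} (h : IsCompOf K τ x) :
    x.1.leadingCoeff = x.2.headD 0 := by
  rw [Polynomial.leadingCoeff, h.natDegree]
  obtain ⟨h1, es, h2, -⟩ := h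
  rw [h1, if_pos le_rfl, h2]
  rfl

theorem IsCompOf.map_eq {τ : Datum A} {x : A[X] × List A} (h : IsCompOf K τ x) (f : A →ₐ[K] E)
    (hd : ((τ.map (f : A →+* E)).poly K).natDegree ≤ τ.s) :
    x.1.map (f : A →+* E) = (τ.map (f : A →+* E)).poly K := by
  ext i
  rw [coeff_map, h.1, ← Datum.map_poly]
  split_ifs with hi
  · rw [coeff_map]
  · rw [map_zero, Datum.map_poly, coeff_eq_zero_of_natDegree_lt (by omega)]

variable [CharZero K] [IsAlgClosed E]

/-- At the points of a component, the given equations and the given inequation hold, and the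
separant does not vanish. -/
theorem IsCompOf.sound {gs : List (List A)} {g₀ l : List A} {m κ s₁ s : ℕ} {x : A[X] × List A}
    (hs : s ≠ 0) (h : IsCompOf K (mkDatum K gs g₀ l m κ s₁ s) x) {f : A →ₐ[K] E} {η : E}
    (hx : OnComp x f η) :
    (∀ g ∈ gs, ((ofList g).map (f : A →+* E)).eval η = 0) ∧
      ((ofList g₀).map (f : A →+* E)).eval η ≠ 0 ∧
      ((derivative x.1).map (f : A →+* E)).eval η ≠ 0 := by
  obtain ⟨τ, hτ⟩ : ∃ τ, τ = mkDatum K gs g₀ l m κ s₁ s := ⟨_, rfl⟩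
  have hss : τ.s = s := by rw [hτ]; rfl
  rw [← hτ] at h
  obtain ⟨-, es, h2, h3, h4, h5⟩ := id h
  have hmap := map_mkDatum K f gs g₀ l m κ s₁ s
  rw [← hτ] at hmap
  have hpoly := Datum.map_poly K f τ
  obtain ⟨hd, hη⟩ := sound_mkDatum (K := K) hmap hs (by
    rw [← hpoly, coeff_map, ← hss]
    have := hx.2.1
    rwa [h2] at this) (fun q hq => by
    rw [← Datum.map_eqs, List.mem_map] at hq
    obtain ⟨q, hq, rfl⟩ := hq
    ext i
    rw [coeff_map, coeff_zero]
    rcases h5 q hq i with h0 | h0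
    · rw [h0, map_zero]
    · exact hx.2.2 _ (by rwa [h2]))
  have hm := h.map_eq f (by rwa [hss])
  have := hη η (by rw [← hm]; exact hx.1)
  rw [← hm] at this
  refine ⟨fun g hg => ?_, ?_, ?_⟩
  · rw [← ofList_map]
    exact this.1 _ (List.mem_map.2 ⟨g, hg, rfl⟩)
  · rw [← ofList_map]
    exact this.2.1
  · rw [← derivative_map]
    exact this.2.2

/-- A solution at which some coefficient of an equation does not vanish lies on the component of
some datum. -/
theorem exists_mkDatum {gs : List (List A)} {g₀ g : List A} {f : A →ₐ[K] E} {η : E} {b : ℕ}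
    (hg : g ∈ gs) (hne : ∃ x ∈ g, f x ≠ 0)
    (h : ∀ g ∈ gs, ((ofList g).map (f : A →+* E)).eval η = 0)
    (h₀ : ((ofList g₀).map (f : A →+* E)).eval η ≠ 0) (hb : g.length * gs.length < b) :
    ∃ i < g.length, ∃ m < g.length - i - 1, ∃ κ < b, ∃ s₁ ≤ g.length - i - 1 - m,
      ∃ s, 1 ≤ s ∧ s ≤ g.length - i - 1 - m ∧ ∃ τ, τ = mkDatum K gs g₀ (g.reverse.drop i) m κ s₁ s ∧
        (τ.poly K).coeff s ≠ 0 ∧ ∀ x, IsCompOf K τ x → OnComp x f η := by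
  obtain ⟨i, hi, m, hm, κ, hκ, s₁, hs₁, s, hs, hs', τ, hτ, h1, h2, h3⟩ := complete_mkDatum (K := K)
    (gs := gs.map (List.map f)) (g₀ := g₀.map f) (g := g.map f) (η := η) (b := b)
    (List.mem_map.2 ⟨g, hg, rfl⟩) (by simpa using hne) (fun g' hg' => by
      obtain ⟨u, hu, rfl⟩ := List.mem_map.1 hg'
      have := h u hu
      rwa [← ofList_map] at this)
    (by rwa [← ofList_map] at h₀) (by simpa using hb)
  rw [List.length_map] at hi hm hs₁ hs'
  rw [← List.map_reverse, ← List.map_drop, ← map_mkDatum] at hτ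
  rw [hτ] at h1 h2 h3
  refine ⟨i, hi, m, hm, κ, hκ, s₁, hs₁, s, hs, hs', _, rfl, ?_, ?_⟩
  · rw [← Datum.map_poly, coeff_map] at h1
    exact fun h => h1 (by rw [h, map_zero])
  · intro x hx
    obtain ⟨-, es, h4, -, h5, -⟩ := id hx
    obtain ⟨hd, -⟩ := sound_mkDatum (K := K) (map_mkDatum K f gs g₀ (g.reverse.drop i) m κ s₁ s)
      (by omega) h1 h2
    refine ⟨?_, ?_, ?_⟩
    · rw [hx.map_eq f hd]
      exact h3
    · rw [h4, List.headD_cons]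
      rw [← Datum.map_poly, coeff_map] at h1
      exact h1
    · intro e he
      rw [h4, List.tail_cons] at he
      rcases h5 e he with rfl | ⟨q, hq, i, rfl⟩
      · exact map_zero f
      · have := h2 (q.map (f : A →+* E)) (by
          rw [← Datum.map_eqs]; exact List.mem_map.2 ⟨q, hq, rfl⟩)
        have := congrArg (fun p => p.coeff i) this
        simpa using this

end

/-! ### Programs for the candidates -/

section
variable {K : Type u} [Field K] {N n M Dm : ℕ}

/-- `(α, l)` is mapped to `homog α 1 l`. -/
def homogP : Prog :=
  (tl ⊠ (hd ⊠ ((.prim .one ⊠ nilP) ⊠ nilP))) ⨾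
  each (arg₁ ⊠ (((arg₂ ⊠ arg₁) ⨾ mulR) ⊠ (((hd ⊠ arg₂) ⨾ mulR) ⊠ rest₃))) ⨾ rest₂ ⨾ revP

theorem homog_append (A : Type*) [CommRing A] (α pw x : A) (l : List A) :
    homog α pw (l ++ [x]) = homog α pw l ++ [x * (pw * α ^ l.length)] := by
  induction l generalizing pw with
  | nil => simp [homog]
  | cons y l ih => simp [homog, ih]; ring

theorem wp_homogP (hN : Big n M Dm N) {a : MvPolynomial (Fin n) K}
    {l : List (MvPolynomial (Fin n) K)} {x y : Val K} {D : ℕ} (hD : (l.length + 1) * D ≤ Dm)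
    (hl : l.length ≤ N) (hx : RepR M D a x) (hy : ListRep (RepR M D) l y) :
    wp N homogP (.cons x y) (ListRep (RepR M ((l.length + 1) * D)) (homog a 1 l)) := by
  simp only [homogP, wp, app_fst, app_snd, app_nil, app_one]
  refine wp_each (fun l' s => ∃ m p z, l = m ++ l' ∧ s = .cons x (.cons p z) ∧
    RepR M (m.length * D) (a ^ m.length) p ∧
    ListRep (RepR M ((l.length + 1) * D)) (homog a 1 m).reverse z) hy hl
    ⟨[], _, .nil, rfl, rfl, ?_, rfl⟩ ?_ ?_
  · simpa using repR_const (n := n) (M := M) (1 : K) 0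
  · rintro b l' v s - hv ⟨m, p, z, hm, rfl, hp, hz⟩
    simp only [wp, app_fst, app_snd]
    have hlen := congrArg List.length hm
    simp only [List.length_append, List.length_cons] at hlen
    have e : m.length * D + D ≤ l.length * D := by
      rw [← Nat.succ_mul]; gcongr; omega
    have e2 : l.length * D + D = (l.length + 1) * D := by ring
    refine wp_mono ((implR hN.1).mul (by omega) hp hx) fun p' hp' => ?_
    refine wp_mono ((implR hN.1).mul (by omega) hv hp) fun q hq => ?_
    refine ⟨m ++ [b], p', _, by simpa using hm, rfl, ?_, ?_⟩
    · rw [List.length_append, List.length_singleton, Nat.succ_mul, pow_succ]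
      exact hp'
    · rw [homog_append, List.reverse_append, one_mul]
      exact ⟨q, z, rfl, (implR hN.1).mono (by omega) hq, hz⟩
  · rintro s ⟨m, p, z, hm, rfl, hp, hz⟩
    obtain rfl : l = m := by simpa using hm
    simp only [app_snd]
    have := wp_revP (N := N) hz (by simpa using hl)
    rwa [List.reverse_reverse] at this

/-- `(α, l)` is mapped to `homogPoly α l`. -/
def homogPolyP : Prog := (hd ⊠ (tl ⨾ revP)) ⨾ homogP ⨾ revP

theorem wp_homogPolyP (hN : Big n M Dm N) {a : MvPolynomial (Fin n) K}
    {l : List (MvPolynomial (Fin n) K)} {x y : Val K} {D : ℕ} (hD : (l.length + 1) * D ≤ Dm)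
    (hl : l.length ≤ N) (hD1 : 1 ≤ D) (hx : RepR M D a x) (hy : ListRep (RepR M D) l y) :
    wp N homogPolyP (.cons x y) (RepQ M ((l.length + 1) * D) (homogPoly a l)) := by
  simp only [homogPolyP, wp, app_fst, app_snd]
  refine wp_mono (wp_revP hy hl) fun z hz => ?_
  refine wp_mono (wp_homogP hN (by simpa using hD) (by simpa using hl) hx hz) fun z hz => ?_
  rw [List.length_reverse] at hz
  refine wp_mono (wp_revP hz (by simpa using hl)) fun z hz => ⟨_, rfl, ?_, hz⟩
  simp only [List.length_reverse, length_homog, mul_one]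
  nlinarith

/-- The program computing `nextList`. -/
def nextP : Prog :=
  (.skip ⊠ (lenP ⊠ ((lenP ⨾ .prim .inv) ⊠ nilP))) ⨾
  forT ((((arg₁ ⊠ .prim .one) ⨾ .prim .sub) ⊠ (hd ⊠ rest₂)) ⨾
    .branch (arg₁ ⨾ tl)
      (hd ⊠ (arg₂ ⊠ (((((((hd ⊠ arg₂) ⨾ .prim .mul) ⊠ nilP) ⊠ (arg₁ ⨾ hd)) ⨾ mulR) ⊠ rest₃))))
      (hd ⊠ rest₂)) ⨾ rest₂ ⨾ revP

theorem wp_nextP (hN : Big n M Dm N) {c : List (MvPolynomial (Fin n) K)} {x : Val K} {D : ℕ}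
    (hD : D ≤ Dm) (hc : c.length ≤ N) (hx : ListRep (RepR M D) c x) :
    wp N nextP x (ListRep (RepR M D) (nextList K c)) := by
  simp only [nextP, wp, app_nil]
  refine wp_mono (wp_lenP hx.counter hc) ?_
  rintro _ rfl
  refine wp_mono (wp_lenP hx.counter hc) ?_
  rintro _ rfl
  simp only [app_inv]
  refine wp_forT (fun (l : List (MvPolynomial (Fin n) K)) s =>
    ∃ (m : List (MvPolynomial (Fin n) K)) (z : Val K), s = .cons (.fld (l.length : K))
    (.cons (.fld (c.length : K)⁻¹) z) ∧ nextList K c = m ++ derivList K (c.length : K)⁻¹ l ∧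
    ListRep (RepR M D) m.reverse z) hx hc ⟨[], .nil, rfl, rfl, rfl⟩ ?_ ?_
  · rintro a l v w s - hv hw ⟨m, z, rfl, hm, hz⟩
    simp only [wp, app_fst, app_snd, app_one, app_sub]
    have e : ((a :: l).length : K) - 1 = (l.length : K) := by simp
    rw [e]
    constructor
    · intro hne
      cases l with
      | nil => exact absurd hw hne
      | cons b l =>
        simp only [app_mul, app_nil]
        refine wp_mono ((implR hN.1).mul (D := 0) (D' := D) (by omega) (repR_const (n := n) (M := M)
          (((b :: l).length : K) * (c.length : K)⁻¹) 0) hv) fun u hu => ?_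
        rw [zero_add] at hu
        refine ⟨m ++ [algebraMap K _ (((b :: l).length : K) * (c.length : K)⁻¹) * a], _, rfl,
          ?_, ?_⟩
        · rw [hm, derivList, List.append_assoc, List.singleton_append, List.length_cons]
        · rw [List.reverse_append]
          exact ⟨u, z, rfl, hu, hz⟩
    · intro hnil
      subst hnil
      obtain rfl := hw.nil_iff.1 rfl
      exact ⟨m, z, by simp, by rw [hm]; rfl, hz⟩
  · rintro s ⟨m, z, rfl, hm, hz⟩
    simp only [app_snd]
    rw [hm, derivList, List.append_nil]
    have hlen := congrArg List.length hm
    simp only [length_nextList, derivList, List.append_nil] at hlen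
    have := wp_revP (N := N) hz (by simp; omega)
    rwa [List.reverse_reverse] at this

/-- The list of all `(nextList K)^[m] c`, for `m < c.length`, in descending order. -/
def chainP : Prog :=
  (.skip ⊠ (.skip ⊠ nilP)) ⨾ each ((arg₁ ⨾ nextP) ⊠ (arg₁ ⊠ rest₂)) ⨾ tl

theorem wp_chainP (hN : Big n M Dm N) {c : List (MvPolynomial (Fin n) K)} {x : Val K} {D : ℕ}
    (hD : D ≤ Dm) (hc : c.length ≤ N) (hx : ListRep (RepR M D) c x) :
    wp N chainP x (ListRep (fun m => ListRep (RepR M D) ((nextList K)^[m] c))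
      (List.range c.length).reverse) := by
  simp only [chainP, wp, app_nil]
  refine wp_each_counter (fun i s => ∃ m y z, m + i = c.length ∧ s = .cons y z ∧
    ListRep (RepR M D) ((nextList K)^[m] c) y ∧
    ListRep (fun m => ListRep (RepR M D) ((nextList K)^[m] c)) (List.range m).reverse z)
    hx.counter hc ⟨0, x, .nil, by omega, rfl, hx, rfl⟩ ?_ ?_
  · rintro i _ s - ⟨m, y, z, hm, rfl, hy, hz⟩
    simp only [wp, app_fst, app_snd]
    refine wp_mono (wp_nextP hN hD (by rw [length_iterate_nextList]; omega) hy) fun u hu => ?_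
    refine ⟨m + 1, u, _, by omega, rfl, ?_, ?_⟩
    · rw [Function.iterate_succ_apply']; exact hu
    · rw [List.range_succ, List.reverse_append]
      exact ⟨y, z, rfl, hy, hz⟩
  · rintro s ⟨m, y, z, hm, rfl, hy, hz⟩
    obtain rfl : m = c.length := by omega
    exact hz

/-- The list of the first `b` natural numbers as elements of `K`, in descending order. -/
def natsP : Prog :=
  (.skip ⊠ (.prim .zero ⊠ nilP)) ⨾
  each (((arg₁ ⊠ .prim .one) ⨾ .prim .add) ⊠ (arg₁ ⊠ rest₂)) ⨾ tl

theorem wp_natsP {b : ℕ} {x : Val K} (hb : b ≤ N) (hx : Counter b x) :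
    wp N natsP x
      (ListRep (fun (i : ℕ) (w : Val K) => w = .fld (i : K)) (List.range b).reverse) := by
  simp only [natsP, wp, app_nil, app_zero]
  refine wp_each_counter (fun i s => ∃ m z, m + i = b ∧ s = .cons (.fld (m : K)) z ∧
    ListRep (fun (i : ℕ) (w : Val K) => w = .fld (i : K)) (List.range m).reverse z)
    hx hb ⟨0, .nil, by omega, by simp, rfl⟩ ?_ ?_
  · rintro i _ s - ⟨m, z, hm, rfl, hz⟩
    simp only [wp, app_fst, app_snd, app_one, app_add]
    refine ⟨m + 1, .cons (.fld (m : K)) z, by omega, by simp, ?_⟩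
    rw [List.range_succ, List.reverse_append]
    exact ⟨_, z, rfl, rfl, hz⟩
  · rintro s ⟨m, z, hm, rfl, hz⟩
    obtain rfl : m = b := by omega
    exact hz

/-- `(κ, gs)` is mapped to `combo κ gs`. -/
def comboP : Prog :=
  (tl ⊠ ((hd ⨾ constQ) ⊠ nilP)) ⨾
  each (arg₁ ⊠ ((((arg₁ ⊠ rest₂) ⨾ mulQ) ⊠ hd) ⨾ addQ)) ⨾ tl

theorem wp_comboP (hN : Big n M Dm N) {κ : K} {gs : List (PolyY K n)} {y : Val K} {D : ℕ}
    (hD : D ≤ Dm) (hl : gs.length ≤ N) (hy : ListRep (RepQ M D) gs y) :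
    wp N comboP (.cons (.fld κ) y) (RepQ M D (combo (algebraMap K _ κ) gs)) := by
  simp only [comboP, wp, app_fst, app_snd, app_nil]
  refine wp_mono (wp_constQ n M κ 0) fun u hu => ?_
  refine wp_each (fun l s => ∃ m z, gs = m ++ l ∧ s = .cons u z ∧
    RepQ M D (combo (algebraMap K _ κ) m) z) hy hl ⟨[], .nil, rfl, rfl, repQ_zero _⟩ ?_ ?_
  · rintro g l v s - hv ⟨m, z, hm, rfl, hz⟩
    simp only [wp, app_fst, app_snd]
    refine wp_mono ((implQ hN).mul (by omega) hu hz) fun t ht => ?_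
    rw [zero_add] at ht
    refine wp_mono ((implQ hN).add hD ht hv) fun t ht => ⟨m ++ [g], t, by simpa using hm, rfl, ?_⟩
    rw [combo, List.foldl_append]
    exact ht
  · rintro s ⟨m, z, hm, rfl, hz⟩
    obtain rfl : gs = m := by simpa using hm
    exact hz

/-- The program computing `monicPoly`. -/
def monicP : Prog := ((.prim .one ⊠ nilP) ⊠ .skip) ⨾ revP

theorem wp_monicP {c : List (MvPolynomial (Fin n) K)} {x : Val K} {D : ℕ}
    (hD : c.length ≤ D) (hc : c.length + 1 ≤ N) (hx : ListRep (RepR M D) c x) :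
    wp N monicP x (RepQ M D (monicPoly c)) := by
  simp only [monicP, wp, app_nil, app_one]
  have h1 := repR_const (n := n) (M := M) (1 : K) D
  rw [map_one] at h1
  have h : ListRep (RepR M D) (1 :: c) (.cons (.cons (.fld 1) .nil) x) := ⟨_, x, rfl, h1, hx⟩
  refine wp_mono (wp_revP h (by simpa using hc)) fun y hy => ⟨_, ?_, ?_, hy⟩
  · rw [List.reverse_cons, ofList_append, monicPoly, add_comm]
    simp [ofList]
  · simpa using hD

theorem ofList_linear (A : Type*) [CommRing A] [Algebra K A] (a : A) :
    ofList [Polynomial.C a * Polynomial.X, algebraMap K (Polynomial A) (0 - 1)] =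
      Polynomial.C (Polynomial.C a * Polynomial.X) - Polynomial.X := by
  rw [zero_sub, map_neg, map_one, ofList, ofList, ofList, mul_zero, add_zero, map_neg, map_one]
  ring

theorem ofList_zero_cons (A : Type*) [CommRing A] (a : A) :
    ofList [0, a] = Polynomial.C a * Polynomial.X := by
  rw [ofList, ofList, ofList, mul_zero, add_zero, map_zero, zero_add, mul_comm]

theorem repR_zero (D : ℕ) : RepR (K := K) (n := n) M D 0 .nil :=
  ⟨by rw [map_zero]; exact RepPoly.nil, by simp⟩

/-- The list of coefficients `l` is mapped to the list of constant polynomials. -/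
def liftP : Prog := (nilP ⊠ .skip) ⨾ mapP (tl ⊠ nilP)

theorem wp_liftP {l : List (MvPolynomial (Fin n) K)} {w : Val K} {D : ℕ} (hN : l.length ≤ N)
    (hw : ListRep (RepR M D) l w) :
    wp N liftP w (ListRep (RepQ M D) (l.map Polynomial.C)) := by
  simp only [liftP, wp, app_nil]
  refine wp_mapP hw hN fun q w _ hw => ?_
  simp only [wp, app_snd, app_nil]
  exact RepPoly.singleton (β := 1) hw

/-- `α` is mapped to the polynomial `α * X - Z` in `Z`. -/
def linP : Prog :=
  (nilP ⊠ (.skip ⊠ nilP)) ⊠ ((((.prim .zero ⊠ .prim .one) ⨾ .prim .sub) ⨾ constQ) ⊠ nilP)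

theorem wp_linP {a : MvPolynomial (Fin n) K} {z : Val K} {D : ℕ} (hD : 1 ≤ D)
    (hz : RepR M D a z) : wp N linP z
      (RepZ M D (Polynomial.C (Polynomial.C a * Polynomial.X) - Polynomial.X)) := by
  simp only [linP, wp, app_nil, app_zero, app_one, app_sub]
  refine wp_mono (wp_constQ n M (0 - 1 : K) D) fun u hu => ?_
  exact ⟨_, ofList_linear _ a, by simp; omega, _, _, rfl, ⟨_, ofList_zero_cons _ a,
      by simp; omega, _, _, rfl, repR_zero D, _, _, rfl, hz, rfl⟩, _, _, rfl, hu, rfl⟩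

/-- `(c, (φ, α))` is mapped to the list of the `sel K c φ α s`, for `s ≤ c.length`. -/
def selP : Prog :=
  ((hd ⨾ liftP) ⊠ (((arg₁ ⨾ liftP) ⊠ (rest₂ ⨾ linP)) ⨾ mulZ)) ⨾ rootSymmP

theorem wp_selP (hN : Big n M Dm N) {c : List (MvPolynomial (Fin n) K)} {φ : PolyY K n}
    {a : MvPolynomial (Fin n) K} {x y z : Val K} {D Dφ : ℕ} (hD1 : 1 ≤ D)
    (hD : symmSize c.length D (Dφ + D) ≤ Dm) (hDφ : Dφ + D ≤ Dm) (hc : c.length + 1 ≤ N)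
    (hx : ListRep (RepR M D) c x) (hy : RepQ M Dφ φ y) (hz : RepR M D a z) :
    wp N selP (.cons x (.cons y z)) (ListRep (RepQ M (symmSize c.length D (Dφ + D)))
      ((List.range (c.length + 1)).map (sel K c φ a))) := by
  have h2 := hN.2
  obtain ⟨l, rfl, hl, hy⟩ := hy
  simp only [selP, wp, app_fst, app_snd]
  refine wp_mono (wp_liftP (by omega) hx) fun x' hx' => ?_
  refine wp_mono (wp_liftP (by omega) hy) fun y' hy' => ?_
  refine wp_mono (wp_linP hD1 hz) fun u hu => ?_
  have hφ : RepZ M Dφ ((ofList l).map Polynomial.C) y' :=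
    ⟨_, ofList_map _ _, by simpa using hl, hy'⟩
  refine wp_mono ((implZ hN).mul hDφ hφ hu) fun w hw => ?_
  have := wp_rootSymmP hN (by simpa using hD) (by simpa using hc) hx' hw
  rw [List.length_map] at this
  exact this

end

/-! ### Programs for the components -/

section
variable {K : Type u} [Field K] {N n M Dm : ℕ}

/-- The list of the pairs of `i + 2` in unary and the list without its first `i` entries, for all
smaller `i`, in descending order. -/
def tailsP : Prog :=
  (.skip ⊠ ((nilP ⊠ (nilP ⊠ nilP)) ⊠ nilP)) ⨾
  forT ((nilP ⊠ arg₁) ⊠ ((arg₁ ⊠ hd) ⊠ rest₂)) ⨾ tl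

/-- The tree `w` represents `i + 2` and the list `l` without its first `i` entries. -/
def RepTail {α : Type*} (ρ : α → Val K → Prop) (l : List α) (i : ℕ) (w : Val K) : Prop :=
  ∃ a b, w = .cons a b ∧ Counter (i + 2) a ∧ ListRep ρ (l.drop i) b

theorem wp_tailsP {α : Type*} {ρ : α → Val K → Prop} {l : List α} {w : Val K} (hl : l.length ≤ N)
    (hw : ListRep ρ l w) :
    wp N tailsP w (ListRep (RepTail ρ l) (List.range l.length).reverse) := by
  simp only [tailsP, wp, app_nil]
  refine wp_forT (fun l' s => ∃ i c z, l' = l.drop i ∧ i + l'.length = l.length ∧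
    s = .cons c z ∧ Counter (i + 2) c ∧ ListRep (RepTail ρ l) (List.range i).reverse z) hw hl
    ⟨0, _, .nil, rfl, by omega, rfl, (counter_zero.cons).cons, rfl⟩ ?_ ?_
  · rintro a l' x y s - hx hy ⟨i, c, z, hl', hi, rfl, hc, hz⟩
    simp only [wp, app_fst, app_snd, app_nil]
    refine ⟨i + 1, _, _, ?_, ?_, rfl, hc.cons, ?_⟩
    · rw [← List.tail_drop, ← hl']; rfl
    · simp at hi; omega
    · rw [List.range_succ, List.reverse_append]
      refine ⟨_, z, rfl, ⟨c, _, rfl, hc, ?_⟩, hz⟩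
      rw [← hl']
      exact ⟨x, y, rfl, hx, hy⟩
  · rintro s ⟨i, c, z, hl', hi, rfl, hc, hz⟩
    obtain rfl : i = l.length := by simpa using hi
    exact hz

/-- The concatenation of a list of lists, in some order. -/
def flattenP : Prog := (.skip ⊠ nilP) ⨾ each revAppP

theorem wp_flattenP {qs : List (PolyY K n)} {w : Val K} {D : ℕ} (hq : qs.length ≤ N)
    (hD : D + 1 ≤ N) (hw : ListRep (RepQ M D) qs w) :
    wp N flattenP w fun y => ∃ es, ListRep (RepR M D) es y ∧ es.length ≤ qs.length * (D + 1) ∧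
      (∀ e ∈ es, ∃ q ∈ qs, ∃ i, e = q.coeff i) ∧ ∀ q ∈ qs, ∀ i, q.coeff i = 0 ∨ q.coeff i ∈ es := by
  simp only [flattenP, wp, app_nil]
  refine wp_each (fun l s => ∃ m es, qs = m ++ l ∧ ListRep (RepR M D) es s ∧
    es.length ≤ m.length * (D + 1) ∧ (∀ e ∈ es, ∃ q ∈ m, ∃ i, e = q.coeff i) ∧
    ∀ q ∈ m, ∀ i, q.coeff i = 0 ∨ q.coeff i ∈ es) hw hq ⟨[], [], rfl, rfl, by simp⟩ ?_ ?_
  · rintro q l x s - ⟨c, hc, hcl, hx⟩ ⟨m, es, hm, hs, h1, h2, h3⟩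
    refine wp_mono (wp_revAppP hx hs (by omega)) fun y hy =>
      ⟨m ++ [q], _, by simpa using hm, hy, ?_, ?_, ?_⟩
    · simp only [List.length_append, List.length_reverse, List.length_singleton]
      nlinarith
    · intro e he
      rcases List.mem_append.1 he with he | he
      · rw [List.mem_reverse] at he
        obtain ⟨i, hi, rfl⟩ := List.getElem_of_mem he
        refine ⟨q, by simp, i, ?_⟩
        rw [← hc, coeff_ofList, List.getD_eq_getElem _ _ hi]
      · obtain ⟨q', hq', h⟩ := h2 e he
        exact ⟨q', by simp [hq'], h⟩
    · intro q' hq' i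
      rcases List.mem_append.1 hq' with hq' | hq'
      · exact (h3 q' hq' i).imp_right fun h => List.mem_append_right _ h
      · rw [List.mem_singleton.1 hq', ← hc, coeff_ofList]
        by_cases hi : i < c.length
        · rw [List.getD_eq_getElem _ _ hi]
          exact Or.inr (List.mem_append_left _ (List.mem_reverse.2 (List.getElem_mem hi)))
        · exact Or.inl (List.getD_eq_default _ _ (by omega))
  · rintro s ⟨m, es, hm, hs, h⟩
    obtain rfl : qs = m := by simpa using hm
    exact ⟨es, hs, h⟩

/-- `(m, (V, l))` is mapped to the list of the codes of the first `m` entries of `l`, in reverse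
order. The list `l` is extended by zeros, if necessary. -/
def takeDecodeP : Prog :=
  (hd ⊠ (arg₁ ⊠ (rest₂ ⊠ nilP))) ⨾
  each (arg₁ ⊠ ((arg₂ ⨾ tl) ⊠ (((arg₁ ⊠ (arg₂ ⨾ hd)) ⨾ decodeP) ⊠ rest₃))) ⨾ rest₂

theorem wp_takeDecodeP {m D : ℕ} {l : List (MvPolynomial (Fin n) K)} {x V w : Val K}
    (hD : D < M) (hN : M ^ n ≤ N) (hm : m ≤ N) (hx : Counter m x)
    (hV : ListRep RepVec (vecs M n) V) (hw : ListRep (RepR M D) l w) :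
    wp N takeDecodeP (.cons x (.cons V w)) (ListRep (fun q w => IsCodeX w q)
      ((List.range m).map fun i => l.getD i 0).reverse) := by
  simp only [takeDecodeP, wp, app_fst, app_snd, app_nil]
  refine wp_each_counter (fun i s => ∃ j t z, j + i = m ∧ s = .cons V (.cons t z) ∧
    ListRep (RepR M D) (l.drop j) t ∧ ListRep (fun q w => IsCodeX w q)
      ((List.range j).map fun i => l.getD i 0).reverse z) hx hm
    ⟨0, w, .nil, by omega, rfl, hw, rfl⟩ ?_ ?_
  · rintro i _ s - ⟨j, t, z, hj, rfl, ht, hz⟩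
    simp only [wp, app_fst, app_snd]
    have hhd : RepR M D (l.getD j 0) (Prim.fst.app t) ∧
        ListRep (RepR M D) (l.drop (j + 1)) (Prim.snd.app t) := by
      rw [← List.tail_drop]
      cases hc : l.drop j with
      | nil =>
        rw [hc] at ht
        obtain rfl : t = .nil := ht
        rw [List.getD_eq_default _ _ (List.drop_eq_nil_iff.1 hc)]
        exact ⟨repR_zero _, rfl⟩
      | cons a₀ a' =>
        rw [hc] at ht
        obtain ⟨u, z, rfl, hu, hz⟩ := ht
        have : l.getD j 0 = a₀ := by
          have := congrArg (fun l => l.getD 0 0) hc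
          simpa [List.getD_eq_getElem?_getD] using this
        rw [this]
        exact ⟨hu, hz⟩
    refine wp_mono (wp_decodeP hV hhd.1 hD hN) fun u hu => ?_
    refine ⟨j + 1, _, _, by omega, rfl, hhd.2, ?_⟩
    rw [List.range_succ, List.map_append, List.reverse_append]
    exact ⟨u, z, rfl, hu, hz⟩
  · rintro s ⟨j, t, z, hj, rfl, ht, hz⟩
    obtain rfl : j = m := by omega
    exact hz

/-- `(gs, (c, (φ, α)))` is mapped to the list of the `sel K c (φ * g) α s`, for `g` in `gs` and
`1 ≤ s ≤ c.length`, in some order. -/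
def gatherP : Prog :=
  (hd ⊠ (tl ⊠ nilP)) ⨾
  each (arg₁ ⊠ (((((arg₁ ⨾ hd) ⊠ ((((arg₁ ⨾ tl ⨾ hd) ⊠ hd) ⨾ mulQ) ⊠ (arg₁ ⨾ tl ⨾ tl))) ⨾
    selP ⨾ tl) ⊠ rest₂) ⨾ revAppP)) ⨾ tl

theorem wp_gatherP (hN : Big n M Dm N) {c : List (MvPolynomial (Fin n) K)} {φ : PolyY K n}
    {gs : List (PolyY K n)} {a : MvPolynomial (Fin n) K} {w x y z : Val K} {D Dφ : ℕ} (hD1 : 1 ≤ D)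
    (hD : symmSize c.length D (Dφ + D + D) ≤ Dm) (hDφ : Dφ + D + D ≤ Dm) (hc : c.length + 1 ≤ N)
    (hg : gs.length ≤ N) (hw : ListRep (RepQ M D) gs w)
    (hx : ListRep (RepR M D) c x) (hy : RepQ M Dφ φ y) (hz : RepR M D a z) :
    wp N gatherP (.cons w (.cons x (.cons y z))) fun v => ∃ qs,
      ListRep (RepQ M (symmSize c.length D (Dφ + D + D))) qs v ∧ qs.Perm (gs.flatMap fun g =>
        ((List.range (c.length + 1)).map (sel K c (φ * g) a)).tail) := by
  simp only [gatherP, wp, app_fst, app_snd, app_nil]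
  refine wp_each (fun l s => ∃ m qs t, gs = m ++ l ∧ s = .cons (.cons x (.cons y z)) t ∧
    ListRep (RepQ M (symmSize c.length D (Dφ + D + D))) qs t ∧ qs.Perm (m.flatMap fun g =>
        ((List.range (c.length + 1)).map (sel K c (φ * g) a)).tail)) hw hg
    ⟨[], [], .nil, rfl, rfl, rfl, by simp⟩ ?_ ?_
  · rintro g l v s - hv ⟨m, qs, t, hm, rfl, ht, hqs⟩
    simp only [wp, app_fst, app_snd]
    refine wp_mono ((implQ hN).mul (by omega) hy hv) fun u hu => ?_
    refine wp_mono (wp_selP hN hD1 hD hDφ hc hx hu hz) fun r hr => ?_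
    rw [List.range_succ_eq_map, List.map_cons] at hr
    obtain ⟨r₀, r, rfl, -, hr⟩ := hr
    refine wp_mono (wp_revAppP hr ht (by simp; omega)) fun r hr => ?_
    refine ⟨m ++ [g], _, r, by simpa using hm, rfl, hr, ?_⟩
    rw [List.flatMap_append, List.flatMap_singleton, List.range_succ_eq_map, List.map_cons,
      List.tail_cons]
    refine ((List.reverse_perm _).append ?_).trans List.perm_append_comm
    rwa [List.range_succ_eq_map] at hqs
  · rintro s ⟨m, qs, t, hm, rfl, ht, hqs⟩
    obtain rfl : gs = m := by simpa using hm
    exact ⟨qs, ht, hqs⟩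

theorem isCodeX_nil_iff {w : Val K} {q : MvPolynomial (Fin n) K} (h : IsCodeX w q) :
    w = .nil ↔ q = 0 := by
  obtain ⟨l, -, hl, rfl⟩ := h
  rw [← MvPolynomial.support_eq_empty, Finset.eq_empty_iff_forall_notMem]
  simp only [← hl]
  cases l with
  | nil => simp [Val.list]
  | cons e l =>
    refine ⟨fun h => ?_, fun h => absurd List.mem_cons_self (h e)⟩
    simp [Val.list] at h

theorem isCodeY_of_listRep {p : PolyY K n} {w : Val K}
    (h : ListRep (fun q w => IsCodeX w q) ((List.range (p.natDegree + 1)).map p.coeff) w) :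
    IsCodeY w p := by
  rw [listRep_iff] at h
  obtain ⟨ws, rfl, h⟩ := h
  have hlen : ws.length = p.natDegree + 1 := by simpa using h.length_eq.symm
  refine ⟨fun j => ws[j], fun j => ?_, ?_⟩
  · have := (List.forall₂_iff_get.1 h).2 j (by simp; omega) (by omega)
    simpa using this
  · congr 1
    refine List.ext_getElem (by simp [hlen]) fun i h1 h2 => by rw [List.getElem_ofFn]; rfl

/-! ### The search for components -/

/-- A tree represents the polynomial and the list of the inequation and the equations of a
component. The size of the polynomials is at most `D`, and there are `b` equations. -/
def RepComp (D b : ℕ) (x : PolyY K n × List (MvPolynomial (Fin n) K)) (w : Val K) : Prop :=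
  (∃ u v, w = .cons u v ∧ IsCodeY u x.1 ∧ ListRep (fun q w => IsCodeX w q) x.2 v) ∧
    x.2.length = b + 1 ∧ degXY x.1 ≤ D ∧ ∀ t ∈ x.2, t.totalDegree ≤ D

/-- Every component in the list belongs to a datum in `J`, and the list contains a component for
every datum in `J` that yields one. -/
def Covers (L : List (PolyY K n × List (MvPolynomial (Fin n) K)))
    (J : Set (Datum (MvPolynomial (Fin n) K))) : Prop :=
  (∀ x ∈ L, ∃ τ ∈ J, IsCompOf K τ x) ∧
    ∀ τ ∈ J, (τ.poly K).coeff τ.s ≠ 0 → ∃ x ∈ L, IsCompOf K τ x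

/-- On the input `(x, (ctx, acc))`, where `acc` represents a list of components, the program `f`
adds at most `m` components to this list, and they cover `J`. -/
def Adds (N D b : ℕ) (f : Prog) (x ctx : Val K) (J : Set (Datum (MvPolynomial (Fin n) K)))
    (m : ℕ) : Prop :=
  ∀ L acc, ListRep (RepComp D b) L acc → wp N f (.cons x (.cons ctx acc)) fun y => ∃ L',
    ListRep (RepComp D b) (L' ++ L) y ∧ L'.length ≤ m ∧ Covers L' J

/-- Apply a program that adds components, for each entry of a list. -/
def eachAcc (f : Prog) : Prog := each (arg₁ ⊠ f) ⨾ tl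

theorem Covers.append {L L' : List (PolyY K n × List (MvPolynomial (Fin n) K))}
    {J J' : Set (Datum (MvPolynomial (Fin n) K))} (h : Covers L J) (h' : Covers L' J') :
    Covers (L ++ L') (J ∪ J') := by
  refine ⟨fun x hx => ?_, fun τ hτ h0 => ?_⟩
  · rcases List.mem_append.1 hx with hx | hx
    · obtain ⟨τ, hτ, h1⟩ := h.1 x hx
      exact ⟨τ, Or.inl hτ, h1⟩
    · obtain ⟨τ, hτ, h1⟩ := h'.1 x hx
      exact ⟨τ, Or.inr hτ, h1⟩
  · rcases hτ with hτ | hτ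
    · obtain ⟨x, hx, h1⟩ := h.2 τ hτ h0
      exact ⟨x, List.mem_append_left _ hx, h1⟩
    · obtain ⟨x, hx, h1⟩ := h'.2 τ hτ h0
      exact ⟨x, List.mem_append_right _ hx, h1⟩

theorem adds_eachAcc {α : Type*} {ρ : α → Val K → Prop} {l : List α} {D b m m' : ℕ} {f : Prog}
    {w ctx : Val K} {J : α → Set (Datum (MvPolynomial (Fin n) K))}
    {J' : Set (Datum (MvPolynomial (Fin n) K))} (hl : l.length ≤ N) (hw : ListRep ρ l w)
    (hf : ∀ a ∈ l, ∀ x, ρ a x → Adds N D b f x ctx (J a) m)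
    (hJ : ∀ τ, τ ∈ J' ↔ ∃ a ∈ l, τ ∈ J a) (hm : l.length * m ≤ m') :
    Adds N D b (eachAcc f) w ctx J' m' := by
  intro L acc hacc
  simp only [eachAcc, wp]
  refine wp_each (fun l' s => ∃ l₀ acc' L', l = l₀ ++ l' ∧ s = .cons ctx acc' ∧
    ListRep (RepComp D b) (L' ++ L) acc' ∧ L'.length ≤ l₀.length * m ∧
    Covers L' {τ | ∃ a ∈ l₀, τ ∈ J a}) hw hl ⟨[], acc, [], rfl, rfl, hacc, by simp, ?_⟩ ?_ ?_
  · exact ⟨by simp, by simp⟩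
  · rintro a l' x s hsuf hx ⟨l₀, acc', L', hl₀, rfl, hacc', hlen, hcov⟩
    simp only [wp, app_fst, app_snd]
    refine wp_mono (hf a (hsuf.subset (by simp)) x hx _ _ hacc') ?_
    rintro y ⟨L'', hy, hlen', hcov'⟩
    refine ⟨l₀ ++ [a], y, L'' ++ L', by simpa using hl₀, rfl, by simpa using hy, ?_, ?_⟩
    · simp only [List.length_append, List.length_singleton]
      nlinarith
    · convert hcov'.append hcov using 1
      ext τ
      simp only [List.mem_append, List.mem_singleton, Set.mem_ofPred_eq, Set.mem_union]
      constructor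
      · rintro ⟨a', h | rfl, h'⟩
        · exact Or.inr ⟨a', h, h'⟩
        · exact Or.inl h'
      · rintro (h | ⟨a', h, h'⟩)
        · exact ⟨a, Or.inr rfl, h⟩
        · exact ⟨a', Or.inl h, h'⟩
  · rintro s ⟨l₀, acc', L', hl₀, rfl, hacc', hlen, hcov⟩
    obtain rfl : l = l₀ := by simpa using hl₀
    refine ⟨L', hacc', hlen.trans hm, ?_⟩
    convert hcov using 1
    ext τ
    exact hJ τ

theorem totalDegree_getD_le {l : List (MvPolynomial (Fin n) K)} {w : Val K} {D : ℕ}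
    (hw : ListRep (RepR M D) l w) (i : ℕ) : (l.getD i 0).totalDegree ≤ D := by
  obtain ⟨ws, -, hws⟩ := listRep_iff.1 hw
  by_cases hi : i < l.length
  · rw [List.getD_eq_getElem _ _ hi]
    exact ((List.forall₂_iff_get.1 hws).2 i hi (by rw [← hws.length_eq]; exact hi)).2
  · rw [List.getD_eq_default _ _ (by omega)]
    simp

/-- A candidate, given by `s + 1` in unary and the list of the `sel K c φ α s'`, for
`s ≤ s' ≤ c.length`, is turned into a component, if its leading coefficient does not vanish. The
context consists of the list of all exponent vectors, a list whose length is the number of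
equations, and the list of the further equations. -/
def candidateP : Prog :=
  ((((hd ⨾ hd) ⊠ ((arg₁ ⨾ hd) ⊠ (hd ⨾ tl ⨾ hd))) ⨾ takeDecodeP) ⊠ .skip) ⨾
  .branch (hd ⨾ hd)
    (((hd ⨾ revP) ⊠ ((hd ⨾ hd) ⊠ (((arg₂ ⨾ tl ⨾ hd) ⊠ ((arg₂ ⨾ hd) ⊠
      ((((arg₁ ⨾ tl ⨾ tl) ⊠ (arg₂ ⨾ tl ⨾ tl)) ⨾ revAppP) ⨾ flattenP))) ⨾ takeDecodeP))) ⊠ rest₃)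
    rest₃

theorem adds_candidateP {c : List (MvPolynomial (Fin n) K)} {φ : PolyY K n}
    {gs qs : List (PolyY K n)} {a : MvPolynomial (Fin n) K} {s D b Bd : ℕ} {x y V W L : Val K}
    (hDM : D < M) (hDN : D + 1 ≤ N) (hN : M ^ n ≤ N) (hbN : b ≤ N) (hcN : c.length + 1 ≤ N)
    (hs : s ≤ c.length) (hx : Counter (s + 1) x)
    (hy : ListRep (RepQ M D) (((List.range (c.length + 1)).map (sel K c φ a)).drop s) y)
    (hV : ListRep RepVec (vecs M n) V) (hW : Counter b W) (hL : ListRep (RepQ M D) qs L)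
    (hqs : qs.Perm (gs.flatMap fun g =>
        ((List.range (c.length + 1)).map (sel K c (φ * g) a)).tail))
    (hb : (c.length + qs.length) * (D + 1) ≤ b) (hBd : D + s ≤ Bd) :
    Adds N Bd b candidateP (.cons x y) (.cons V (.cons W L)) {⟨c, a, φ, gs, s⟩} 1 := by
  intro L₀ acc hacc
  obtain ⟨τ, hτ⟩ : ∃ τ : Datum (MvPolynomial (Fin n) K), τ = ⟨c, a, φ, gs, s⟩ := ⟨_, rfl⟩
  have hs' : s < ((List.range (c.length + 1)).map (sel K c φ a)).length := by simp; omega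
  rw [List.drop_eq_getElem_cons hs'] at hy
  obtain ⟨y₁, y₂, rfl, ⟨l, hl, hlen, hy₁⟩, hy₂⟩ := hy
  have hlp : ∀ i, l.getD i 0 = (τ.poly K).coeff i := fun i => by
    rw [← coeff_ofList, hl, hτ]
    simp [Datum.poly]
  have hdeg : ∀ i, ((τ.poly K).coeff i).totalDegree ≤ D := fun i => by
    rw [← hlp]
    exact totalDegree_getD_le hy₁ i
  have hss : τ.s = s := by rw [hτ]
  rw [← hτ]
  simp only [candidateP, wp, app_fst, app_snd]
  refine wp_mono (wp_takeDecodeP hDM hN (by omega) hx hV hy₁) fun u hu => ?_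
  simp only [hlp] at hu
  rw [List.range_succ, List.map_append, List.reverse_append] at hu
  obtain ⟨u₁, u₂, rfl, hu₁, hu₂⟩ := id hu
  simp only [app_fst]
  constructor
  · intro hne
    have h0 : (τ.poly K).coeff s ≠ 0 := fun h => hne ((isCodeX_nil_iff hu₁).2 h)
    have hlen2 : (((List.range (c.length + 1)).map (sel K c φ a)).drop (s + 1)).reverse.length +
        qs.length ≤ c.length + qs.length := by simp
    have hle := Nat.le_mul_of_pos_right (c.length + qs.length) (show 0 < D + 1 by omega)
    refine wp_mono (wp_revP hu (by simp; omega)) fun r hr => ?_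
    refine wp_mono (wp_revAppP hy₂ hL (by simp; omega)) fun e he => ?_
    refine wp_mono (wp_flattenP (by rw [List.length_append]; omega) hDN he) ?_
    rintro e' ⟨es, hes, h1, h2, h3⟩
    refine wp_mono (wp_takeDecodeP hDM hN hbN hW hV hes) fun v hv => ?_
    have hesb : es.length ≤ b := by
      refine h1.trans (le_trans (Nat.mul_le_mul_right _ ?_) hb)
      rw [List.length_append]; omega
    have hmem : ∀ q, q ∈ (((List.range (c.length + 1)).map (sel K c φ a)).drop (s + 1)).reverse ++
        qs ↔ q ∈ τ.eqs K := fun q => by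
      rw [Datum.eqs, hτ, List.mem_append, List.mem_append, List.mem_reverse, hqs.mem_iff]
    have hcomp : IsCompOf K τ (ofList ((List.range (s + 1)).map (τ.poly K).coeff),
        (τ.poly K).coeff s :: ((List.range b).map fun i => es.getD i 0).reverse) := by
      refine ⟨fun i => ?_, _, by rw [hss], by rwa [hss], fun e he => ?_, fun q hq i => ?_⟩
      · rw [coeff_ofList, hss]
        split_ifs with hi
        · rw [List.getD_eq_getElem _ _ (by simp; omega)]; simp
        · rw [List.getD_eq_default _ _ (by simp; omega)]
      · rw [List.mem_reverse, List.mem_map] at he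
        obtain ⟨i, hi, rfl⟩ := he
        by_cases hi : i < es.length
        · rw [List.getD_eq_getElem _ _ hi]
          obtain ⟨q, hq, h⟩ := h2 _ (List.getElem_mem hi)
          exact Or.inr ⟨q, (hmem q).1 hq, h⟩
        · exact Or.inl (List.getD_eq_default _ _ (by omega))
      · refine (h3 q ((hmem q).2 hq) i).imp_right fun h => ?_
        obtain ⟨j, hj, h⟩ := List.getElem_of_mem h
        rw [List.mem_reverse, List.mem_map]
        exact ⟨j, by simp; omega, by rw [List.getD_eq_getElem _ _ hj, h]⟩
    have hnat := hcomp.natDegree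
    rw [hss] at hnat
    refine ⟨[(ofList ((List.range (s + 1)).map (τ.poly K).coeff),
      (τ.poly K).coeff s :: ((List.range b).map fun i => es.getD i 0).reverse)],
      ⟨_, acc, rfl, ⟨⟨r, _, rfl, isCodeY_of_listRep ?_, u₁, v, rfl, hu₁, hv⟩, by simp, ?_, ?_⟩,
        hacc⟩, by simp, ?_, ?_⟩
    · rw [hnat]
      convert hr using 1
      rw [← List.reverse_append, List.reverse_reverse, ← List.map_append, ← List.range_succ]
      refine List.map_congr_left fun i hi => (hcomp.1 i).trans (if_pos ?_)
      have := List.mem_range.1 hi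
      omega
    · refine Finset.sup_le fun j hj => ?_
      have hj' := Polynomial.le_natDegree_of_mem_supp j hj
      rw [hnat] at hj'
      rw [hcomp.1, if_pos (by omega)]
      exact (Nat.add_le_add (hdeg j) hj').trans hBd
    · intro t ht
      rcases List.mem_cons.1 ht with rfl | ht
      · exact (hdeg s).trans (by omega)
      · rw [List.mem_reverse, List.mem_map] at ht
        obtain ⟨i, -, rfl⟩ := ht
        exact (totalDegree_getD_le hes i).trans (by omega)
    · intro x hx
      exact ⟨τ, rfl, by rwa [List.mem_singleton.1 hx]⟩
    · intro τ' hτ' _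
      rw [Set.mem_singleton_iff.1 hτ']
      exact ⟨_, by simp, hcomp⟩
  · intro hnil
    have h0 := (isCodeX_nil_iff hu₁).1 hnil
    refine ⟨[], hacc, by simp, by simp, fun τ' hτ' h => absurd ?_ h⟩
    rw [Set.mem_singleton_iff.1 hτ', hss]
    exact h0

end

/-! ### Loops over the candidates -/

/-- The size of the coefficients after homogenization of polynomials of degree less than `d`. -/
def homogSize (d : ℕ) : ℕ := (d + 1) * d

/-- The size of the polynomials that do not vanish at the selected roots. -/
def avoidSize (d : ℕ) : ℕ :=
  symmSize d (homogSize d) (homogSize d + homogSize d) + (homogSize d + homogSize d)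

/-- The size of the polynomials of the components. -/
def compSize (d : ℕ) : ℕ := symmSize d (homogSize d) (avoidSize d + homogSize d + homogSize d)

theorem symmSize_mono {r r' D D' : ℕ} (hr : r ≤ r') (hD : D ≤ D') (C : ℕ) :
    symmSize r C D ≤ symmSize r' C D' := by
  unfold symmSize; gcongr

theorem le_symmSize {r : ℕ} (hr : 1 ≤ r) (C D : ℕ) : D ≤ symmSize r C D := by
  unfold symmSize
  nlinarith [Nat.zero_le ((r * D + 1) * C), Nat.le_mul_of_pos_left D hr,
    Nat.le_mul_of_pos_left ((r * D + 1) * C + r * D) hr]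

/-- The bounds that the search for components needs: `d` bounds the degrees of the `k` given
equations, `b` is the number of equations of a component, `Bd` bounds the degrees of the output, and
`N` bounds the numbers of iterations of all loops. -/
structure Bounds (n M N d k b Bd : ℕ) : Prop where
  big : Big n M (compSize d) N
  one_le : 1 ≤ d
  lt : compSize d < M
  le_b : (d + k * d) * (compSize d + 1) ≤ b
  b_le : b ≤ N
  k_le : k ≤ N
  le_Bd : compSize d + d ≤ Bd

section
variable {K : Type u} [Field K] {N n M d k b Bd : ℕ}

theorem Bounds.size_le (h : Bounds n M N d k b Bd) :
    d ≤ homogSize d ∧ 1 ≤ homogSize d ∧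
      homogSize d + homogSize d + homogSize d + homogSize d ≤ compSize d ∧
      avoidSize d + homogSize d + homogSize d ≤ compSize d ∧ d + 1 ≤ N ∧ M ^ n ≤ N ∧
      symmSize d (homogSize d) (homogSize d + homogSize d) ≤ compSize d := by
  have h1 := h.one_le
  have h2 : d ≤ homogSize d := by unfold homogSize; nlinarith
  have h3 : avoidSize d + homogSize d + homogSize d ≤ compSize d := le_symmSize h1 _ _
  have h4 : symmSize d (homogSize d) (homogSize d + homogSize d) + (homogSize d + homogSize d) =
    avoidSize d := rfl
  have h5 := h.big.2
  refine ⟨h2, by omega, by omega, h3, by omega, ?_, by omega⟩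
  have := Nat.le_mul_of_pos_left (M ^ n) (show 0 < compSize d by omega)
  have := h.big.1
  omega

/-- For a polynomial `w`, the components that are selected by `w * h`. The context consists of the
list of all exponent vectors, a list whose length is the number of equations, the leading
coefficient `α`, the homogenized equations, the lower coefficients `c`, and `h`. -/
def refineP : Prog :=
  (((hd ⊠ (arg₁ ⨾ tl ⨾ rest₄)) ⨾ mulQ) ⊠ .skip) ⨾
  ((((arg₂ ⨾ arg₄) ⊠ (hd ⊠ (arg₂ ⨾ arg₂))) ⨾ selP ⨾ tl ⨾ tailsP) ⊠
    (((arg₂ ⨾ hd) ⊠ ((arg₂ ⨾ arg₁) ⊠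
      (((arg₂ ⨾ arg₃) ⊠ ((arg₂ ⨾ arg₄) ⊠ (hd ⊠ (arg₂ ⨾ arg₂)))) ⨾ gatherP))) ⊠ rest₃)) ⨾
  eachAcc candidateP

theorem adds_refineP (hB : Bounds n M N d k b Bd) {c : List (MvPolynomial (Fin n) K)}
    {p h : PolyY K n} {gs : List (PolyY K n)} {a : MvPolynomial (Fin n) K}
    {w V W x₁ x₂ x₃ x₄ : Val K} (hc : c.length ≤ d) (hgs : gs.length ≤ k)
    (hV : ListRep RepVec (vecs M n) V) (hW : Counter b W) (h₁ : RepR M (homogSize d) a x₁)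
    (h₂ : ListRep (RepQ M (homogSize d)) gs x₂) (h₃ : ListRep (RepR M (homogSize d)) c x₃)
    (h₄ : RepQ M (homogSize d + homogSize d) h x₄)
    (hw : RepQ M (symmSize d (homogSize d) (homogSize d + homogSize d)) p w) :
    Adds N Bd b refineP w (.cons V (.cons W (.cons x₁ (.cons x₂ (.cons x₃ x₄)))))
      {τ | ∃ i < c.length, τ = ⟨c, a, p * h, gs, i + 1⟩} d := by
  intro L acc hacc
  obtain ⟨s1, s2, s3, s4, s5, s6, s7⟩ := hB.size_le
  have e1 : symmSize c.length (homogSize d) (avoidSize d + homogSize d) ≤ compSize d :=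
    symmSize_mono hc (by omega) _
  have e2 : symmSize c.length (homogSize d) (avoidSize d + homogSize d + homogSize d) ≤
    compSize d :=
    symmSize_mono hc le_rfl _
  have hkN := hB.k_le
  simp only [refineP, wp, app_fst, app_snd]
  refine wp_mono ((implQ hB.big).mul (show avoidSize d ≤ _ by omega) hw h₄) fun f hf => ?_
  refine wp_mono (wp_selP hB.big (Dφ := avoidSize d) s2 e1 (by omega) (by omega) h₃ hf h₁)
    fun l hl => ?_
  have hl' := (implQ hB.big).listMono e1 hl
  rw [List.range_succ_eq_map, List.map_cons] at hl'
  obtain ⟨l₀, l, rfl, -, hl'⟩ := hl'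
  simp only [app_snd]
  refine wp_mono (wp_tailsP (by simp; omega) hl') fun t ht => ?_
  refine wp_mono (wp_gatherP hB.big (Dφ := avoidSize d) s2 e2 (by omega) (by omega) (by omega) h₂ h₃
    hf h₁) ?_
  rintro g ⟨qs, hg, hqs⟩
  have hg' := (implQ hB.big).listMono e2 hg
  refine adds_eachAcc (J := fun i => {⟨c, a, p * h, gs, i + 1⟩}) (m := 1) (m' := d) ?_ ht ?_ ?_ ?_
    L acc hacc
  · simp; omega
  · rintro i hi x ⟨y, z, rfl, hy, hz⟩
    simp only [List.length_map, List.length_range, List.mem_reverse, List.mem_range] at hi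
    refine adds_candidateP hB.lt hB.big.2 s6 hB.b_le (by omega) (by omega) hy ?_ hV hW hg' hqs ?_ ?_
    · rw [List.range_succ_eq_map, List.map_cons, List.drop_succ_cons]
      exact hz
    · refine le_trans (Nat.mul_le_mul_right _ ?_) hB.le_b
      have : qs.length ≤ k * d := by
        rw [hqs.length_eq, List.length_flatMap]
        simp only [List.length_tail, List.length_map, List.length_range, Nat.add_sub_cancel,
          List.map_const', List.sum_replicate, smul_eq_mul]
        exact Nat.mul_le_mul hgs hc
      omega
    · have := hB.le_Bd
      omega
  · intro τ
    simp
  · simpa using hc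

/-- For an element `κ` of `K`, the components that are selected after the choice of `κ`. The context
is the same as for `refineP`. -/
def combineP : Prog :=
  ((((arg₁ ⨾ arg₄) ⊠ (((hd ⊠ (arg₁ ⨾ arg₃)) ⨾ comboP) ⊠ (.prim .one ⊠ nilP))) ⨾ selP) ⊠ tl) ⨾
  eachAcc refineP

theorem adds_combineP (hB : Bounds n M N d k b Bd) {c : List (MvPolynomial (Fin n) K)}
    {h : PolyY K n} {gs : List (PolyY K n)} {a : MvPolynomial (Fin n) K} {κ : ℕ}
    {V W x₁ x₂ x₃ x₄ : Val K} (hc : c.length ≤ d) (hgs : gs.length ≤ k)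
    (hV : ListRep RepVec (vecs M n) V) (hW : Counter b W) (h₁ : RepR M (homogSize d) a x₁)
    (h₂ : ListRep (RepQ M (homogSize d)) gs x₂) (h₃ : ListRep (RepR M (homogSize d)) c x₃)
    (h₄ : RepQ M (homogSize d + homogSize d) h x₄) :
    Adds N Bd b combineP (.fld (κ : K))
      (.cons V (.cons W (.cons x₁ (.cons x₂ (.cons x₃ x₄)))))
      {τ | ∃ s₁ ≤ c.length, ∃ i < c.length,
        τ = ⟨c, a, sel K c (combo (algebraMap K _ (κ : K)) gs) 1 s₁ * h, gs, i + 1⟩}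
      ((d + 1) * d) := by
  intro L acc hacc
  obtain ⟨s1, s2, s3, s4, s5, s6, s7⟩ := hB.size_le
  have hkN := hB.k_le
  have e1 : symmSize c.length (homogSize d) (homogSize d + homogSize d) ≤
    symmSize d (homogSize d) (homogSize d + homogSize d) := symmSize_mono hc le_rfl _
  simp only [combineP, wp, app_fst, app_snd, app_nil, app_one]
  refine wp_mono (wp_comboP hB.big (by omega) (by omega) h₂) fun f hf => ?_
  have h1 := repR_const (n := n) (M := M) (1 : K) (homogSize d)
  rw [map_one] at h1
  refine wp_mono (wp_selP hB.big s2 (e1.trans s7) (by omega) (by omega) h₃ hf h1) fun l hl => ?_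
  have hl := (implQ hB.big).listMono e1 hl
  rw [listRep_map] at hl
  refine adds_eachAcc (J := fun s₁ => {τ | ∃ i < c.length,
    τ = ⟨c, a, sel K c (combo (algebraMap K _ (κ : K)) gs) 1 s₁ * h, gs, i + 1⟩}) (m := d)
    ?_ hl ?_ ?_ ?_ L acc hacc
  · simp; omega
  · exact fun s₁ _ x hx => adds_refineP hB hc hgs hV hW h₁ h₂ h₃ h₄ hx
  · intro τ
    simp
  · rw [List.length_range]
    gcongr

/-- For the lower coefficients `c` of a monic polynomial, the components that belong to simple roots
of this polynomial. The context consists of the list of all exponent vectors, a list whose length is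
the number of equations, the leading coefficient, the homogenized equations, and the homogenized
inequation. -/
def simpleRootsP : Prog :=
  ((arg₁ ⨾ arg₁ ⨾ natsP) ⊠ (((arg₁ ⨾ hd) ⊠ ((arg₁ ⨾ arg₁) ⊠ ((arg₁ ⨾ arg₂) ⊠ ((arg₁ ⨾ arg₃) ⊠ (hd ⊠
    (((hd ⨾ nextP ⨾ monicP) ⊠ (arg₁ ⨾ rest₄)) ⨾ mulQ)))))) ⊠ rest₂)) ⨾
  eachAcc combineP

theorem adds_simpleRootsP (hB : Bounds n M N d k b Bd) {c : List (MvPolynomial (Fin n) K)}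
    {g₀ : PolyY K n} {gs : List (PolyY K n)} {a : MvPolynomial (Fin n) K}
    {V W x₁ x₂ x₃ x₄ : Val K} (hc : c.length ≤ d) (hgs : gs.length ≤ k)
    (hV : ListRep RepVec (vecs M n) V) (hW : Counter b W) (h₁ : RepR M (homogSize d) a x₁)
    (h₂ : ListRep (RepQ M (homogSize d)) gs x₂) (h₃ : ListRep (RepR M (homogSize d)) c x₃)
    (h₄ : RepQ M (homogSize d) g₀ x₄) :
    Adds N Bd b simpleRootsP x₃ (.cons V (.cons W (.cons x₁ (.cons x₂ x₄))))
      {τ | ∃ κ < b, ∃ s₁ ≤ c.length, ∃ i < c.length, τ = ⟨c, a,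
        sel K c (combo (algebraMap K _ (κ : K)) gs) 1 s₁ * (monicPoly (nextList K c) * g₀), gs,
        i + 1⟩} (b * ((d + 1) * d)) := by
  intro L acc hacc
  obtain ⟨s1, s2, s3, s4, s5, s6, s7⟩ := hB.size_le
  simp only [simpleRootsP, wp, app_fst, app_snd]
  refine wp_mono (wp_natsP hB.b_le hW) fun l hl => ?_
  refine wp_mono (wp_nextP hB.big (by omega) (by omega) h₃) fun c' hc' => ?_
  refine wp_mono (wp_monicP (by rw [length_nextList]; omega) (by rw [length_nextList]; omega) hc')
    fun m hm => ?_
  refine wp_mono ((implQ hB.big).mul (by omega) hm h₄) fun h hh => ?_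
  refine adds_eachAcc (J := fun κ : ℕ => {τ | ∃ s₁ ≤ c.length, ∃ i < c.length, τ = ⟨c, a,
        sel K c (combo (algebraMap K _ (κ : K)) gs) 1 s₁ * (monicPoly (nextList K c) * g₀), gs,
        i + 1⟩}) (m := (d + 1) * d) ?_ hl ?_ ?_ ?_ L acc hacc
  · simpa using hB.b_le
  · rintro κ - _ rfl
    exact adds_combineP hB hc hgs hV hW h₁ h₂ h₃ hh
  · intro τ
    simp
  · simp

/-- For the coefficients of an equation in descending order, beginning with the presumed leading
coefficient, the components that belong to roots of this equation. The context consists of the list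
of all exponent vectors, a list whose length is the number of equations, the list of the given
equations, and the given inequation. -/
def leadingP : Prog :=
  ((((hd ⨾ tl ⨾ hd) ⊠ (hd ⨾ tl ⨾ tl)) ⨾ homogP ⨾ chainP) ⊠
    (((arg₁ ⨾ hd) ⊠ ((arg₁ ⨾ arg₁) ⊠ ((hd ⨾ tl ⨾ hd) ⊠
      ((((hd ⨾ tl ⨾ hd) ⊠ (arg₁ ⨾ arg₂)) ⨾ mapP homogPolyP) ⊠
      (((hd ⨾ tl ⨾ hd) ⊠ (arg₁ ⨾ rest₃)) ⨾ homogPolyP))))) ⊠ rest₂)) ⨾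
  eachAcc simpleRootsP

theorem adds_leadingP (hB : Bounds n M N d k b Bd) {l g₀ : List (MvPolynomial (Fin n) K)}
    {gs : List (List (MvPolynomial (Fin n) K))} {V W x y x₂ x₃ : Val K}
    (hl : l.length ≤ d) (hl0 : l ≠ []) (hgs : gs.length ≤ k) (hgd : ∀ g ∈ gs, g.length = d)
    (hg₀ : g₀.length = d) (hV : ListRep RepVec (vecs M n) V) (hW : Counter b W)
    (hy : ListRep (RepR M d) l y) (h₂ : ListRep (ListRep (RepR M d)) gs x₂)
    (h₃ : ListRep (RepR M d) g₀ x₃) :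
    Adds N Bd b leadingP (.cons x y) (.cons V (.cons W (.cons x₂ x₃)))
      {τ | ∃ m < l.length - 1, ∃ κ < b, ∃ s₁ ≤ l.length - 1 - m, ∃ i < l.length - 1 - m,
        τ = mkDatum K gs g₀ l m κ s₁ (i + 1)} (d * (b * ((d + 1) * d))) := by
  intro L acc hacc
  obtain ⟨s1, s2, s3, s4, s5, s6, s7⟩ := hB.size_le
  have hkN := hB.k_le
  have h1 := hB.one_le
  obtain ⟨a, rest, rfl⟩ := List.exists_cons_of_ne_nil hl0
  obtain ⟨ya, y, rfl, hya, hy⟩ := hy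
  have hr : rest.length + 1 ≤ d := by simpa using hl
  have e1 : (rest.length + 1) * d ≤ homogSize d := by unfold homogSize; gcongr; omega
  have e2 : (d + 1) * d = homogSize d := rfl
  simp only [leadingP, wp, app_fst, app_snd]
  refine wp_mono (wp_homogP hB.big (by omega) (by omega) hya hy) fun c hc => ?_
  refine wp_mono (wp_chainP hB.big (D := homogSize d) (by omega) (by rw [length_homog]; omega)
    ((implR hB.big.1).listMono e1 hc)) fun ch hch => ?_
  refine wp_mono (wp_mapP (g := homogPoly a) (σ := RepQ M (homogSize d)) h₂ (by omega)
    fun g hg w hw => ?_) fun gh hgh => ?_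
  · have := wp_homogPolyP (l := g) (D := d) hB.big (by rw [hgd g hg]; omega)
      (by rw [hgd g hg]; omega)
      h1 hya hw
    rw [hgd g hg] at this
    exact this
  have hg₀' := wp_homogPolyP (l := g₀) (D := d) hB.big (by rw [hg₀]; omega) (by rw [hg₀]; omega) h1
    hya h₃
  rw [hg₀] at hg₀'
  refine wp_mono hg₀' fun gz hgz => ?_
  refine adds_eachAcc (J := fun m => {τ | ∃ κ < b, ∃ s₁ ≤ rest.length - m, ∃ i < rest.length - m,
    τ = mkDatum K gs g₀ (a :: rest) m κ s₁ (i + 1)}) (m := b * ((d + 1) * d)) ?_ hch ?_ ?_ ?_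
    L acc hacc
  · simp; omega
  · intro m hm w hw
    have := adds_simpleRootsP hB (c := (nextList K)^[m] (homog a 1 rest))
      (by rw [length_iterate_nextList, length_homog]; omega) (by simpa using hgs) hV hW
      ((implR hB.big.1).mono s1 hya) hgh hw hgz
    rw [length_iterate_nextList, length_homog] at this
    exact this
  · intro τ
    simp
  · simp only [List.length_reverse, List.length_range, length_homog]
    gcongr
    omega

/-- For the coefficients of an equation, the components that belong to its roots. The context is the
same as for `leadingP`. -/
def equationP : Prog := ((hd ⨾ revP ⨾ tailsP) ⊠ tl) ⨾ eachAcc leadingP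

theorem adds_equationP (hB : Bounds n M N d k b Bd) {g g₀ : List (MvPolynomial (Fin n) K)}
    {gs : List (List (MvPolynomial (Fin n) K))} {V W y x₂ x₃ : Val K}
    (hg : g.length = d) (hgs : gs.length ≤ k) (hgd : ∀ g ∈ gs, g.length = d)
    (hg₀ : g₀.length = d) (hV : ListRep RepVec (vecs M n) V) (hW : Counter b W)
    (hy : ListRep (RepR M d) g y) (h₂ : ListRep (ListRep (RepR M d)) gs x₂)
    (h₃ : ListRep (RepR M d) g₀ x₃) :
    Adds N Bd b equationP y (.cons V (.cons W (.cons x₂ x₃)))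
      {τ | ∃ j < d, ∃ m < d - j - 1, ∃ κ < b, ∃ s₁ ≤ d - j - 1 - m, ∃ i < d - j - 1 - m,
        τ = mkDatum K gs g₀ (g.reverse.drop j) m κ s₁ (i + 1)} (d * (d * (b * ((d + 1) * d)))) := by
  intro L acc hacc
  obtain ⟨s1, s2, s3, s4, s5, s6, s7⟩ := hB.size_le
  simp only [equationP, wp, app_fst, app_snd]
  refine wp_mono (wp_revP hy (by omega)) fun r hr => ?_
  refine wp_mono (wp_tailsP (by simp; omega) hr) fun t ht => ?_
  refine adds_eachAcc (J := fun j => {τ | ∃ m < d - j - 1, ∃ κ < b, ∃ s₁ ≤ d - j - 1 - m,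
    ∃ i < d - j - 1 - m, τ = mkDatum K gs g₀ (g.reverse.drop j) m κ s₁ (i + 1)})
    (m := d * (b * ((d + 1) * d))) ?_ ht ?_ ?_ ?_ L acc hacc
  · simp; omega
  · rintro j hj _ ⟨x, y, rfl, -, hy⟩
    simp only [List.length_reverse, List.mem_reverse, List.mem_range] at hj
    have := adds_leadingP hB (l := g.reverse.drop j) (x := x) (by simp; omega)
      (by rw [ne_eq, List.drop_eq_nil_iff]; simp; omega) hgs hgd hg₀ hV hW hy h₂ h₃
    simp only [List.length_drop, List.length_reverse, hg] at this
    exact this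
  · intro τ
    simp [hg]
  · simp [hg]

/-- The list of the components. The input consists of the list of all exponent vectors, a list whose
length is the number of equations, the list of the given equations, and the given inequation. -/
def searchP : Prog := (arg₂ ⊠ (.skip ⊠ nilP)) ⨾ eachAcc equationP

theorem wp_searchP (hB : Bounds n M N d k b Bd) {g₀ : List (MvPolynomial (Fin n) K)}
    {gs : List (List (MvPolynomial (Fin n) K))} {V W x₂ x₃ : Val K}
    (hgs : gs.length ≤ k) (hgd : ∀ g ∈ gs, g.length = d)
    (hg₀ : g₀.length = d) (hV : ListRep RepVec (vecs M n) V) (hW : Counter b W)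
    (h₂ : ListRep (ListRep (RepR M d)) gs x₂) (h₃ : ListRep (RepR M d) g₀ x₃) :
    wp N searchP (.cons V (.cons W (.cons x₂ x₃))) fun y => ∃ L,
      ListRep (RepComp Bd b) L y ∧ L.length ≤ gs.length * (d * (d * (b * ((d + 1) * d)))) ∧
      Covers L {τ | ∃ g ∈ gs, ∃ j < d, ∃ m < d - j - 1, ∃ κ < b, ∃ s₁ ≤ d - j - 1 - m,
        ∃ i < d - j - 1 - m, τ = mkDatum K gs g₀ (g.reverse.drop j) m κ s₁ (i + 1)} := by
  have hkN := hB.k_le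
  have h : Adds N Bd b (eachAcc equationP) x₂ (.cons V (.cons W (.cons x₂ x₃)))
      {τ | ∃ g ∈ gs, ∃ j < d, ∃ m < d - j - 1, ∃ κ < b, ∃ s₁ ≤ d - j - 1 - m,
        ∃ i < d - j - 1 - m, τ = mkDatum K gs g₀ (g.reverse.drop j) m κ s₁ (i + 1)}
      (gs.length * (d * (d * (b * ((d + 1) * d))))) :=
    adds_eachAcc (by omega) h₂
      (fun g hg y hy => adds_equationP hB (hgd g hg) hgs hgd hg₀ hV hW hy h₂ h₃)
      (fun τ => by simp only [Set.mem_ofPred_eq]) le_rfl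
  simp only [searchP, wp, app_fst, app_snd, app_nil]
  refine wp_mono (h [] .nil rfl) ?_
  rintro y ⟨L, hL, h⟩
  exact ⟨L, by simpa using hL, h⟩

end

/-! ### The program -/

theorem symmSize_le_pow {d C D e : ℕ} (hd : 2 ≤ d) (hC : C ≤ d ^ 3) (hD : D ≤ d ^ e) :
    symmSize d C D ≤ d ^ (e + 7) := by
  have h1 : 1 ≤ d ^ (e + 1) := Nat.one_le_pow _ _ (by omega)
  have h2 : d ^ (e + 1) ≤ d ^ (e + 4) := Nat.pow_le_pow_right (by omega) (by omega)
  have h3 : 4 ≤ d ^ 2 := by nlinarith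
  calc symmSize d C D ≤ d * ((d * d ^ e + 1) * d ^ 3 + d * d ^ e) := by
        unfold symmSize; gcongr
    _ = d * ((d ^ (e + 1) + 1) * d ^ 3 + d ^ (e + 1)) := by ring
    _ ≤ d * ((d ^ (e + 1) + d ^ (e + 1)) * d ^ 3 + d ^ (e + 4)) := by gcongr
    _ = 3 * d ^ (e + 5) := by ring
    _ ≤ d ^ 2 * d ^ (e + 5) := by gcongr; omega
    _ = d ^ (e + 7) := by ring

theorem add_le_pow {d a b e : ℕ} (hd : 2 ≤ d) (ha : a ≤ d ^ e) (hb : b ≤ d ^ e) :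
    a + b ≤ d ^ (e + 1) := by
  rw [pow_succ]; nlinarith

theorem compSize_le_pow {d : ℕ} (hd : 2 ≤ d) : compSize d ≤ d ^ 20 := by
  have h1 : homogSize d ≤ d ^ 3 := calc
    (d + 1) * d ≤ (d * d) * d := by gcongr; nlinarith
    _ = d ^ 3 := by ring
  have h2 : homogSize d + homogSize d ≤ d ^ 4 := add_le_pow hd h1 h1
  have h3 : avoidSize d ≤ d ^ 12 := add_le_pow (e := 11) hd (symmSize_le_pow hd h1 h2)
    (h2.trans (Nat.pow_le_pow_right (by omega) (by omega)))
  refine symmSize_le_pow (e := 13) hd h1 ?_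
  rw [add_assoc]
  exact add_le_pow hd h3 (h2.trans (Nat.pow_le_pow_right (by omega) (by omega)))

/-- The bounds that are used by the program. The choice `M = d ^ 32` leaves room for degrees up to
`d ^ 20` and for a factor `d ^ 4`, so that the number of equations of a component, which is at most
`d ^ 24 * M ^ n`, is bounded by `(M ^ n) ^ 2`. -/
theorem bounds {n d k : ℕ} (hn : 1 ≤ n) (hd : 2 ≤ d) :
    Bounds n (d ^ 32) (((d ^ 32) ^ n) ^ 2 + k + 1) d (d * (d ^ 32) ^ n + 1) (((d ^ 32) ^ n) ^ 2)
      (d ^ 20 + d) := by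
  have h3 := compSize_le_pow hd
  have hB : d ^ 32 ≤ (d ^ 32) ^ n := Nat.le_self_pow (by omega) _
  have h4 : d ^ 20 < d ^ 32 := Nat.pow_lt_pow_right (by omega) (by omega)
  have h5 : d ^ 24 ≤ d ^ 32 := Nat.pow_le_pow_right (by omega) (by omega)
  have h6 : d ≤ d ^ 20 := Nat.le_self_pow (by omega) _
  obtain ⟨B, hBn⟩ : ∃ B, B = (d ^ 32) ^ n := ⟨_, rfl⟩
  rw [← hBn] at hB ⊢
  have hle : (d + (d * B + 1) * d) * (compSize d + 1) ≤ B ^ 2 := by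
    have hd2 : 2 * d ≤ d ^ 2 := by nlinarith
    have e1 : d + (d * B + 1) * d ≤ 2 * (d ^ 2 * B) := by nlinarith
    have e2 : compSize d + 1 ≤ 2 * d ^ 20 := by omega
    have h7 : 4 ≤ d ^ 2 := by nlinarith
    calc (d + (d * B + 1) * d) * (compSize d + 1) ≤ 2 * (d ^ 2 * B) * (2 * d ^ 20) := by gcongr
      _ = 4 * (d ^ 22 * B) := by ring
      _ ≤ d ^ 2 * (d ^ 22 * B) := by gcongr
      _ = d ^ 24 * B := by ring
      _ ≤ B * B := by gcongr; omega
      _ = B ^ 2 := by ring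
  refine ⟨⟨?_, ?_⟩, by omega, by omega, hle, by omega, ?_, by omega⟩
  · have := Nat.mul_le_mul_right B (show compSize d ≤ B by omega)
    rw [← hBn, pow_two]
    omega
  · have := Nat.le_self_pow (show 2 ≠ 0 by omega) B
    omega
  · refine le_trans ?_ (hle.trans (by omega))
    have h8 := Nat.le_mul_of_pos_right (d + (d * B + 1) * d) (show 0 < compSize d + 1 by omega)
    have h9 := Nat.le_mul_of_pos_right (d * B + 1) (show 0 < d by omega)
    omega

section
variable {K : Type u} [Field K] {N n M d k : ℕ}

/-- The program for `2 ≤ d`. From the input `(n, (d, hs))` it computes in turn `(M, (n, (d, hs)))`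
with `M = d ^ 32`, the tree `(V, (M, (n, (d, hs))))` with the list `V` of all exponent vectors, the
tree `(V, (W, (rows, d)))`, where `W` has the length `(M ^ n) ^ 2` and `rows` are the images of `hs`
under Kronecker substitution, and, by Gaussian elimination on all rows but the first one and by
splitting into coefficients, the input for `searchP`. -/
def decomposeP : Prog :=
  ((arg₁ ⨾ sqP ⨾ sqP ⨾ sqP ⨾ sqP ⨾ sqP) ⊠ .skip) ⨾
  ((((tl ⨾ hd) ⊠ hd) ⨾ vecsP) ⊠ .skip) ⨾
  (hd ⊠ ((hd ⨾ sqP) ⊠ (((arg₁ ⊠ (rest₂ ⨾ rest₂)) ⨾ mapP encPolyP) ⊠ (rest₂ ⨾ arg₁)))) ⨾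
  (hd ⊠ (arg₁ ⊠
    (((rest₃ ⊠ hd) ⊠ (arg₂ ⨾ tl ⨾ elimP)) ⨾ mapP (((hd ⨾ hd) ⊠ ((hd ⨾ tl) ⊠ tl)) ⨾ chunkP)) ⊠
    ((rest₃ ⊠ (hd ⊠ (arg₂ ⨾ hd))) ⨾ chunkP))) ⨾
  searchP

/-- The list of coefficients up to degree `d - 1`. -/
noncomputable def coeffList (d : ℕ) (h : PolyY K n) : List (MvPolynomial (Fin n) K) :=
  (List.range d).map h.coeff

theorem ofList_coeffList {h : PolyY K n} (hd : degXY h < d) : ofList (coeffList d h) = h := by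
  ext1 i
  rw [coeff_ofList, coeffList]
  by_cases hi : i < d
  · rw [List.getD_eq_getElem _ _ (by simpa using hi)]; simp
  · rw [List.getD_eq_default _ _ (by simp; omega),
      Polynomial.coeff_eq_zero_of_natDegree_lt (by have := natDegree_lt_of_degXY hd; omega)]

/-- The data that are considered for the equations `gs` and the inequation `g₀`. -/
def candidates (d b : ℕ) (gs : List (PolyY K n)) (g₀ : PolyY K n) :
    Set (Datum (MvPolynomial (Fin n) K)) :=
  {τ | ∃ g ∈ gs.map (coeffList d), ∃ j < d, ∃ m < d - j - 1, ∃ κ < b, ∃ s₁ ≤ d - j - 1 - m,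
    ∃ i < d - j - 1 - m, τ = mkDatum K (gs.map (coeffList d)) (coeffList d g₀) (g.reverse.drop j)
      m κ s₁ (i + 1)}

theorem wp_decomposeP (hn : 1 ≤ n) (hd : 2 ≤ d) {h : Fin (k + 1) → PolyY K n}
    (hh : ∀ i, degXY (h i) < d) {w : Val K} (hw : IsInput d h w) :
    wp (((d ^ n) ^ 32) ^ 2 + k + 1) decomposeP w fun y => ∃ L gs,
      ListRep (RepComp (d ^ 20 + d) (((d ^ n) ^ 32) ^ 2)) L y ∧ L.length ≤ k * (d ^ n) ^ 96 ∧
      Covers L (candidates d (((d ^ n) ^ 32) ^ 2) gs (h 0)) ∧ (∀ g ∈ gs, degXY g < d) ∧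
      d * gs.length < ((d ^ n) ^ 32) ^ 2 ∧
      ∀ W : Submodule K (PolyY K n), (∀ i : Fin k, h i.succ ∈ W) ↔ ∀ g ∈ gs, g ∈ W := by
  have hB := bounds (n := n) (k := k) hn hd
  obtain ⟨s1, s2, s3, s4, s5, s6, s7⟩ := hB.size_le
  have hpow : (d ^ 32) ^ n = (d ^ n) ^ 32 := by rw [← pow_mul, ← pow_mul, mul_comm]
  have hM : d ^ 32 ≤ (d ^ 32) ^ n := Nat.le_self_pow (by omega) _
  have hdM : d ≤ d ^ 32 := Nat.le_self_pow (by omega) _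
  have hlt := hB.lt
  have hleb := hB.le_b
  rw [← hpow]
  obtain ⟨N, hN⟩ : ∃ N, N = ((d ^ 32) ^ n) ^ 2 + k + 1 := ⟨_, rfl⟩
  rw [← hN] at hB s5 s6 ⊢
  have hBN : ((d ^ 32) ^ n) ^ 2 ≤ N := hB.b_le
  have hBB : (d ^ 32) ^ n ≤ ((d ^ 32) ^ n) ^ 2 := Nat.le_self_pow (by omega) _
  have hnN : n ≤ (d ^ 32) ^ n := (Nat.lt_pow_self (show 1 < d ^ 32 by omega)).le
  obtain ⟨c, hc, rfl⟩ := hw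
  simp only [decomposeP, wp, app_fst, app_snd]
  have hsq : ∀ e ≤ 16, d ^ e ≤ N := fun e he =>
    (Nat.pow_le_pow_right (by omega) (by omega : e ≤ 32)).trans (hM.trans s6)
  refine wp_mono (wp_sqP (counter_num d) (by omega)) fun m₁ hm₁ => ?_
  refine wp_mono (wp_sqP hm₁ (hsq 2 (by omega))) fun m₂ hm₂ => ?_
  rw [← pow_mul] at hm₂
  refine wp_mono (wp_sqP hm₂ (hsq 4 (by omega))) fun m₃ hm₃ => ?_
  rw [← pow_mul] at hm₃
  refine wp_mono (wp_sqP hm₃ (hsq 8 (by omega))) fun m₄ hm₄ => ?_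
  rw [← pow_mul] at hm₄
  refine wp_mono (wp_sqP hm₄ (hsq 16 (by omega))) fun m₅ hm₅ => ?_
  rw [← pow_mul] at hm₅
  change Counter (d ^ 32) m₅ at hm₅
  refine wp_mono (wp_vecsP (counter_num n) hm₅ (by omega) (by omega) fun i hi =>
    (Nat.pow_le_pow_right (by omega) hi).trans s6) fun V hV => ?_
  have hVc := hV.counter
  rw [length_vecs] at hVc
  refine wp_mono (wp_sqP hVc s6) fun W hW => ?_
  have hhs : ListRep (fun i x => IsCodeY x (h i)) (List.finRange (k + 1))
      (Val.list (List.ofFn c)) := by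
    rw [listRep_iff]
    refine ⟨_, rfl, List.forall₂_iff_get.2 ⟨by simp, fun i h1 h2 => ?_⟩⟩
    simp only [List.get_eq_getElem, List.getElem_ofFn, List.getElem_finRange]
    exact hc _
  refine wp_mono (wp_mapP (σ := RepRow (d ^ 32) d) (g := h) hhs (by simp; omega)
    fun i _ x hx => ?_) fun rows hrows => ?_
  · refine wp_mono (wp_encPolyP (by omega) (by omega) (by omega) hB.big (by omega) (by omega) s6 hm₅
      hx (hh i)) fun y hy => ⟨hy, hh i⟩
  rw [List.finRange_succ, List.map_cons] at hrows
  obtain ⟨r₀, rows, rfl, hr₀, hrows⟩ := hrows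
  simp only [app_fst, app_snd]
  refine wp_mono (wp_elimP hB.big (by omega) (by simp; omega) hrows
    (eq_zero_of_kronY_eq_zero hdM)) ?_
  rintro y ⟨gs, hgs, hl1, hl2, hspan⟩
  have hdeg : ∀ g ∈ gs, degXY g < d := fun g hg => by
    obtain ⟨ws, -, hws⟩ := listRep_iff.1 hgs
    obtain ⟨i, hi, rfl⟩ := List.getElem_of_mem hg
    exact ((List.forall₂_iff_get.1 hws).2 i hi (by rw [← hws.length_eq]; exact hi)).2
  have hkN := hB.k_le
  refine wp_mono (wp_mapP (g := coeffList d) (σ := ListRep (RepR (d ^ 32) d)) hgs (by omega)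
    fun g hg x hx => ?_) fun gl hgl => ?_
  · simp only [wp, app_fst, app_snd]
    exact wp_chunkP hdM (by omega) s6 (by omega) (counter_num d) hVc hx
  refine wp_mono (wp_chunkP hdM (by omega) s6 (by omega) (counter_num d) hVc hr₀) fun g₀ hg₀ => ?_
  refine wp_mono (wp_searchP hB (gs := gs.map (coeffList d)) (g₀ := coeffList d (h 0))
    (by simpa using hl2) (by simp [coeffList]) (by simp [coeffList]) hV hW hgl hg₀) ?_
  rintro y ⟨L, hL, hlen, hcov⟩
  refine ⟨L, gs, hL, hlen.trans ?_, hcov, hdeg, ?_, fun W => ?_⟩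
  · have e1 : d * (d * ((d + 1) * d)) ≤ d ^ 32 := calc
      d * (d * ((d + 1) * d)) ≤ d * (d * ((d * d) * d)) := by gcongr; nlinarith
      _ = d ^ 5 := by ring
      _ ≤ d ^ 32 := Nat.pow_le_pow_right (by omega) (by omega)
    calc _ ≤ k * (d * (d * (((d ^ 32) ^ n) ^ 2 * ((d + 1) * d)))) := by
          gcongr
          simpa using hl1
      _ = k * (((d ^ 32) ^ n) ^ 2 * (d * (d * ((d + 1) * d)))) := by ring
      _ ≤ k * (((d ^ 32) ^ n) ^ 2 * (d ^ 32) ^ n) := by gcongr; omega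
      _ = k * (d ^ n) ^ 96 := by rw [hpow]; ring
  · have h8 := Nat.le_mul_of_pos_right (d + (d * (d ^ 32) ^ n + 1) * d)
      (show 0 < compSize d + 1 by omega)
    have h9 : d * gs.length ≤ (d * (d ^ 32) ^ n + 1) * d := by
      rw [mul_comm]
      exact Nat.mul_le_mul_right _ hl2
    omega
  · rw [← hspan W]
    simp

end

/-! ### The decomposition -/

section
variable {K : Type u} [Field K] {n k d b N₂ : ℕ} {E : Type v} [Field E] [Algebra K E]

theorem valueAt_eq (z : (Fin n → E) × E) (p : PolyY K n) : valueAt z p =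
    (p.map ((MvPolynomial.aeval z.1 : MvPolynomial (Fin n) K →ₐ[K] E) :
      MvPolynomial (Fin n) K →+* E)).eval z.2 :=
  Polynomial.eval₂_eq_eval_map _

theorem valueAt_C (z : (Fin n → E) × E) (q : MvPolynomial (Fin n) K) :
    valueAt z (Polynomial.C q) = MvPolynomial.aeval z.1 q :=
  Polynomial.eval₂_C _ _

theorem mem_component_iff {x : PolyY K n × List (MvPolynomial (Fin n) K)}
    (hx : x.2.length = N₂ + 1) (z : (Fin n → E) × E) :
    z ∈ component E x.1 (fun t : Fin (N₂ + 1) => x.2.getD t 0) ↔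
      OnComp x (MvPolynomial.aeval z.1 : MvPolynomial (Fin n) K →ₐ[K] E) z.2 := by
  obtain ⟨p, l⟩ := x
  obtain ⟨a, l, rfl⟩ := List.exists_cons_of_ne_nil (l := l) (by rintro rfl; simp at hx)
  have hl : l.length = N₂ := by simpa using hx
  simp only [component, zeroSet, OnComp, Set.mem_ofPred_eq, Set.mem_insert_iff, Set.mem_range,
    forall_eq_or_imp, forall_exists_index, forall_apply_eq_imp_iff, valueAt_C, ← valueAt_eq,
    Fin.val_zero, Fin.val_succ, List.getD_cons_zero, List.getD_cons_succ, List.headD_cons,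
    List.tail_cons]
  constructor
  · rintro ⟨⟨h1, h2⟩, h3⟩
    refine ⟨h1, h3, fun e he => ?_⟩
    obtain ⟨i, hi, rfl⟩ := List.getElem_of_mem he
    have := h2 ⟨i, hl ▸ hi⟩
    rwa [List.getD_eq_getElem _ _ hi] at this
  · rintro ⟨h1, h3, h2⟩
    refine ⟨⟨h1, fun t => ?_⟩, h3⟩
    rw [List.getD_eq_getElem _ _ (hl ▸ t.2)]
    exact h2 _ (List.getElem_mem _)

/-- The polynomials that vanish at the point `z`. Gaussian elimination preserves the condition that
this subspace contains all equations. -/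
def vanishing (z : (Fin n → E) × E) : Submodule K (PolyY K n) where
  carrier := {p | valueAt z p = 0}
  add_mem' {p q} hp hq := by
    rw [Set.mem_ofPred_eq] at *
    rw [valueAt, Polynomial.eval₂_add, ← valueAt, ← valueAt, hp, hq, add_zero]
  zero_mem' := Polynomial.eval₂_zero _ _
  smul_mem' c p hp := by
    rw [Set.mem_ofPred_eq] at *
    rw [Algebra.smul_def, valueAt, Polynomial.eval₂_mul, ← valueAt, ← valueAt, hp, mul_zero]

/-- The polynomials whose first `d` coefficients vanish at the point `ξ`. -/
def coeffVanishing (d : ℕ) (ξ : Fin n → E) : Submodule K (PolyY K n) where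
  carrier := {p | ∀ j < d, MvPolynomial.aeval ξ (p.coeff j) = 0}
  add_mem' {p q} hp hq j hj := by rw [Polynomial.coeff_add, map_add, hp j hj, hq j hj, add_zero]
  zero_mem' j _ := by rw [Polynomial.coeff_zero, map_zero]
  smul_mem' c p hp j hj := by rw [Polynomial.coeff_smul, map_smul, hp j hj, smul_zero]

theorem valueAt_eq_zero_of_coeff {h : PolyY K n} (hd : degXY h < d) {z : (Fin n → E) × E}
    (hz : ∀ j < d, MvPolynomial.aeval z.1 (h.coeff j) = 0) : valueAt z h = 0 := by
  rw [valueAt, Polynomial.eval₂_eq_sum_range]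
  refine Finset.sum_eq_zero fun j hj => ?_
  have := natDegree_lt_of_degXY hd
  have h0 := hz j (by have := Finset.mem_range.1 hj; omega)
  exact mul_eq_zero_of_left h0 _

variable [CharZero K] [IsAlgClosed E]

/-- On the components that belong to candidates, the given equations and the given inequation hold,
and the separant does not vanish. -/
theorem sound_of_mem {gs : List (PolyY K n)} {g₀ : PolyY K n} (hgs : ∀ g ∈ gs, degXY g < d)
    (hg₀ : degXY g₀ < d) {τ : Datum (MvPolynomial (Fin n) K)} (hτ : τ ∈ candidates d b gs g₀)
    {x : PolyY K n × List (MvPolynomial (Fin n) K)} (hx : IsCompOf K τ x) {z : (Fin n → E) × E}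
    (hz : OnComp x (MvPolynomial.aeval z.1 : MvPolynomial (Fin n) K →ₐ[K] E) z.2) :
    (∀ g ∈ gs, valueAt z g = 0) ∧ valueAt z g₀ ≠ 0 ∧ valueAt z (Polynomial.derivative x.1) ≠ 0 := by
  obtain ⟨g, -, j, -, m, -, κ, -, s₁, -, i, -, rfl⟩ := hτ
  have := hx.sound (Nat.succ_ne_zero i) hz
  rw [ofList_coeffList hg₀] at this
  simp only [valueAt_eq]
  refine ⟨fun g hg => ?_, this.2⟩
  have h := this.1 (coeffList d g) (List.mem_map.2 ⟨g, hg, rfl⟩)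
  rwa [ofList_coeffList (hgs g hg)] at h

/-- Every solution at which some coefficient of an equation does not vanish lies on a component. -/
theorem exists_mem_of_solution {gs : List (PolyY K n)} {g₀ : PolyY K n}
    (hgs : ∀ g ∈ gs, degXY g < d) (hg₀ : degXY g₀ < d) (hb : d * gs.length < b)
    {L : List (PolyY K n × List (MvPolynomial (Fin n) K))} (hL : Covers L (candidates d b gs g₀))
    {z : (Fin n → E) × E} (hz : ∀ g ∈ gs, valueAt z g = 0) (hz₀ : valueAt z g₀ ≠ 0)
    (hne : ∃ g ∈ gs, ∃ j < d, MvPolynomial.aeval z.1 (g.coeff j) ≠ 0) :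
    ∃ x ∈ L, OnComp x (MvPolynomial.aeval z.1 : MvPolynomial (Fin n) K →ₐ[K] E) z.2 := by
  obtain ⟨g, hg, j, hj, hj'⟩ := hne
  have hlen : (coeffList d g).length = d := by simp [coeffList]
  obtain ⟨i, hi, m, hm, κ, hκ, s₁, hs₁, s, hs, hs', τ, hτ, hlead, h⟩ :=
    exists_mkDatum (K := K) (gs := gs.map (coeffList d)) (g₀ := coeffList d g₀)
      (g := coeffList d g) (f := MvPolynomial.aeval z.1) (η := z.2) (b := b)
      (List.mem_map.2 ⟨g, hg, rfl⟩)
      ⟨_, List.mem_map.2 ⟨j, List.mem_range.2 hj, rfl⟩, hj'⟩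
      (fun g' hg' => by
        obtain ⟨q, hq, rfl⟩ := List.mem_map.1 hg'
        rw [ofList_coeffList (hgs q hq), ← valueAt_eq]
        exact hz q hq)
      (by rwa [ofList_coeffList hg₀, ← valueAt_eq]) (by rwa [hlen, List.length_map])
  rw [hlen] at hi hm hs₁ hs'
  have hmem : τ ∈ candidates d b gs g₀ :=
    ⟨_, List.mem_map.2 ⟨g, hg, rfl⟩, i, hi, m, hm, κ, hκ, s₁, hs₁, s - 1, by omega, by
      rw [hτ, Nat.sub_add_cancel hs]⟩
  have hss : τ.s = s := by rw [hτ]; rfl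
  obtain ⟨x, hx, hx'⟩ := hL.2 τ hmem (by rwa [hss])
  exact ⟨x, hx, h x hx'⟩

/-- The decomposition, for equations `gs` with the same span as the given ones. -/
theorem zeroSet_eq_union {h : Fin (k + 1) → PolyY K n} (hh : ∀ i, degXY (h i) < d)
    {gs : List (PolyY K n)} (hgs : ∀ g ∈ gs, degXY g < d) (hb : d * gs.length < b)
    (hspan : ∀ W : Submodule K (PolyY K n), (∀ i : Fin k, h i.succ ∈ W) ↔ ∀ g ∈ gs, g ∈ W)
    {L : List (PolyY K n × List (MvPolynomial (Fin n) K))}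
    (hL : Covers L (candidates d b gs (h 0))) (hlen : ∀ x ∈ L, x.2.length = N₂ + 1) :
    zeroSet E (Set.range fun i : Fin k => h i.succ) (h 0) =
      (⋃ q : Fin L.length, component E L[q].1 fun t : Fin (N₂ + 1) => L[q].2.getD t 0) ∪
        zeroSet E {p | ∃ (i : Fin k) (j : ℕ), j < d ∧ p = Polynomial.C ((h i.succ).coeff j)}
          (h 0) := by
  have hl : ∀ q : Fin L.length, L[q].2.length = N₂ + 1 := fun q => hlen _ (List.getElem_mem _)
  ext z
  simp only [Set.mem_union, Set.mem_iUnion, mem_component_iff (hl _)]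
  constructor
  · rintro ⟨h1, h2⟩
    by_cases hc : ∀ i : Fin k, h i.succ ∈ coeffVanishing (K := K) d z.1
    · refine Or.inr ⟨?_, h2⟩
      rintro p ⟨i, j, hj, rfl⟩
      rw [valueAt_C]
      exact hc i j hj
    · refine Or.inl ?_
      rw [hspan] at hc
      push Not at hc
      obtain ⟨g, hg, hg'⟩ := hc
      obtain ⟨x, hx, hx'⟩ := exists_mem_of_solution hgs (hh 0) hb hL
        ((hspan (vanishing z)).1 fun i => h1 _ ⟨i, rfl⟩) h2
        ⟨g, hg, by by_contra! hcon; exact hg' hcon⟩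
      obtain ⟨i, hi, rfl⟩ := List.getElem_of_mem hx
      exact ⟨⟨i, hi⟩, hx'⟩
  · rintro (⟨q, hq⟩ | ⟨h1, h2⟩)
    · obtain ⟨τ, hτ, hx⟩ := hL.1 _ (List.getElem_mem q.2)
      have := sound_of_mem hgs (hh 0) hτ hx hq
      refine ⟨?_, this.2.1⟩
      rintro _ ⟨i, rfl⟩
      exact (hspan (vanishing z)).2 this.1 i
    · refine ⟨?_, h2⟩
      rintro _ ⟨i, rfl⟩
      refine valueAt_eq_zero_of_coeff (hh i.succ) fun j hj => ?_
      rw [← valueAt_C]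
      exact h1 _ ⟨i, j, hj, rfl⟩

end

section
variable {K : Type u} [Field K] {N n k d b N₂ D : ℕ}

theorem isOutput_of_listRep {L : List (PolyY K n × List (MvPolynomial (Fin n) K))} {y : Val K}
    (hL : ListRep (RepComp D b) L y) (hlen : ∀ x ∈ L, x.2.length = N₂ + 1) :
    IsOutput (fun q : Fin L.length => L[q].1)
      (fun q (t : Fin (N₂ + 1)) => L[q].2.getD t 0) y := by
  obtain ⟨ws, rfl, hws⟩ := listRep_iff.1 hL
  have hl := hws.length_eq
  have h : ∀ q : Fin L.length, ∃ u, ∃ v : Fin (N₂ + 1) → Val K,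
      ws[(q : ℕ)] = .cons u (.list (List.ofFn v)) ∧ IsCodeY u L[q].1 ∧
      ∀ t, IsCodeX (v t) (L[q].2.getD t 0) := fun q => by
    obtain ⟨⟨u, v, h1, h2, h3⟩, -⟩ := (List.forall₂_iff_get.1 hws).2 q q.2 (hl ▸ q.2)
    obtain ⟨vs, rfl, hvs⟩ := listRep_iff.1 h3
    have hl' : L[(q : ℕ)].2.length = N₂ + 1 := hlen _ (List.getElem_mem _)
    have hl'' := hvs.length_eq
    simp only [List.get_eq_getElem] at hl'' h1
    refine ⟨u, fun t => vs[(t : ℕ)], ?_, h2, fun t => ?_⟩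
    · rw [h1]
      congr 2
      exact List.ext_getElem (by rw [List.length_ofFn]; omega) fun i h1 h2 => by
        rw [List.getElem_ofFn]
    · have ht : (t : ℕ) < L[(q : ℕ)].2.length := by omega
      have := (List.forall₂_iff_get.1 hvs).2 t ht (by omega)
      simp only [Fin.getElem_fin]
      rw [List.getD_eq_getElem _ _ ht]
      exact this
  choose u v h1 h2 h3 using h
  refine ⟨u, v, h2, h3, ?_⟩
  congr 1
  exact List.ext_getElem (by rw [List.length_ofFn, hl]) fun i h4 h5 => by
    rw [List.getElem_ofFn, ← h1]

/-- The program of the algorithm. If `d = 1`, then all polynomials are constant in `Y`, and there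
are no components. -/
def mainP : Prog := .branch (arg₁ ⨾ tl) decomposeP nilP

theorem wp_mainP (hd : 2 ≤ d) {h : Fin (k + 1) → PolyY K n} {w : Val K} (hw : IsInput d h w)
    {P : Val K → Prop} (hP : wp N decomposeP w P) : wp N mainP w P := by
  refine ⟨fun _ => hP, fun h0 => ?_⟩
  obtain ⟨c, -, rfl⟩ := hw
  obtain ⟨e, rfl⟩ := Nat.exists_eq_add_of_le' hd
  have h1 : Val.cons .nil (Val.num e) = (Val.nil : Val K) := h0
  nomatch h1

end

end QuasiGCD

open QuasiGCD
theorem mainTheorem3 :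
    ∃ (A : Prog) (P Q : Polynomial ℕ) (T : MvPolynomial (Fin 2) ℕ),
      ∀ (K : Type u) [Field K] [CharZero K] (n k d : ℕ) (_ : 1 ≤ n)
        (h : Fin (k + 1) → PolyY K n) (_ : ∀ i, degXY (h i) < d)
        (input : Val K) (_ : IsInput d h input),
        ∃ (output : Val K) (time N₁ N₂ : ℕ) (Ψ : Fin N₁ → PolyY K n)
          (g : Fin N₁ → Fin (N₂ + 1) → MvPolynomial (Fin n) K),
          -- the computation and its running time
          A.Runs input output time ∧ IsOutput Ψ g output ∧
          time ≤ MvPolynomial.eval ![k, d ^ n] T ∧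
          -- the decomposition, over every algebraically closed extension
          (∀ (E : Type v) [Field E] [Algebra K E] [IsAlgClosed E],
            zeroSet E (Set.range fun i : Fin k => h i.succ) (h 0) =
              (⋃ q, component E (Ψ q) (g q)) ∪
                zeroSet E {p | ∃ (i : Fin k) (j : ℕ), j < d ∧
                  p = Polynomial.C ((h i.succ).coeff j)} (h 0)) ∧
          -- initials and separants
          (∀ q, 0 < (Ψ q).natDegree ∧ (Ψ q).leadingCoeff ∣ g q 0) ∧
          (∀ (E : Type v) [Field E] [Algebra K E] [IsAlgClosed E] (q : Fin N₁),
            ∀ z ∈ component E (Ψ q) (g q), valueAt z (Polynomial.derivative (Ψ q)) ≠ 0) ∧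
          -- degrees and numbers of polynomials
          (∀ q, degXY (Ψ q) ≤ P.eval d ∧ ∀ t, (g q t).totalDegree ≤ P.eval d) ∧
          N₁ ≤ k * Q.eval (d ^ n) ∧ N₂ ≤ k * Q.eval (d ^ n) := by
  refine ⟨mainP, Polynomial.X ^ 20 + Polynomial.X, Polynomial.X ^ 96,
    mainP.cost.eval₂ MvPolynomial.C (MvPolynomial.X 1 ^ 64 + MvPolynomial.X 0 + 1), ?_⟩
  intro K _ _ n k d hn h hh input hin
  have hT : MvPolynomial.eval ![k, d ^ n] (mainP.cost.eval₂ MvPolynomial.C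
      (MvPolynomial.X 1 ^ 64 + MvPolynomial.X 0 + 1)) =
      mainP.cost.eval (((d ^ n) ^ 32) ^ 2 + k + 1) := by
    rw [Polynomial.hom_eval₂, show (MvPolynomial.eval ![k, d ^ n]).comp MvPolynomial.C =
      RingHom.id ℕ from RingHom.ext fun x => MvPolynomial.eval_C x, Polynomial.eval₂_id, map_add,
      map_add, map_pow, MvPolynomial.eval_X, MvPolynomial.eval_X, map_one, ← pow_mul (d ^ n) 32 2]
    rfl
  rw [hT]
  by_cases hd : 2 ≤ d
  · have hwp := wp_mainP hd hin (wp_decomposeP hn hd hh hin)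
    obtain ⟨y, t, hrun, ht, L, gs, hL, hlen, hcov, hdeg, hb, hspan⟩ := exists_runs_of_wp hwp
    obtain ⟨ws, -, hws⟩ := listRep_iff.1 hL
    have hrep : ∀ x ∈ L, x.2.length = ((d ^ n) ^ 32) ^ 2 + 1 ∧ degXY x.1 ≤ d ^ 20 + d ∧
        ∀ t ∈ x.2, t.totalDegree ≤ d ^ 20 + d := fun x hx => by
      obtain ⟨i, hi, rfl⟩ := List.getElem_of_mem hx
      exact ((List.forall₂_iff_get.1 hws).2 i hi (by rw [← hws.length_eq]; exact hi)).2
    have hk : ∀ x ∈ L, k ≠ 0 := fun x hx h0 => by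
      rw [h0, zero_mul, Nat.le_zero, List.length_eq_zero_iff] at hlen
      rw [hlen] at hx
      exact List.not_mem_nil hx
    have hlen2 : ∀ x ∈ L, x.2.length = (if k = 0 then 0 else ((d ^ n) ^ 32) ^ 2) + 1 :=
      fun x hx => by rw [if_neg (hk x hx)]; exact (hrep x hx).1
    -- If `k = 0`, then there are no components, and the number `N₂` has to be set to zero.
    refine ⟨y, t, L.length, if k = 0 then 0 else ((d ^ n) ^ 32) ^ 2, fun q => L[q].1,
      fun q t => L[q].2.getD t 0, hrun, isOutput_of_listRep hL hlen2, ht, ?_, fun q => ?_, ?_,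
      fun q => ?_, by simpa using hlen, ?_⟩
    · intro E _ _ _
      exact zeroSet_eq_union hh hdeg hb hspan hcov hlen2
    · obtain ⟨τ, ⟨g, -, j, -, m, -, κ, -, s₁, -, i, -, rfl⟩, hx⟩ := hcov.1 _ (List.getElem_mem q.2)
      refine ⟨?_, ?_⟩
      · exact hx.natDegree ▸ Nat.succ_pos i
      · refine dvd_of_eq (hx.leadingCoeff.trans ?_)
        obtain ⟨-, es, h2, -⟩ := hx
        simp only [Fin.getElem_fin, Fin.val_zero]
        rw [h2]
        rfl
    · intro E _ _ _ q z hz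
      obtain ⟨τ, hτ, hx⟩ := hcov.1 _ (List.getElem_mem q.2)
      exact (sound_of_mem hdeg (hh 0) hτ hx
        ((mem_component_iff (hlen2 _ (List.getElem_mem q.2)) z).1 hz)).2.2
    · have := hrep _ (List.getElem_mem q.2)
      simp only [Polynomial.eval_add, Polynomial.eval_pow, Polynomial.eval_X]
      refine ⟨this.2.1, fun t => this.2.2 _ ?_⟩
      have h3 := hlen2 _ (List.getElem_mem q.2)
      simp only [Fin.getElem_fin]
      rw [List.getD_eq_getElem _ _ (by rw [h3]; exact t.2)]
      exact List.getElem_mem _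
    · split_ifs with h0
      · exact Nat.zero_le _
      · rw [Polynomial.eval_pow, Polynomial.eval_X, ← pow_mul]
        refine le_trans (Nat.pow_le_pow_right ?_ (by omega)) (Nat.le_mul_of_pos_left _ (by omega))
        exact Nat.pow_pos (by omega)
  · -- All polynomials are constant in `Y`, and equal to their coefficients of degree `0`.
    obtain rfl : d = 1 := by have := hh 0; omega
    have hwp : wp (((1 ^ n) ^ 32) ^ 2 + k + 1) mainP input (fun y => y = .nil) := by
      obtain ⟨c, -, rfl⟩ := hin
      exact ⟨fun h => absurd rfl h, fun _ => rfl⟩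
    obtain ⟨_, t, hrun, ht, rfl⟩ := exists_runs_of_wp hwp
    refine ⟨.nil, t, 0, 0, Fin.elim0, fun q => q.elim0, hrun, ⟨Fin.elim0, fun q => q.elim0,
      fun q => q.elim0, fun q => q.elim0, rfl⟩, ht, ?_, fun q => q.elim0, fun _ _ _ _ q => q.elim0,
      fun q => q.elim0, Nat.zero_le _, Nat.zero_le _⟩
    intro E _ _ _
    have hC : ∀ i, h i = Polynomial.C ((h i).coeff 0) := fun i =>
      Polynomial.eq_C_of_natDegree_eq_zero (by have := natDegree_lt_of_degXY (hh i); omega)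
    rw [Set.iUnion_of_empty, Set.empty_union]
    congr 1
    ext p
    simp only [Set.mem_range, Set.mem_ofPred_eq, Nat.lt_one_iff]
    constructor
    · rintro ⟨i, rfl⟩
      exact ⟨i, 0, rfl, hC _⟩
    · rintro ⟨i, j, rfl, rfl⟩
      exact ⟨i, hC _⟩
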